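/- **Setting.** Let $a,p\ge 1$, $c\ge 0$. For subject $j\ge 1$ of group $i\in\{1,\dots,a\}$ let $z_{ij}\in\mathbb R^c$ be fixed covariates and let $\epsilon_{ij}$ be random vectors in $\mathbb R^p$. For $\beta=(\mu',\nu')'\in\mathbb R^{(a+c)p}$, with $\mu=(\mu_1',\dots,\mu_a')'$ and $\nu=(\nu^{(1)\prime},\dots,\nu^{(c)\prime})'$, the observations under $P_\beta$ are $$Y_{ij}=\mu_i+\sum_{w=1}^c z_{ij}^{(w)}\nu^{(w)}+\epsilon_{ij},\qquad 1\le i\le a,\ 1\le j\le n_i .$$ Consider group sizes $(n_1,\dots,n_a)$ running through a sequence with $N=\sum_i n_i\to\infty$. Let $X=(\bigoplus_{i=1}^a 1_{n_i},Z)$, where $Z$ has the rows $z_{ij}'$, $x_{ij}'$ the row of $X$ belonging to subject $(i,j)$, and $\tilde X=X\otimes I_p$, so that $Y=\tilde X\beta+\epsilon$. Assume: 1. the $\epsilon_{ij}$ are independent, $E\epsilon_{ij}=0$, $\mathrm{Cov}(\epsilon_{ij})=\Sigma_i$, and $E\epsilon_{ijk}^4\le C_1<\infty$ for all $i,j,k$;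 2. $\Sigma_i\ge 0$ (possibly singular) and $\sigma_{ik}^2=(\Sigma_i)_{kk}>0$ for all $i,k$; 3. $N/n_i\to\kappa_i>0$ for all $i$; 4. $X$ has full column rank for all large $N$, and the limit $\Xi=\lim N^{-1}X'X$ is nonsingular; 5. $\frac1n\sum_{j=1}^n z_{ij}$ converges in $\mathbb R^c$ as $n\to\infty$, for all $i$; 6. $\frac1n\sum_{j=1}^n z_{ij}z_{ij}'$ converges in $\mathbb R^{c\times c}$ as $n\to\infty$, for all $i$. **Test statistic.** Let $H$ be a real matrix with $ap$ columns (for example a contrast matrix), $T=H'(HH')^+H$ with $^+$ the Moore-Penrose inverse, $\hat\beta=(\hat\mu',\hat\nu')'=(\tilde X'\tilde X)^{-1}\tilde X'Y$, $u_{ij}$ the residual vectors, $\hat\sigma_{ik}^2=(n_i-c-1)^{-1}\sum_{j=1}^{n_i}u_{ijk}^2$, $\hat D=\mathrm{diag}(n_1^{-1}\hat\sigma_{11}^2,\dots,n_1^{-1}\hat\sigma_{1p}^2,\dots,n_a^{-1}\hat\sigma_{ap}^2)$, and $$A(T)=\hat\mu'T'(T\hat DT)^+T\hat\mu .$$ Let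 $\Lambda_{11}$ be the upper-left $ap\times ap$ block of $\lim\,(N^{-1}\tilde X'\tilde X)^{-1}(N^{-1}\tilde X'\mathrm{Cov}(\epsilon)\tilde X)(N^{-1}\tilde X'\tilde X)^{-1}$ (the limit exists under 1-6). Assume moreover 7. $T\Lambda_{11}T\ne 0$, i.e. the limiting null distribution of $A(T)$ is not the point mass at $0$. **Wild bootstrap.** Let $T_{ij}$ be i.i.d. real random variables, independent of the errors, with $E T_{11}=0$, $\mathrm{Var}(T_{11})=1$, $E T_{11}^4<\infty$. Put $Y_{ij}^*=u_{ij}T_{ij}/\sqrt{1-p_{ij,ij}}$ with $p_{ij,ij}=x_{ij}'(X'X)^{-1}x_{ij}$, and let $A^*(T)$ be the statistic $A(T)$ computed from the $Y^*_{ij}$ (same $X$) in place of the $Y_{ij}$. **Theorem.** (i) For every $\beta\in\mathbb R^{(a+c)p}$ and every $\beta_0=(\mu_0',\nu_0')'\in\mathbb R^{(a+c)p}$ with $T\mu_0=0$, $$\sup_{x\in\mathbb R}\bigl|P_\beta(A^*(T)\le x\mid Y)-P_{\beta_0}(A(T)\le x)\bigr|\longrightarrow 0\quad\text{in probability as }N\to\infty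 .$$ (ii) Consequently the wild bootstrap MANCATS test is asymptotically valid: if $T\mu=0$, $0<\alpha<1$, and $q^*_{1-\alpha}(Y)$ denotes the $(1-\alpha)$-quantile of the conditional distribution of $A^*(T)$ given $Y$ under $P_\beta$, then $P_\beta\bigl(A(T)>q^*_{1-\alpha}(Y)\bigr)\to\alpha$. -/

import Mathlib

open MeasureTheory ProbabilityTheory Filter Topology
open scoped Matrix Kronecker

noncomputable section

namespace Mancova

/-! ### Moore-Penrose inverse of a real matrix -/

/-- The four Penrose equations: `B` is the Moore-Penrose inverse of `A`. -/
structure IsMoorePenrose {r s : Type*} [Fintype r] [Fintype s]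
    (A : Matrix r s ℝ) (B : Matrix s r ℝ) : Prop where
  mul_mul : A * B * A = A
  inv_mul_inv : B * A * B = B
  symm_left : (A * B)ᵀ = A * B
  symm_right : (B * A)ᵀ = B * A

/-- Every real matrix has a Moore-Penrose inverse. -/
theorem exists_isMoorePenrose {r s : Type*} [Fintype r] [Fintype s]
    (A : Matrix r s ℝ) : ∃ B : Matrix s r ℝ, IsMoorePenrose A B := by
  classical
  have hS : (Aᵀ * A).IsHermitian := by
    simpa using Matrix.isHermitian_conjTranspose_mul_self A
  obtain ⟨U, d, hU, hU', hd⟩ : ∃ (U : Matrix s s ℝ) (d : s → ℝ), Uᵀ * U = 1 ∧ U * Uᵀ = 1 ∧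
      Aᵀ * A = U * Matrix.diagonal d * Uᵀ := by
    refine ⟨hS.eigenvectorUnitary, hS.eigenvalues, ?_, ?_, ?_⟩
    · have h := Matrix.mem_unitaryGroup_iff'.mp hS.eigenvectorUnitary.2
      rwa [Matrix.star_eq_conjTranspose, Matrix.conjTranspose_eq_transpose_of_trivial] at h
    · have h := Matrix.mem_unitaryGroup_iff.mp hS.eigenvectorUnitary.2
      rwa [Matrix.star_eq_conjTranspose, Matrix.conjTranspose_eq_transpose_of_trivial] at h
    · have h := hS.spectral_theorem
      rw [Unitary.conjStarAlgAut_apply] at h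
      simpa [Matrix.star_eq_conjTranspose, Function.comp_def] using h
  set G : Matrix s s ℝ := U * Matrix.diagonal (fun i => (d i)⁻¹) * Uᵀ with hG
  have key : ∀ f g : s → ℝ, (U * Matrix.diagonal f * Uᵀ) * (U * Matrix.diagonal g * Uᵀ)
      = U * Matrix.diagonal (fun i => f i * g i) * Uᵀ := by
    intro f g
    calc (U * Matrix.diagonal f * Uᵀ) * (U * Matrix.diagonal g * Uᵀ)
        = U * Matrix.diagonal f * (Uᵀ * U) * Matrix.diagonal g * Uᵀ := by
          simp only [Matrix.mul_assoc]
      _ = U * Matrix.diagonal (fun i => f i * g i) * Uᵀ := by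
          rw [hU, Matrix.mul_one, Matrix.mul_assoc U, Matrix.diagonal_mul_diagonal]
  have tr : ∀ f : s → ℝ, (U * Matrix.diagonal f * Uᵀ)ᵀ = U * Matrix.diagonal f * Uᵀ := by
    intro f
    simp [Matrix.transpose_mul, Matrix.mul_assoc]
  have hGt : Gᵀ = G := tr _
  have hGS : G * (Aᵀ * A) = U * Matrix.diagonal (fun i => (d i)⁻¹ * d i) * Uᵀ := by
    rw [hd, hG, key]
  have hGSt : (G * (Aᵀ * A))ᵀ = G * (Aᵀ * A) := by rw [hGS, tr]
  have hSGS : Aᵀ * A * (G * (Aᵀ * A)) = Aᵀ * A := by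
    rw [hGS, hd, key]
    congr 3
    ext i
    by_cases h : d i = 0 <;> simp [h]
  have hGSG : G * (Aᵀ * A) * G = G := by
    rw [hGS, hG, key]
    congr 3
    ext i
    by_cases h : d i = 0 <;> simp [h]
  refine ⟨G * Aᵀ, ?_, ?_, ?_, ?_⟩
  · have h0 : Aᵀ * (A * (G * (Aᵀ * A)) - A) = 0 := by
      rw [Matrix.mul_sub, ← Matrix.mul_assoc Aᵀ A (G * (Aᵀ * A)), hSGS, sub_self]
    have h1 : (A * (G * (Aᵀ * A)) - A)ᴴ * (A * (G * (Aᵀ * A)) - A) = 0 := by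
      have : (A * (G * (Aᵀ * A)) - A)ᴴ = (G * (Aᵀ * A) - 1)ᵀ * Aᵀ := by
        rw [Matrix.conjTranspose_eq_transpose_of_trivial, ← Matrix.transpose_mul,
          Matrix.mul_sub, Matrix.mul_one]
      rw [this, Matrix.mul_assoc, h0, Matrix.mul_zero]
    have h2 := sub_eq_zero.mp (Matrix.conjTranspose_mul_self_eq_zero.mp h1)
    simpa only [Matrix.mul_assoc] using h2
  · calc G * Aᵀ * A * (G * Aᵀ) = (G * (Aᵀ * A) * G) * Aᵀ := by simp only [Matrix.mul_assoc]
      _ = G * Aᵀ := by rw [hGSG]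
  · rw [Matrix.transpose_mul, Matrix.transpose_mul, Matrix.transpose_transpose, hGt,
      Matrix.mul_assoc]
  · simpa only [Matrix.mul_assoc] using hGSt

/-- The Moore-Penrose inverse `A⁺`. -/
def pinv {r s : Type*} [Fintype r] [Fintype s] (A : Matrix r s ℝ) : Matrix s r ℝ :=
  (exists_isMoorePenrose A).choose

/-- The projector form `T = H' (H H')⁺ H` of a hypothesis matrix `H`. -/
def hypProjector {r s : Type*} [Fintype r] [Fintype s] (H : Matrix r s ℝ) : Matrix s s ℝ :=
  Hᵀ * pinv (H * Hᵀ) * H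

/-! ### The model

There are `a` groups, `p` outcomes and `c` covariates; `n i` is the size of group `i`, and
`z i j` is the covariate vector of subject `j` of group `i` (subjects are numbered from `0`). -/

/-- The subjects: pairs of a group `i` and a number `j < n i`. -/
abbrev Subj {a : ℕ} (n : Fin a → ℕ) : Type := (i : Fin a) × Fin (n i)

/-- The total sample size `N`. -/
def totalSize {a : ℕ} (n : Fin a → ℕ) : ℕ := ∑ i, n i

/-- Parameter vectors `β = (μ', ν')'`: the entry `(inl i, k)` is `μ_{ik}` and the entry
`(inr w, k)` is `ν_k^{(w)}`. -/
abbrev Param (a c p : ℕ) : Type := (Fin a ⊕ Fin c) × Fin p → ℝ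

/-- The part `μ` of a parameter vector `β = (μ', ν')'`. -/
def meanPart {a c p : ℕ} (β : Param a c p) : Fin a × Fin p → ℝ :=
  fun q => β (Sum.inl q.1, q.2)

section Statistic

variable {a c p : ℕ} (n : Fin a → ℕ) (z : Fin a → ℕ → Fin c → ℝ)

/-- The matrix `X = (⨁ᵢ 1_{nᵢ}, Z)`. -/
def designMatrix : Matrix (Subj n) (Fin a ⊕ Fin c) ℝ :=
  Matrix.of fun s => Sum.elim (fun i => if s.1 = i then 1 else 0) (fun w => z s.1 s.2 w)

/-- The matrix `X̃ = X ⊗ I_p`. -/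
def fullDesign (p : ℕ) : Matrix (Subj n × Fin p) ((Fin a ⊕ Fin c) × Fin p) ℝ :=
  designMatrix n z ⊗ₖ (1 : Matrix (Fin p) (Fin p) ℝ)

/-- The ordinary least squares estimator `(X̃'X̃)⁻¹ X̃' Y`. -/
def olsEstimator (Y : Subj n × Fin p → ℝ) : Param a c p :=
  (((fullDesign n z p)ᵀ * fullDesign n z p)⁻¹ * (fullDesign n z p)ᵀ) *ᵥ Y

/-- The residuals `u_{ijk}`. -/
def residual (Y : Subj n × Fin p → ℝ) : Subj n × Fin p → ℝ :=
  Y - fullDesign n z p *ᵥ olsEstimator n z Y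

/-- The variance estimators `σ̂²_{ik} = (n_i - c - 1)⁻¹ ∑_j u²_{ijk}`. -/
def varEstimator (Y : Subj n × Fin p → ℝ) (i : Fin a) (k : Fin p) : ℝ :=
  ((n i : ℝ) - c - 1)⁻¹ * ∑ j : Fin (n i), residual n z Y (⟨i, j⟩, k) ^ 2

/-- The diagonal matrix `D̂` with entries `n_i⁻¹ σ̂²_{ik}`. -/
def diagEstimator (Y : Subj n × Fin p → ℝ) : Matrix (Fin a × Fin p) (Fin a × Fin p) ℝ :=
  Matrix.diagonal fun q => (n q.1 : ℝ)⁻¹ * varEstimator n z Y q.1 q.2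

/-- The MANCATS statistic `A(T) = μ̂' T' (T D̂ T)⁺ T μ̂` as a function of the observations. -/
def mancats (T : Matrix (Fin a × Fin p) (Fin a × Fin p) ℝ) (Y : Subj n × Fin p → ℝ) : ℝ :=
  meanPart (olsEstimator n z Y) ⬝ᵥ
    ((Tᵀ * pinv (T * diagEstimator n z Y * T) * T) *ᵥ meanPart (olsEstimator n z Y))

/-- The leverage `p_{ij,ij}`, a diagonal entry of the hat matrix `X (X'X)⁻¹ X'`. -/
def leverage (s : Subj n) : ℝ :=
  (designMatrix n z * ((designMatrix n z)ᵀ * designMatrix n z)⁻¹ * (designMatrix n z)ᵀ) s s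

/-- The wild bootstrap observations `Y*_{ij} = u_{ij} t_{ij} / √(1 - p_{ij,ij})`. -/
def wildObs (Y : Subj n × Fin p → ℝ) (t : Subj n → ℝ) : Subj n × Fin p → ℝ :=
  fun q => residual n z Y q * (t q.1 / √(1 - leverage n z q.1))

/-- The wild bootstrap statistic `A*(T)`: the MANCATS of the wild bootstrap observations. -/
def wildMancats (T : Matrix (Fin a × Fin p) (Fin a × Fin p) ℝ)
    (Y : Subj n × Fin p → ℝ) (t : Subj n → ℝ) : ℝ :=
  mancats n z T (wildObs n z Y t)

/-- The covariance matrix `⨁ᵢ (I_{nᵢ} ⊗ Σᵢ)` of the stacked error vector. -/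
def errorCov (Sig : Fin a → Matrix (Fin p) (Fin p) ℝ) :
    Matrix (Subj n × Fin p) (Subj n × Fin p) ℝ :=
  Matrix.of fun q q' => if q.1 = q'.1 then Sig q.1.1 q.2 q'.2 else 0

/-- The upper-left (adjusted means) block of
`(N⁻¹ X̃'X̃)⁻¹ (N⁻¹ X̃' Cov(ε) X̃) (N⁻¹ X̃'X̃)⁻¹`. -/
def scaledMeanCov (Sig : Fin a → Matrix (Fin p) (Fin p) ℝ) :
    Matrix (Fin a × Fin p) (Fin a × Fin p) ℝ :=
  (((totalSize n : ℝ)⁻¹ • ((fullDesign n z p)ᵀ * fullDesign n z p))⁻¹ *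
    ((totalSize n : ℝ)⁻¹ • ((fullDesign n z p)ᵀ * errorCov n Sig * fullDesign n z p)) *
    ((totalSize n : ℝ)⁻¹ • ((fullDesign n z p)ᵀ * fullDesign n z p))⁻¹).submatrix
      (fun q => (Sum.inl q.1, q.2)) (fun q => (Sum.inl q.1, q.2))

/-- The observations `Y = X̃ β + ε` under the parameter `β`. -/
def dataVec {Ω : Type*} (ε : Fin a → ℕ → Ω → Fin p → ℝ) (β : Param a c p) (ω : Ω) :
    Subj n × Fin p → ℝ :=
  fun q => (fullDesign n z p *ᵥ β) q + ε q.1.1 q.1.2 ω q.2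

/-- The multipliers `T_{ij}` of the subjects of the sample. -/
def weightVec {Ω : Type*} (τ : Fin a → ℕ → Ω → ℝ) (ω : Ω) : Subj n → ℝ :=
  fun s => τ s.1 s.2 ω

/-- The (regular) conditional distribution of `A*(T)` given the observations `Y`, under `β`, as a
function of the observed value of `Y`. -/
def wildCondLaw {Ω : Type*} [MeasurableSpace Ω] (P : Measure Ω) [IsFiniteMeasure P]
    (ε : Fin a → ℕ → Ω → Fin p → ℝ) (τ : Fin a → ℕ → Ω → ℝ)
    (T : Matrix (Fin a × Fin p) (Fin a × Fin p) ℝ) (β : Param a c p)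
    (y : Subj n × Fin p → ℝ) : Measure ℝ :=
  condDistrib (fun ω => wildMancats n z T (dataVec n z ε β ω) (weightVec n τ ω))
    (dataVec n z ε β) P y

end Statistic

/-- The `q`-quantile of a probability distribution on the line. -/
def quantile (ρ : Measure ℝ) (q : ℝ) : ℝ := sInf {x : ℝ | q ≤ ρ.real (Set.Iic x)}

end Mancova

end

open Mancova

/-!
The statistic depends on the data only through the least squares estimator of the means and the
variance estimators, and under the hypothesis only through the errors (`mancats_add_mulVec`). For an
arbitrary array of independent centred error vectors whose second moments stabilize and whose fourth
moments satisfy a Lyapunov condition (`ErrorLimit`), the estimator of the means is asymptotically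
normal by a Lyapunov central limit theorem (`tendstoInDistribution_sum_of_lyapunov`), and the
variance estimators are consistent. Since `T` is a symmetric idempotent and the variances are
positive, `T (T D T)⁺ T` depends continuously on `D` (`pinv_mul_diagonal_mul`), so the statistic
converges in law to a quadratic form of a Gaussian vector (`ErrorLimit.tendsto_mancats`). This limit
law has no atoms, because `T Λ₁₁ T ≠ 0` (`waldForm_gaussian_eq_zero`), and by Pólya's theorem the
distribution functions converge uniformly.

The true errors form such an array (`errorLimit_of_groupCov`). Given the data, the wild bootstrap
errors are again independent and centred, and their moments are explicit functions of the residuals.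
The discrepancy `wildGap` between the moments of the bootstrap errors and those of the true errors
tends to `0` in mean (`ErrorLimit.tendsto_integral_wildGap`): residuals are close to errors,
leverages are uniformly small, and weighted averages of products of errors concentrate. Along every
sequence of data sets with vanishing discrepancy the bootstrap errors satisfy `ErrorLimit`
with the same limits as the true errors (`ErrorLimit.wildArray`). Arguing by contradiction with such sequences, a small
discrepancy forces the law of the bootstrap statistic to be uniformly close to the limit law
(`ErrorLimit.exists_wildGap_lt`), and by Markov's inequality the discrepancy is small with
probability close to one. By independence of multipliers and errors, the conditional law of the
bootstrap statistic is its law for fixed data (`wildCondLaw_ae_eq`); this needs measurability of the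
statistic, and the Moore-Penrose inverse is indeed a Borel function (`measurable_pinv_apply`).

The validity of the test follows, since quantiles of laws that are uniformly close to a continuous
law are asymptotically correct critical values (`tendsto_measureReal_quantile_lt`).
-/

namespace Mancova

/-! ### Moore-Penrose inverses -/

section MoorePenrose

variable {r s : Type*} [Fintype r] [Fintype s]

theorem isMoorePenrose_pinv (A : Matrix r s ℝ) : IsMoorePenrose A (pinv A) :=
  (exists_isMoorePenrose A).choose_spec

theorem IsMoorePenrose.unique {A : Matrix r s ℝ} {B C : Matrix s r ℝ}
    (hB : IsMoorePenrose A B) (hC : IsMoorePenrose A C) : B = C := by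
  have h1 : A * B = A * C := by
    calc A * B = (A * B)ᵀ := hB.symm_left.symm
      _ = (A * C * (A * B))ᵀ := by rw [← Matrix.mul_assoc, hC.mul_mul]
      _ = A * B * (A * C) := by rw [Matrix.transpose_mul, hB.symm_left, hC.symm_left]
      _ = A * C := by rw [← Matrix.mul_assoc, hB.mul_mul]
  have h2 : B * A = C * A := by
    calc B * A = (B * A)ᵀ := hB.symm_right.symm
      _ = (B * A * (C * A))ᵀ := by
        rw [Matrix.mul_assoc B A, ← Matrix.mul_assoc A C A, hC.mul_mul]
      _ = C * A * (B * A) := by rw [Matrix.transpose_mul, hB.symm_right, hC.symm_right]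
      _ = C * A := by rw [Matrix.mul_assoc C A, ← Matrix.mul_assoc A B A, hB.mul_mul]
  calc B = B * A * B := hB.inv_mul_inv.symm
    _ = C * (A * B) := by rw [h2, Matrix.mul_assoc]
    _ = C := by rw [h1, ← Matrix.mul_assoc, hC.inv_mul_inv]

theorem IsMoorePenrose.pinv_eq {A : Matrix r s ℝ} {B : Matrix s r ℝ}
    (h : IsMoorePenrose A B) : pinv A = B :=
  (isMoorePenrose_pinv A).unique h

theorem pinv_smul (A : Matrix r s ℝ) {t : ℝ} (ht : t ≠ 0) : pinv (t • A) = t⁻¹ • pinv A := by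
  have h := isMoorePenrose_pinv A
  refine IsMoorePenrose.pinv_eq ⟨?_, ?_, ?_, ?_⟩
  · simp [smul_smul, ht, h.mul_mul]
  · simp [smul_smul, ht, h.inv_mul_inv]
  · simp [smul_smul, ht, h.symm_left]
  · simp [smul_smul, ht, h.symm_right]

theorem pinv_transpose (A : Matrix r s ℝ) : pinv Aᵀ = (pinv A)ᵀ := by
  have h := isMoorePenrose_pinv A
  refine IsMoorePenrose.pinv_eq ⟨?_, ?_, ?_, ?_⟩
  · rw [← Matrix.transpose_mul, ← Matrix.transpose_mul, ← Matrix.mul_assoc, h.mul_mul]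
  · rw [← Matrix.transpose_mul, ← Matrix.transpose_mul, ← Matrix.mul_assoc, h.inv_mul_inv]
  · rw [← Matrix.transpose_mul, h.symm_right, h.symm_right]
  · rw [← Matrix.transpose_mul, h.symm_left, h.symm_left]

/-- The Moore-Penrose inverse is a Borel function of the entries. It is not continuous, but its
graph is closed (the four Penrose equations), and the projection of the graph to the first factor
is injective, so that preimages are Borel by the Lusin-Souslin theorem. -/
theorem measurable_pinv_apply {α : Type*} [MeasurableSpace α] {M : α → Matrix r s ℝ}
    (hM : ∀ i j, Measurable fun x => M x i j) (i : s) (j : r) :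
    Measurable fun x => pinv (M x) i j := by
  let gr : Set ((r → s → ℝ) × (s → r → ℝ)) :=
    {q | IsMoorePenrose (Matrix.of q.1) (Matrix.of q.2)}
  have hgr : IsClosed gr := by
    have h1 : Continuous fun q : (r → s → ℝ) × (s → r → ℝ) => (Matrix.of q.1 : Matrix r s ℝ) :=
      continuous_fst
    have h2 : Continuous fun q : (r → s → ℝ) × (s → r → ℝ) => (Matrix.of q.2 : Matrix s r ℝ) :=
      continuous_snd
    have : gr = {q | Matrix.of q.1 * Matrix.of q.2 * Matrix.of q.1 = Matrix.of q.1} ∩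
        {q | Matrix.of q.2 * Matrix.of q.1 * Matrix.of q.2 = Matrix.of q.2} ∩
        {q | (Matrix.of q.1 * Matrix.of q.2)ᵀ = Matrix.of q.1 * Matrix.of q.2} ∩
        {q | (Matrix.of q.2 * Matrix.of q.1)ᵀ = Matrix.of q.2 * Matrix.of q.1} := by
      ext q
      exact ⟨fun h => ⟨⟨⟨h.1, h.2⟩, h.3⟩, h.4⟩, fun h => ⟨h.1.1.1, h.1.1.2, h.1.2, h.2⟩⟩
    rw [this]
    refine ((IsClosed.inter (isClosed_eq ?_ ?_) (isClosed_eq ?_ ?_)).inter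
      (isClosed_eq ?_ ?_)).inter (isClosed_eq ?_ ?_) <;> fun_prop
  have hpinv : Measurable fun A : r → s → ℝ => (fun i j => pinv (Matrix.of A) i j) := by
    intro S hS
    have : (fun A : r → s → ℝ => (fun i j => pinv (Matrix.of A) i j)) ⁻¹' S
        = Prod.fst '' (gr ∩ Prod.snd ⁻¹' S) := by
      ext A
      simp only [Set.mem_preimage, Set.mem_image, Set.mem_inter_iff, Prod.exists,
        exists_and_right, exists_eq_right]
      refine ⟨fun h => ⟨_, isMoorePenrose_pinv (Matrix.of A), h⟩, ?_⟩
      rintro ⟨B, hB, hBS⟩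
      have hB' : pinv (Matrix.of A) = Matrix.of B := IsMoorePenrose.pinv_eq hB
      simpa [hB'] using hBS
    rw [this]
    refine (hgr.measurableSet.inter (measurable_snd hS)).image_of_measurable_injOn
      measurable_fst ?_
    rintro ⟨A, B⟩ hB ⟨A', B'⟩ hB' h
    obtain rfl : A = A' := h
    have hu : Matrix.of B = Matrix.of B' := IsMoorePenrose.unique hB.1 hB'.1
    exact Prod.ext rfl (Matrix.of.injective hu)
  have hM' : Measurable fun x => (fun i j => M x i j) :=
    measurable_pi_lambda _ fun i => measurable_pi_lambda _ fun j => hM i j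
  exact (measurable_pi_apply j).comp ((measurable_pi_apply i).comp (hpinv.comp hM'))

theorem transpose_hypProjector (H : Matrix r s ℝ) : (hypProjector H)ᵀ = hypProjector H := by
  have h : (pinv (H * Hᵀ))ᵀ = pinv (H * Hᵀ) := by
    rw [← pinv_transpose]; simp [Matrix.transpose_mul]
  simp [hypProjector, Matrix.transpose_mul, h, Matrix.mul_assoc]

theorem hypProjector_mul_self (H : Matrix r s ℝ) :
    hypProjector H * hypProjector H = hypProjector H := by
  have h := (isMoorePenrose_pinv (H * Hᵀ)).inv_mul_inv
  calc hypProjector H * hypProjector H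
      = Hᵀ * (pinv (H * Hᵀ) * (H * Hᵀ) * pinv (H * Hᵀ)) * H := by
        simp only [hypProjector, Matrix.mul_assoc]
    _ = hypProjector H := by rw [h, hypProjector]

end MoorePenrose

section ProjectedDiagonal

variable {q : Type*} [Fintype q] [DecidableEq q]

/-- The matrix `T D T + (1 - T)`. For a symmetric idempotent `T` and a diagonal matrix `D` with
positive entries it is positive definite, and its inverse agrees with the Moore-Penrose inverse of
`T D T` on the range of `T`. -/
noncomputable def diagCompletion (T : Matrix q q ℝ) (d : q → ℝ) : Matrix q q ℝ :=
  T * Matrix.diagonal d * T + (1 - T)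

theorem posDef_diagCompletion {T : Matrix q q ℝ} (hT : Tᵀ = T) (hTT : T * T = T) {d : q → ℝ}
    (hd : ∀ i, 0 < d i) : (diagCompletion T d).PosDef := by
  have hTh : T.IsHermitian := by
    rw [Matrix.IsHermitian, Matrix.conjTranspose_eq_transpose_of_trivial, hT]
  have hD : (Matrix.diagonal d).PosDef := Matrix.PosDef.diagonal hd
  refine Matrix.PosDef.of_dotProduct_mulVec_pos ?_ fun x hx => ?_
  · refine Matrix.IsHermitian.add ?_ (Matrix.isHermitian_one.sub hTh)
    have := Matrix.isHermitian_mul_mul_conjTranspose T hD.isHermitian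
    rwa [hTh.eq] at this
  · have hproj : ∀ y : q → ℝ, x ⬝ᵥ T *ᵥ y = (T *ᵥ x) ⬝ᵥ y := by
      intro y
      rw [Matrix.dotProduct_mulVec, ← Matrix.mulVec_transpose, hT]
    have h1 : star x ⬝ᵥ diagCompletion T d *ᵥ x
        = star (T *ᵥ x) ⬝ᵥ Matrix.diagonal d *ᵥ (T *ᵥ x) + (x - T *ᵥ x) ⬝ᵥ (x - T *ᵥ x) := by
      have e1 : (T *ᵥ x) ⬝ᵥ (T *ᵥ x) = x ⬝ᵥ T *ᵥ x := by
        rw [← hproj, Matrix.mulVec_mulVec, hTT]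
      simp only [diagCompletion, star_trivial, Matrix.add_mulVec, Matrix.sub_mulVec,
        Matrix.one_mulVec, dotProduct_add, dotProduct_sub, sub_dotProduct,
        ← Matrix.mulVec_mulVec, hproj]
      rw [hproj x] at e1
      linarith
    rw [h1]
    have h3 : 0 ≤ (x - T *ᵥ x) ⬝ᵥ (x - T *ᵥ x) := by
      simpa using dotProduct_star_self_nonneg (x - T *ᵥ x)
    by_cases h : T *ᵥ x = 0
    · rw [h]
      have : 0 < x ⬝ᵥ x := by simpa using Matrix.dotProduct_star_self_pos_iff.mpr hx
      simpa using this
    · have := hD.dotProduct_mulVec_pos h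
      linarith

theorem mul_diagCompletion {T : Matrix q q ℝ} (hTT : T * T = T) (d : q → ℝ) :
    T * diagCompletion T d = T * Matrix.diagonal d * T := by
  rw [diagCompletion, Matrix.mul_add, Matrix.mul_sub, hTT, Matrix.mul_one, sub_self, add_zero,
    ← Matrix.mul_assoc, ← Matrix.mul_assoc, hTT]

theorem diagCompletion_mul {T : Matrix q q ℝ} (hTT : T * T = T) (d : q → ℝ) :
    diagCompletion T d * T = T * Matrix.diagonal d * T := by
  rw [diagCompletion, Matrix.add_mul, Matrix.sub_mul, hTT, Matrix.one_mul, sub_self, add_zero,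
    Matrix.mul_assoc, hTT]

/-- Multiplied by the projection `T`, the Moore-Penrose inverse of `T D T` becomes an ordinary
inverse, which depends continuously on `D`. -/
theorem pinv_mul_diagonal_mul {T : Matrix q q ℝ} (hT : Tᵀ = T) (hTT : T * T = T) {d : q → ℝ}
    (hd : ∀ i, 0 < d i) :
    pinv (T * Matrix.diagonal d * T) = (diagCompletion T d)⁻¹ * T := by
  have hM : IsUnit (diagCompletion T d).det :=
    (Matrix.isUnit_iff_isUnit_det _).mp (posDef_diagCompletion hT hTT hd).isUnit
  set M := diagCompletion T d with hMdef
  have h1 : M * T = T * Matrix.diagonal d * T := diagCompletion_mul hTT d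
  have h2 : T * M = T * Matrix.diagonal d * T := mul_diagCompletion hTT d
  have hcomm : M⁻¹ * T = T * M⁻¹ := by
    calc M⁻¹ * T = M⁻¹ * (T * M) * M⁻¹ := by
          rw [Matrix.mul_assoc, Matrix.mul_assoc T, Matrix.mul_nonsing_inv _ hM, Matrix.mul_one]
      _ = T * M⁻¹ := by
          rw [h2, ← h1, ← Matrix.mul_assoc, Matrix.nonsing_inv_mul _ hM, Matrix.one_mul]
  have h3 : T * Matrix.diagonal d * T * (M⁻¹ * T) = T := by
    rw [hcomm, ← h1, Matrix.mul_assoc, ← Matrix.mul_assoc T T, hTT, ← hcomm, ← Matrix.mul_assoc,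
      Matrix.mul_nonsing_inv _ hM, Matrix.one_mul]
  have h4 : M⁻¹ * T * (T * Matrix.diagonal d * T) = T := by
    rw [← h1, hcomm, Matrix.mul_assoc, ← Matrix.mul_assoc M⁻¹, Matrix.nonsing_inv_mul _ hM,
      Matrix.one_mul, hTT]
  refine IsMoorePenrose.pinv_eq ⟨?_, ?_, ?_, ?_⟩
  · rw [h3, ← Matrix.mul_assoc, ← Matrix.mul_assoc, hTT]
  · rw [h4, hcomm, ← Matrix.mul_assoc, hTT]
  · rw [h3, hT]
  · rw [h4, hT]

theorem continuousAt_diagCompletion_inv {T : Matrix q q ℝ} (hT : Tᵀ = T) (hTT : T * T = T)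
    {d : q → ℝ} (hd : ∀ i, 0 < d i) : ContinuousAt (fun d => (diagCompletion T d)⁻¹) d := by
  have hM : IsUnit (diagCompletion T d).det :=
    (Matrix.isUnit_iff_isUnit_det _).mp (posDef_diagCompletion hT hTT hd).isUnit
  have hc : Continuous fun d : q → ℝ => diagCompletion T d := by
    unfold diagCompletion; fun_prop
  exact ContinuousAt.comp
    (continuousAt_matrix_inv _ (NormedRing.inverse_continuousAt hM.unit)) hc.continuousAt

end ProjectedDiagonal

theorem dotProduct_transpose_mul_mul_mulVec {q r : Type*} [Fintype q] [Fintype r]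
    (A : Matrix r q ℝ) (B : Matrix r r ℝ) (v : q → ℝ) :
    v ⬝ᵥ (Aᵀ * B * A) *ᵥ v = (A *ᵥ v) ⬝ᵥ B *ᵥ (A *ᵥ v) := by
  rw [← Matrix.mulVec_mulVec, ← Matrix.mulVec_mulVec, Matrix.dotProduct_mulVec v,
    ← Matrix.mulVec_transpose, Matrix.transpose_transpose]

/-! ### A Lyapunov central limit theorem for triangular arrays of random vectors -/

section Lyapunov

variable {Ω : Type*} [MeasurableSpace Ω] {P : Measure Ω} [IsProbabilityMeasure P]

theorem integrable_pow_of_memLp_four {X : Ω → ℝ} (hX : MemLp X 4 P) {k : ℕ} (hk : k ≤ 4) :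
    Integrable (fun ω => X ω ^ k) P := by
  rcases Nat.eq_zero_or_pos k with rfl | hk0
  · simp
  have h : MemLp X (k : ENNReal) P := hX.mono_exponent (by exact_mod_cast hk)
  have := h.integrable_norm_pow hk0.ne'
  refine (integrable_norm_iff (hX.1.pow k)).mp ?_
  simpa [norm_pow] using this

theorem sq_integral_le_integral_sq {X : Ω → ℝ} (hX : MemLp X 2 P) :
    (∫ ω, X ω ∂P) ^ 2 ≤ ∫ ω, X ω ^ 2 ∂P := by
  have h := variance_nonneg X P
  rw [variance_eq_sub hX] at h
  simpa using h

theorem integral_sq_sq_le_integral_pow_four {X : Ω → ℝ} (hX : MemLp X 4 P) :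
    (∫ ω, X ω ^ 2 ∂P) ^ 2 ≤ ∫ ω, X ω ^ 4 ∂P := by
  have h2 : MemLp (fun ω => X ω ^ 2) 2 P := by
    refine (memLp_two_iff_integrable_sq (hX.1.pow 2)).mpr ?_
    simpa [← pow_mul] using integrable_pow_of_memLp_four hX le_rfl
  simpa [← pow_mul] using sq_integral_le_integral_sq h2

theorem norm_exp_mul_I_sub_taylor_le (x : ℝ) :
    ‖Complex.exp (x * Complex.I) - (1 + x * Complex.I - (x : ℂ) ^ 2 / 2)‖ ≤ 4 * |x| ^ 3 := by
  have hn : ‖(x : ℂ) * Complex.I‖ = |x| := by simp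
  rcases le_or_gt |x| 1 with h | h
  · have hb := Complex.exp_bound (x := (x : ℂ) * Complex.I) (by rwa [hn]) (n := 3) (by norm_num)
    have hs : ∑ m ∈ Finset.range 3, ((x : ℂ) * Complex.I) ^ m / (m.factorial : ℂ)
        = 1 + x * Complex.I - (x : ℂ) ^ 2 / 2 := by
      simp [Finset.sum_range_succ, Nat.factorial, mul_pow]
      ring
    rw [hs, hn] at hb
    refine hb.trans ?_
    have : (4 : ℝ) * ((Nat.factorial 3 : ℝ) * (3 : ℕ))⁻¹ ≤ 4 := by norm_num [Nat.factorial]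
    have h3 : 0 ≤ |x| ^ 3 := by positivity
    norm_num [Nat.factorial]
    nlinarith
  · have h1 : ‖Complex.exp (x * Complex.I)‖ = 1 := Complex.norm_exp_ofReal_mul_I x
    have h2 : ‖(1 : ℂ) + x * Complex.I - (x : ℂ) ^ 2 / 2‖ ≤ 1 + |x| + |x| ^ 2 / 2 := by
      refine (norm_sub_le _ _).trans (add_le_add ((norm_add_le _ _).trans ?_) ?_)
      · simp
      · simp
    refine (norm_sub_le _ _).trans ?_
    rw [h1]
    have h3 : |x| ≤ |x| ^ 3 := by nlinarith [sq_nonneg (|x| - 1), sq_nonneg |x|]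
    have h4 : |x| ^ 2 ≤ |x| ^ 3 := by nlinarith [sq_nonneg |x|]
    linarith [h2]

/-- The characteristic function of a centred real random variable is compared, at `1`, with that
of the centred Gaussian of the same variance; `η` splits the third absolute moment between the
second and the fourth. -/
theorem norm_integral_exp_mul_I_sub_le {X : Ω → ℝ} (hX : MemLp X 4 P)
    (h0 : ∫ ω, X ω ∂P = 0) {η : ℝ} (hη : 0 < η) :
    ‖∫ ω, Complex.exp (X ω * Complex.I) ∂P - Complex.exp (-(∫ ω, X ω ^ 2 ∂P : ℝ) / 2)‖ ≤
      2 * η * ∫ ω, X ω ^ 2 ∂P + (2 * η⁻¹ + 1) * ∫ ω, X ω ^ 4 ∂P := by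
  have i1 : Integrable X P := by
    simpa using integrable_pow_of_memLp_four hX (k := 1) (by norm_num)
  have i2 := integrable_pow_of_memLp_four hX (k := 2) (by norm_num)
  have i4 := integrable_pow_of_memLp_four hX (k := 4) (by norm_num)
  set v := ∫ ω, X ω ^ 2 ∂P with hv
  set f := ∫ ω, X ω ^ 4 ∂P with hf
  have hv0 : 0 ≤ v := integral_nonneg fun _ => sq_nonneg _
  have hf0 : 0 ≤ f := integral_nonneg fun _ => by positivity
  have hvf : v ^ 2 ≤ f := integral_sq_sq_le_integral_pow_four hX
  have iexp : Integrable (fun ω => Complex.exp (X ω * Complex.I)) P := by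
    refine Integrable.of_bound (C := 1) ?_ (ae_of_all _ fun ω => ?_)
    · have := hX.1.aemeasurable
      exact AEMeasurable.aestronglyMeasurable (by fun_prop)
    · rw [Complex.norm_exp_ofReal_mul_I]
  have itay : Integrable (fun ω => 1 + (X ω : ℂ) * Complex.I - (X ω : ℂ) ^ 2 / 2) P := by
    refine ((integrable_const _).add (i1.ofReal.mul_const _)).sub (Integrable.div_const ?_ _)
    simpa using i2.ofReal (𝕜 := ℂ)
  have etay : ∫ ω, (1 + (X ω : ℂ) * Complex.I - (X ω : ℂ) ^ 2 / 2) ∂P = 1 - (v : ℂ) / 2 := by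
    have e1 : ∫ ω, (X ω : ℂ) ∂P = 0 := by rw [integral_complex_ofReal, h0]; simp
    have e2 : ∫ ω, (X ω : ℂ) ^ 2 ∂P = (v : ℂ) := by
      rw [hv, ← integral_complex_ofReal]; simp
    have j1 : Integrable (fun ω => 1 + (X ω : ℂ) * Complex.I) P :=
      (integrable_const _).add (i1.ofReal.mul_const _)
    have j2 : Integrable (fun ω => (X ω : ℂ) ^ 2 / 2) P := by
      refine Integrable.div_const ?_ _
      simpa using i2.ofReal (𝕜 := ℂ)
    rw [integral_sub j1 j2, integral_add (integrable_const _) (i1.ofReal.mul_const _),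
      integral_mul_const, integral_div, e1, e2]
    simp
  have b1 : ‖∫ ω, Complex.exp (X ω * Complex.I) ∂P - (1 - (v : ℂ) / 2)‖ ≤
      2 * η * v + 2 * η⁻¹ * f := by
    rw [← etay, ← integral_sub iexp itay]
    have hb : Integrable (fun ω => 2 * η * X ω ^ 2 + 2 * η⁻¹ * X ω ^ 4) P :=
      (i2.const_mul _).add (i4.const_mul _)
    refine (norm_integral_le_of_norm_le hb (ae_of_all _ fun ω => ?_)).trans_eq ?_
    · refine (norm_exp_mul_I_sub_taylor_le (X ω)).trans ?_
      set y := |X ω| with hy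
      have hy2 : X ω ^ 2 = y ^ 2 := (sq_abs _).symm
      have hy4 : X ω ^ 4 = y ^ 4 := by
        rw [show (4 : ℕ) = 2 * 2 by norm_num, pow_mul, pow_mul, hy2]
      rw [hy2, hy4]
      have h := mul_nonneg (by positivity : 0 ≤ 2 * η⁻¹) (sq_nonneg (y * (y - η)))
      have : 2 * η⁻¹ * (y * (y - η)) ^ 2 = 2 * η * y ^ 2 + 2 * η⁻¹ * y ^ 4 - 4 * y ^ 3 := by
        field_simp; ring
      linarith
    · rw [integral_add (i2.const_mul _) (i4.const_mul _), integral_const_mul, integral_const_mul]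
  have b2 : ‖(1 - (v : ℂ) / 2) - Complex.exp (-(v : ℝ) / 2)‖ ≤ f := by
    have : (1 - (v : ℂ) / 2) - Complex.exp (-(v : ℝ) / 2)
        = ((1 - v / 2 - Real.exp (-v / 2) : ℝ) : ℂ) := by push_cast; ring
    rw [this, Complex.norm_real, Real.norm_eq_abs]
    have l1 : -v / 2 + 1 ≤ Real.exp (-v / 2) := Real.add_one_le_exp _
    have l2 : Real.exp (-v / 2) ≤ 1 - v / 2 + (v / 2) ^ 2 := by
      rcases le_or_gt (v / 2) 1 with h | h
      · have := Real.abs_exp_sub_one_sub_id_le (x := -v / 2)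
          (by rw [abs_le]; constructor <;> linarith)
        have := (abs_le.mp this).2
        nlinarith
      · have : Real.exp (-v / 2) ≤ 1 := Real.exp_le_one_iff.mpr (by linarith)
        nlinarith
    rw [abs_le]; constructor <;> nlinarith
  calc _ ≤ ‖∫ ω, Complex.exp (X ω * Complex.I) ∂P - (1 - (v : ℂ) / 2)‖ +
        ‖(1 - (v : ℂ) / 2) - Complex.exp (-(v : ℝ) / 2)‖ := norm_sub_le_norm_sub_add_norm_sub _ _ _
    _ ≤ _ := by linarith

theorem norm_prod_sub_prod_le {ι : Type*} (s : Finset ι) (f g : ι → ℂ)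
    (hf : ∀ i ∈ s, ‖f i‖ ≤ 1) (hg : ∀ i ∈ s, ‖g i‖ ≤ 1) :
    ‖∏ i ∈ s, f i - ∏ i ∈ s, g i‖ ≤ ∑ i ∈ s, ‖f i - g i‖ := by
  classical
  induction s using Finset.induction_on with
  | empty => simp
  | insert i s hi ih =>
    have ih' := ih (fun j hj => hf j (Finset.mem_insert_of_mem hj))
      (fun j hj => hg j (Finset.mem_insert_of_mem hj))
    rw [Finset.prod_insert hi, Finset.prod_insert hi, Finset.sum_insert hi]
    have e : f i * ∏ j ∈ s, f j - g i * ∏ j ∈ s, g j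
        = (f i - g i) * ∏ j ∈ s, f j + g i * (∏ j ∈ s, f j - ∏ j ∈ s, g j) := by ring
    have hp : ‖∏ j ∈ s, f j‖ ≤ 1 := by
      rw [norm_prod]
      exact Finset.prod_le_one (fun _ _ => norm_nonneg _)
        fun j hj => hf j (Finset.mem_insert_of_mem hj)
    have hgi := hg i (Finset.mem_insert_self i s)
    rw [e]
    refine (norm_add_le _ _).trans (add_le_add ?_ ?_)
    · rw [norm_mul]; exact mul_le_of_le_one_right (norm_nonneg _) hp
    · rw [norm_mul]; exact (mul_le_of_le_one_left (norm_nonneg _) hgi).trans ih'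

/-- The characteristic functions, at `1`, of row sums of an array satisfying the Lyapunov condition
converge to that of a Gaussian variable. -/
theorem tendsto_prod_charFun_of_lyapunov {ι : ℕ → Type*} [∀ m, Fintype (ι m)]
    {X : ∀ m, ι m → Ω → ℝ} (hX : ∀ m s, MemLp (X m s) 4 P)
    (h0 : ∀ m s, ∫ ω, X m s ω ∂P = 0) {v : ℝ}
    (hv : Tendsto (fun m => ∑ s, ∫ ω, X m s ω ^ 2 ∂P) atTop (𝓝 v))
    (h4 : Tendsto (fun m => ∑ s, ∫ ω, X m s ω ^ 4 ∂P) atTop (𝓝 0)) :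
    Tendsto (fun m => ∏ s, ∫ ω, Complex.exp (X m s ω * Complex.I) ∂P) atTop
      (𝓝 (Complex.exp (-(v : ℂ) / 2))) := by
  have hg : Tendsto (fun m => ∏ s, Complex.exp (-(∫ ω, X m s ω ^ 2 ∂P : ℝ) / 2)) atTop
      (𝓝 (Complex.exp (-(v : ℂ) / 2))) := by
    have : ∀ m, ∏ s, Complex.exp (-(∫ ω, X m s ω ^ 2 ∂P : ℝ) / 2)
        = Complex.exp (-((∑ s, ∫ ω, X m s ω ^ 2 ∂P : ℝ) : ℂ) / 2) := by
      intro m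
      rw [← Complex.exp_sum]
      congr 1
      push_cast
      rw [← Finset.sum_div, Finset.sum_neg_distrib]
    simp_rw [this]
    have hc : Continuous fun y : ℝ => Complex.exp (-(y : ℂ) / 2) := by fun_prop
    exact (hc.tendsto v).comp hv
  refine (tendsto_iff_of_dist ?_).mpr hg
  -- with `η` the square root of the Lyapunov sum (kept positive), both error terms vanish
  set b : ℕ → ℝ := fun m => ∑ s, ∫ ω, X m s ω ^ 4 ∂P with hb
  set η : ℕ → ℝ := fun m => √(b m + 1 / ((m : ℝ) + 1)) with hη
  have hb0 : ∀ m, 0 ≤ b m := fun m =>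
    Finset.sum_nonneg fun s _ => integral_nonneg fun _ => by positivity
  have hpos : ∀ m, 0 < b m + 1 / ((m : ℝ) + 1) := fun m => by
    have := hb0 m; positivity
  have hη0 : ∀ m, 0 < η m := fun m => Real.sqrt_pos.mpr (hpos m)
  have hηt : Tendsto η atTop (𝓝 0) := by
    have : Tendsto (fun m : ℕ => b m + 1 / ((m : ℝ) + 1)) atTop (𝓝 (0 + 0)) :=
      h4.add tendsto_one_div_add_atTop_nhds_zero_nat
    rw [add_zero] at this
    simpa [hη] using this.sqrt
  have hbη : ∀ m, (η m)⁻¹ * b m ≤ η m := fun m => by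
    rw [inv_mul_le_iff₀ (hη0 m), ← sq, hη, Real.sq_sqrt (hpos m).le]
    have : (0 : ℝ) ≤ 1 / ((m : ℝ) + 1) := by positivity
    linarith
  have hle : ∀ m, dist (∏ s, ∫ ω, Complex.exp (X m s ω * Complex.I) ∂P)
      (∏ s, Complex.exp (-(∫ ω, X m s ω ^ 2 ∂P : ℝ) / 2)) ≤
      2 * η m * ∑ s, ∫ ω, X m s ω ^ 2 ∂P + 2 * η m + b m := by
    intro m
    rw [dist_eq_norm]
    refine (norm_prod_sub_prod_le _ _ _ (fun s _ => ?_) (fun s _ => ?_)).trans ?_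
    · refine (norm_integral_le_integral_norm _).trans_eq ?_
      simp [Complex.norm_exp_ofReal_mul_I]
    · have : (-((∫ ω, X m s ω ^ 2 ∂P : ℝ) : ℂ) / 2) = ((-(∫ ω, X m s ω ^ 2 ∂P) / 2 : ℝ) : ℂ) := by
        push_cast; ring
      rw [this, Complex.norm_exp_ofReal]
      have : 0 ≤ ∫ ω, X m s ω ^ 2 ∂P := integral_nonneg fun _ => sq_nonneg _
      exact Real.exp_le_one_iff.mpr (by linarith)
    · refine (Finset.sum_le_sum fun s _ =>
        norm_integral_exp_mul_I_sub_le (hX m s) (h0 m s) (hη0 m)).trans ?_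
      rw [Finset.sum_add_distrib, ← Finset.mul_sum, ← Finset.mul_sum]
      have := hbη m
      simp only [hb] at this ⊢
      linarith
  refine squeeze_zero (fun _ => dist_nonneg) hle ?_
  have := (((hηt.const_mul 2).mul hv).add (hηt.const_mul 2)).add h4
  simpa using this

/-- Lyapunov's central limit theorem for row-wise independent arrays of centred random vectors. -/
theorem tendstoInDistribution_sum_of_lyapunov {q : Type*} [Fintype q] [DecidableEq q]
    {ι : ℕ → Type*} [∀ m, Fintype (ι m)] {Z : ∀ m, ι m → Ω → EuclideanSpace ℝ q}
    (hmeas : ∀ m s, Measurable (Z m s)) (hindep : ∀ m, iIndepFun (Z m) P)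
    (hmem : ∀ m s k, MemLp (fun ω => Z m s ω k) 4 P)
    (hmean : ∀ m s k, ∫ ω, Z m s ω k ∂P = 0) {L : Matrix q q ℝ} (hL : L.PosSemidef)
    (hcov : ∀ k l, Tendsto (fun m => ∑ s, ∫ ω, Z m s ω k * Z m s ω l ∂P) atTop (𝓝 (L k l)))
    (h4 : Tendsto (fun m => ∑ s, ∑ k, ∫ ω, Z m s ω k ^ 4 ∂P) atTop (𝓝 0)) :
    TendstoInDistribution (fun m ω => ∑ s, Z m s ω) atTop id (fun _ => P)
      (multivariateGaussian 0 L) where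
  forall_aemeasurable m := (Finset.measurable_sum _ fun s _ => hmeas m s).aemeasurable
  aemeasurable_limit := aemeasurable_id
  tendsto := by
    refine ProbabilityMeasure.tendsto_iff_tendsto_charFun.2 fun t => ?_
    have hI : ∀ m s k, Integrable (fun ω => Z m s ω k) P := fun m s k => by
      simpa using integrable_pow_of_memLp_four (hmem m s k) (k := 1) (by norm_num)
    have hI2 : ∀ m s k l, Integrable (fun ω => Z m s ω k * Z m s ω l) P := fun m s k l =>
      MemLp.integrable_mul (p := 2) (q := 2) ((hmem m s k).mono_exponent (by norm_num))
        ((hmem m s l).mono_exponent (by norm_num))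
    have hin : ∀ m s ω, inner ℝ (Z m s ω) t = ∑ k, t k * Z m s ω k := fun m s ω => by
      simp [PiLp.inner_apply]
    have hlhs : ∀ m, charFun (P.map fun ω => ∑ s, Z m s ω) t
        = ∏ s, ∫ ω, Complex.exp ((∑ k, t k * Z m s ω k : ℝ) * Complex.I) ∂P := by
      intro m
      rw [(hindep m).charFun_map_fun_sum_eq_prod fun s => (hmeas m s).aemeasurable,
        Finset.prod_apply]
      refine Finset.prod_congr rfl fun s _ => ?_
      rw [charFun_apply, integral_map (hmeas m s).aemeasurable (by fun_prop)]
      simp_rw [hin]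
    have hrhs : charFun ((multivariateGaussian (0 : EuclideanSpace ℝ q) L).map id) t
        = Complex.exp (-((t ⬝ᵥ L *ᵥ t : ℝ) : ℂ) / 2) := by
      rw [Measure.map_id, charFun_multivariateGaussian hL]
      congr 1
      simp
      ring
    simp only [ProbabilityMeasure.coe_mk, hrhs]
    refine (tendsto_congr hlhs).mpr (tendsto_prod_charFun_of_lyapunov ?_ ?_ ?_ ?_)
    · intro m s
      exact memLp_finsetSum _ fun k _ => (hmem m s k).const_mul _
    · intro m s
      rw [integral_finsetSum _ fun k _ => (hI m s k).const_mul _]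
      simp [integral_const_mul, hmean]
    · have e : ∀ m, ∑ s, ∫ ω, (∑ k, t k * Z m s ω k) ^ 2 ∂P
          = ∑ k, ∑ l, t k * t l * ∑ s, ∫ ω, Z m s ω k * Z m s ω l ∂P := by
        intro m
        have : ∀ s, ∫ ω, (∑ k, t k * Z m s ω k) ^ 2 ∂P
            = ∑ k, ∑ l, t k * t l * ∫ ω, Z m s ω k * Z m s ω l ∂P := by
          intro s
          have : ∀ ω, (∑ k, t k * Z m s ω k) ^ 2
              = ∑ k, ∑ l, t k * t l * (Z m s ω k * Z m s ω l) := by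
            intro ω
            rw [sq, Finset.sum_mul_sum]
            exact Finset.sum_congr rfl fun k _ => Finset.sum_congr rfl fun l _ => by ring
          simp_rw [this]
          rw [integral_finsetSum _ fun k _ => integrable_finsetSum _ fun l _ =>
            (hI2 m s k l).const_mul _]
          refine Finset.sum_congr rfl fun k _ => ?_
          rw [integral_finsetSum _ fun l _ => (hI2 m s k l).const_mul _]
          exact Finset.sum_congr rfl fun l _ => integral_const_mul _ _
        simp_rw [this, Finset.mul_sum]
        rw [Finset.sum_comm]
        exact Finset.sum_congr rfl fun k _ => Finset.sum_comm
      simp_rw [e]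
      have : t ⬝ᵥ L *ᵥ t = ∑ k, ∑ l, t k * t l * L k l := by
        simp only [dotProduct, Matrix.mulVec, Finset.mul_sum]
        exact Finset.sum_congr rfl fun k _ => Finset.sum_congr rfl fun l _ => by ring
      rw [this]
      exact tendsto_finsetSum _ fun k _ => tendsto_finsetSum _ fun l _ =>
        (hcov k l).const_mul _
    · refine squeeze_zero (g := fun m => (∑ k, t k ^ 2) ^ 2 * Fintype.card q *
          ∑ s, ∑ k, ∫ ω, Z m s ω k ^ 4 ∂P)
        (fun m => Finset.sum_nonneg fun s _ => integral_nonneg fun _ => by positivity)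
        (fun m => ?_) ?_
      · rw [Finset.mul_sum]
        refine Finset.sum_le_sum fun s _ => ?_
        have i4 : ∀ k, Integrable (fun ω => Z m s ω k ^ 4) P := fun k =>
          integrable_pow_of_memLp_four (hmem m s k) le_rfl
        rw [← integral_finsetSum _ fun k _ => i4 k, ← integral_const_mul]
        refine integral_mono_of_nonneg (ae_of_all _ fun ω => by positivity)
          ((integrable_finsetSum _ fun k _ => i4 k).const_mul _) (ae_of_all _ fun ω => ?_)
        have c1 : (∑ k, t k * Z m s ω k) ^ 2 ≤ (∑ k, t k ^ 2) * ∑ k, Z m s ω k ^ 2 :=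
          Finset.sum_mul_sq_le_sq_mul_sq _ _ _
        have c2 : (∑ k, Z m s ω k ^ 2) ^ 2 ≤ Fintype.card q * ∑ k, Z m s ω k ^ 4 := by
          have := sq_sum_le_card_mul_sum_sq (s := Finset.univ) (f := fun k => Z m s ω k ^ 2)
          simpa [← pow_mul] using this
        calc (∑ k, t k * Z m s ω k) ^ 4 = ((∑ k, t k * Z m s ω k) ^ 2) ^ 2 := by ring
          _ ≤ ((∑ k, t k ^ 2) * ∑ k, Z m s ω k ^ 2) ^ 2 :=
            pow_le_pow_left₀ (sq_nonneg _) c1 2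
          _ = (∑ k, t k ^ 2) ^ 2 * (∑ k, Z m s ω k ^ 2) ^ 2 := by ring
          _ ≤ (∑ k, t k ^ 2) ^ 2 * (Fintype.card q * ∑ k, Z m s ω k ^ 4) := by gcongr
          _ = _ := by ring
      · simpa using h4.const_mul ((∑ k, t k ^ 2) ^ 2 * (Fintype.card q : ℝ))

end Lyapunov

/-! ### Distribution functions, quantiles and conditional laws -/

section DistributionFunction

theorem continuous_measureReal_Iic (ν : Measure ℝ) [IsProbabilityMeasure ν]
    (hν : ∀ x, ν {x} = 0) : Continuous fun x => ν.real (Set.Iic x) := by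
  have e : (fun x => ν.real (Set.Iic x)) = cdf ν := funext fun x => (cdf_eq_real ν x).symm
  rw [e, continuous_iff_continuousAt]
  intro x
  rw [(monotone_cdf ν).continuousAt_iff_leftLim_eq_rightLim, (cdf ν).rightLim_eq]
  have h := (cdf ν).measure_singleton x
  rw [measure_cdf, hν x, eq_comm, ENNReal.ofReal_eq_zero] at h
  exact le_antisymm ((monotone_cdf ν).leftLim_le le_rfl) (by linarith)

theorem exists_measureReal_Iic_eq (ν : Measure ℝ) [IsProbabilityMeasure ν]
    (hν : ∀ x, ν {x} = 0) {u : ℝ} (h0 : 0 < u) (h1 : u < 1) : ∃ x, ν.real (Set.Iic x) = u := by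
  have hb : Tendsto (fun x => ν.real (Set.Iic x)) atBot (𝓝 0) :=
    (tendsto_cdf_atBot ν).congr fun x => cdf_eq_real ν x
  have ht : Tendsto (fun x => ν.real (Set.Iic x)) atTop (𝓝 1) :=
    (tendsto_cdf_atTop ν).congr fun x => cdf_eq_real ν x
  obtain ⟨l, hl⟩ := (hb.eventually_lt_const h0).exists
  obtain ⟨r, hr⟩ := (ht.eventually_const_lt h1).exists
  obtain ⟨x, hx⟩ := mem_range_of_exists_le_of_exists_ge (continuous_measureReal_Iic ν hν)
    ⟨l, hl.le⟩ ⟨r, hr.le⟩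
  exact ⟨x, hx⟩

/-- **Pólya's theorem**: pointwise convergence of distribution functions to a continuous
distribution function is uniform. -/
theorem eventually_forall_abs_measureReal_Iic_sub_le {μ : ℕ → Measure ℝ}
    [∀ m, IsProbabilityMeasure (μ m)] {ν : Measure ℝ} [IsProbabilityMeasure ν]
    (hν : ∀ x, ν {x} = 0)
    (h : ∀ x, Tendsto (fun m => (μ m).real (Set.Iic x)) atTop (𝓝 (ν.real (Set.Iic x))))
    {δ : ℝ} (hδ : 0 < δ) :
    ∀ᶠ m in atTop, ∀ x, |(μ m).real (Set.Iic x) - ν.real (Set.Iic x)| ≤ δ := by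
  obtain ⟨k, hk⟩ := exists_nat_gt (3 / δ)
  have hk0 : (0 : ℝ) < k := lt_of_le_of_lt (by positivity) hk
  have hkδ : 3 / (k : ℝ) ≤ δ := by
    rw [div_le_iff₀ hk0]; rw [div_lt_iff₀ hδ] at hk; linarith
  set F := fun x => ν.real (Set.Iic x) with hF
  have hFmono : ∀ {x y}, F x < F y → x < y := fun {x y} hxy => by
    by_contra hn
    exact absurd hxy (not_lt.mpr (measureReal_mono (Set.Iic_subset_Iic.mpr (not_lt.mp hn))))
  -- a grid of `1/k`-quantiles of the limit
  have hgrid : ∀ j : ℕ, ∃ x, 0 < j → j < k → F x = j / k := by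
    intro j
    by_cases hj : 0 < j ∧ j < k
    · obtain ⟨x, hx⟩ := exists_measureReal_Iic_eq ν hν (u := (j : ℝ) / k)
        (by have : (0 : ℝ) < j := by exact_mod_cast hj.1
            positivity)
        (by rw [div_lt_one hk0]; exact_mod_cast hj.2)
      exact ⟨x, fun _ _ => hx⟩
    · exact ⟨0, fun h1 h2 => absurd ⟨h1, h2⟩ hj⟩
  choose g hg using hgrid
  have hev : ∀ᶠ m in atTop, ∀ j ∈ Finset.range k, |(μ m).real (Set.Iic (g j)) - F (g j)| < 1 / k :=
    (Finset.eventually_all _).mpr fun j _ =>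
      ((h (g j)).sub_const (F (g j))).abs.eventually_lt_const (by simpa [hF] using hk0)
  filter_upwards [hev] with m hm x
  have hFx0 : 0 ≤ F x := measureReal_nonneg
  have hG0 : 0 ≤ (μ m).real (Set.Iic x) := measureReal_nonneg
  have hG1 : (μ m).real (Set.Iic x) ≤ 1 := measureReal_le_one
  set j := ⌊F x * k⌋₊ with hj
  have hj1 : (j : ℝ) / k ≤ F x := by
    rw [div_le_iff₀ hk0]; exact Nat.floor_le (by positivity)
  have hj2 : F x < ((j : ℝ) + 1) / k := by
    rw [lt_div_iff₀ hk0]; exact Nat.lt_floor_add_one _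
  have e3 : (3 : ℝ) / k = 1 / k + 1 / k + 1 / k := by ring
  have ej : ((j : ℝ) + 1) / k = j / k + 1 / k := by ring
  have hk1 : 0 < 1 / (k : ℝ) := by positivity
  clear_value j
  rw [abs_le]
  constructor
  · rcases lt_or_ge j 2 with h2 | h2
    · have : (j : ℝ) / k ≤ 1 / k := by
        gcongr; exact_mod_cast Nat.lt_succ_iff.mp h2
      change -δ ≤ _ - F x
      linarith
    · obtain ⟨i, rfl⟩ : ∃ i, j = i + 1 := ⟨j - 1, by omega⟩
      have hjk : i + 1 ≤ k := by
        have : ((i + 1 : ℕ) : ℝ) / k ≤ 1 := hj1.trans measureReal_le_one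
        rw [div_le_one hk0] at this
        exact_mod_cast this
      have hi := hg i (by omega) (by omega)
      have hlt : g i < x := by
        refine hFmono (lt_of_lt_of_le ?_ hj1)
        rw [hi]; push_cast; gcongr; linarith
      have h3 := abs_lt.mp (hm i (Finset.mem_range.mpr (by omega)))
      have h4 : (μ m).real (Set.Iic (g i)) ≤ (μ m).real (Set.Iic x) :=
        measureReal_mono (Set.Iic_subset_Iic.mpr hlt.le)
      have ei : ((i + 1 : ℕ) : ℝ) / k = (i : ℝ) / k + 1 / k := by push_cast; ring
      change -δ ≤ _ - F x
      linarith [h3.1]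
  · rcases lt_or_ge (j + 1) k with h2 | h2
    · have hi := hg (j + 1) (by omega) h2
      have hlt : x < g (j + 1) := by
        refine hFmono (lt_of_lt_of_eq hj2 ?_)
        rw [hi]; push_cast; rfl
      have h3 := abs_lt.mp (hm (j + 1) (Finset.mem_range.mpr h2))
      have h4 : (μ m).real (Set.Iic x) ≤ (μ m).real (Set.Iic (g (j + 1))) :=
        measureReal_mono (Set.Iic_subset_Iic.mpr hlt.le)
      have ei : F (g (j + 1)) = (j : ℝ) / k + 1 / k := by rw [hi]; push_cast; ring
      change _ - F x ≤ δ
      linarith [h3.2]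
    · have : 1 ≤ ((j : ℝ) + 1) / k := by
        rw [le_div_iff₀ hk0]; rw [one_mul]; exact_mod_cast h2
      change _ - F x ≤ δ
      linarith

theorem TendstoInDistribution.tendsto_measureReal_le {Ω Ω' : Type*} [MeasurableSpace Ω]
    [MeasurableSpace Ω'] {P : Measure Ω} [IsProbabilityMeasure P] {P' : Measure Ω'}
    [IsProbabilityMeasure P'] {X : ℕ → Ω → ℝ} {Z : Ω' → ℝ}
    (h : TendstoInDistribution X atTop Z (fun _ => P) P') (hZ : ∀ x, P'.map Z {x} = 0) (x : ℝ) :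
    Tendsto (fun m => (P.map (X m)).real (Set.Iic x)) atTop (𝓝 ((P'.map Z).real (Set.Iic x))) := by
  have := ProbabilityMeasure.tendsto_measure_of_null_frontier_of_tendsto' h.tendsto
    (E := Set.Iic x) (by simpa using hZ x)
  exact (ENNReal.tendsto_toReal (measure_ne_top _ _)).comp this

/-- If conditional distribution functions converge in probability, uniformly, to the continuous
limiting distribution function of a statistic, then the conditional quantiles are asymptotically
valid critical values for that statistic. -/
theorem tendsto_measureReal_quantile_lt {Ω : Type*} [MeasurableSpace Ω] {P : Measure Ω}
    [IsProbabilityMeasure P] {A : ℕ → Ω → ℝ} (hA : ∀ m, Measurable (A m))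
    {ρ : ℕ → Ω → Measure ℝ} [∀ m ω, IsProbabilityMeasure (ρ m ω)]
    {ν : Measure ℝ} [IsProbabilityMeasure ν] (hν : ∀ x, ν {x} = 0)
    (hAν : ∀ x, Tendsto (fun m => P.real {ω | A m ω ≤ x}) atTop (𝓝 (ν.real (Set.Iic x))))
    (hρ : ∀ δ > 0, Tendsto (fun m => P.real
      {ω | ∃ x, δ < |(ρ m ω).real (Set.Iic x) - ν.real (Set.Iic x)|}) atTop (𝓝 0))
    {α : ℝ} (h0 : 0 < α) (h1 : α < 1) :
    Tendsto (fun m => P.real {ω | quantile (ρ m ω) (1 - α) < A m ω}) atTop (𝓝 α) := by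
  have hne : ∀ m ω, {x : ℝ | 1 - α ≤ (ρ m ω).real (Set.Iic x)}.Nonempty := fun m ω => by
    have := (tendsto_cdf_atTop (ρ m ω)).eventually_const_lt (u := 1 - α) (by linarith)
    obtain ⟨x, hx⟩ := this.exists
    exact ⟨x, by rw [cdf_eq_real] at hx; exact hx.le⟩
  have hbdd : ∀ m ω, BddBelow {x : ℝ | 1 - α ≤ (ρ m ω).real (Set.Iic x)} := fun m ω => by
    have := (tendsto_cdf_atBot (ρ m ω)).eventually_lt_const (u := 1 - α) (by linarith)
    obtain ⟨b, hb⟩ := this.exists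
    rw [cdf_eq_real] at hb
    refine ⟨b, fun x hx => le_of_not_gt fun hlt => ?_⟩
    have : (ρ m ω).real (Set.Iic x) ≤ (ρ m ω).real (Set.Iic b) :=
      measureReal_mono (Set.Iic_subset_Iic.mpr hlt.le)
    exact absurd (hx.out.trans this) (not_le.mpr hb)
  have hgt : ∀ x, Tendsto (fun m => P.real {ω | x < A m ω}) atTop (𝓝 (1 - ν.real (Set.Iic x))) := by
    intro x
    have : ∀ m, P.real {ω | x < A m ω} = 1 - P.real {ω | A m ω ≤ x} := fun m => by
      rw [← probReal_compl_eq_one_sub (measurableSet_le (hA m) measurable_const)]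
      congr 1; ext ω; simp
    simp_rw [this]
    exact (hAν x).const_sub 1
  rw [Metric.tendsto_nhds]
  intro η hη
  obtain ⟨δ, hδ, hδ1, hδ2, hδ3⟩ : ∃ δ > 0, 4 * δ ≤ η ∧ 2 * δ < α ∧ 2 * δ < 1 - α := by
    refine ⟨min (η / 4) (min (α / 4) ((1 - α) / 4)), ?_, ?_, ?_, ?_⟩
    · have : 0 < 1 - α := by linarith
      positivity
    · have := min_le_left (η / 4) (min (α / 4) ((1 - α) / 4)); linarith
    · have := (min_le_right (η / 4) (min (α / 4) ((1 - α) / 4))).trans (min_le_left _ _); linarith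
    · have := (min_le_right (η / 4) (min (α / 4) ((1 - α) / 4))).trans (min_le_right _ _); linarith
  obtain ⟨y₁, hy₁⟩ := exists_measureReal_Iic_eq ν hν (u := 1 - α - 2 * δ) (by linarith)
    (by linarith)
  obtain ⟨y₂, hy₂⟩ := exists_measureReal_Iic_eq ν hν (u := 1 - α + 2 * δ) (by linarith)
    (by linarith)
  have hev := (hρ δ hδ).eventually_lt_const hδ
  have hev₁ := (hgt y₁).eventually_lt_const (u := α + 3 * δ) (by rw [hy₁]; linarith)
  have hev₂ := (hgt y₂).eventually_const_lt (u := α - 3 * δ) (by rw [hy₂]; linarith)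
  filter_upwards [hev, hev₁, hev₂] with m hm hm₁ hm₂
  set bad := {ω | ∃ x, δ < |(ρ m ω).real (Set.Iic x) - ν.real (Set.Iic x)|} with hbad
  have sub₁ : {ω | quantile (ρ m ω) (1 - α) < A m ω} ⊆ {ω | y₁ < A m ω} ∪ bad := by
    intro ω hω
    by_cases hb : ω ∈ bad
    · exact Or.inr hb
    · refine Or.inl ?_
      obtain ⟨x, hx, hxA⟩ := exists_lt_of_csInf_lt (hne m ω) hω
      by_contra hle
      have hxy : x ≤ y₁ := hxA.le.trans (not_lt.mp hle)
      have h3 : (ρ m ω).real (Set.Iic x) ≤ (ρ m ω).real (Set.Iic y₁) :=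
        measureReal_mono (Set.Iic_subset_Iic.mpr hxy)
      have h4 : |(ρ m ω).real (Set.Iic y₁) - ν.real (Set.Iic y₁)| ≤ δ :=
        le_of_not_gt fun h => hb ⟨y₁, h⟩
      have h5 := (abs_le.mp h4).2
      have h6 := hx.out
      linarith
  have sub₂ : {ω | y₂ < A m ω} ⊆ {ω | quantile (ρ m ω) (1 - α) < A m ω} ∪ bad := by
    intro ω hω
    by_cases hb : ω ∈ bad
    · exact Or.inr hb
    · refine Or.inl (lt_of_le_of_lt (csInf_le (hbdd m ω) ?_) hω)
      have h4 : |(ρ m ω).real (Set.Iic y₂) - ν.real (Set.Iic y₂)| ≤ δ :=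
        le_of_not_gt fun h => hb ⟨y₂, h⟩
      have h5 := (abs_le.mp h4).1
      change 1 - α ≤ (ρ m ω).real (Set.Iic y₂)
      linarith
  have b₁ := (measureReal_mono sub₁).trans (measureReal_union_le (μ := P) _ _)
  have b₂ := (measureReal_mono sub₂).trans (measureReal_union_le (μ := P) _ _)
  rw [Real.dist_eq, abs_lt]
  constructor <;> linarith

/-- For independent `Y` and `W`, the conditional law of `f (Y, W)` given `Y = y` is the law of
`f (y, W)`. -/
theorem condDistrib_comp_prodMk_of_indepFun {Ω β γ : Type*} [MeasurableSpace Ω]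
    [MeasurableSpace β] [MeasurableSpace γ] {P : Measure Ω} [IsProbabilityMeasure P]
    {Y : Ω → β} {W : Ω → γ} (hY : Measurable Y) (hW : Measurable W) (h : IndepFun Y W P)
    {f : β × γ → ℝ} (hf : Measurable f) :
    ∀ᵐ y ∂(P.map Y), condDistrib (fun ω => f (Y ω, W ω)) Y P y = P.map fun ω => f (y, W ω) := by
  have : IsProbabilityMeasure (P.map W) := Measure.isProbabilityMeasure_map hW.aemeasurable
  have : IsProbabilityMeasure (P.map Y) := Measure.isProbabilityMeasure_map hY.aemeasurable
  set K : Kernel β ℝ := (Kernel.id ×ₖ Kernel.const β (P.map W)).map f with hK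
  have hKy : ∀ y, K y = P.map fun ω => f (y, W ω) := by
    intro y
    rw [hK, Kernel.map_apply _ hf, Kernel.prod_apply, Kernel.id_apply, Kernel.const_apply,
      Measure.dirac_prod, Measure.map_map hf (by fun_prop), Measure.map_map (by fun_prop) hW]
    rfl
  have hKm : IsMarkovKernel K := Kernel.IsMarkovKernel.map _ hf
  have key : condDistrib (fun ω => f (Y ω, W ω)) Y P =ᵐ[P.map Y] K := by
    refine condDistrib_ae_eq_of_measure_eq_compProd _ (by fun_prop) ?_
    ext s hs
    have hg : Measurable fun q : β × γ => (q.1, f q) := by fun_prop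
    rw [Measure.compProd_apply hs, Measure.map_apply (by fun_prop) hs]
    have e : (fun ω => (Y ω, f (Y ω, W ω))) ⁻¹' s
        = (fun ω => (Y ω, W ω)) ⁻¹' ((fun q : β × γ => (q.1, f q)) ⁻¹' s) := rfl
    rw [e, ← Measure.map_apply (by fun_prop) (hg hs), h.map_prod_eq_prod_map_map hY.aemeasurable
      hW.aemeasurable, Measure.prod_apply (hg hs)]
    refine lintegral_congr fun y => ?_
    rw [hKy, Measure.map_apply hW (by exact measurable_prodMk_left (hg hs)),
      Measure.map_apply (by fun_prop) (measurable_prodMk_left hs)]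
    rfl
  filter_upwards [key] with y hy
  rw [hy, hKy]

/-- Markov's inequality: convergence to `0` in mean implies convergence to `0` in probability. -/
theorem tendsto_measureReal_ge_of_integral {Ω : Type*} [MeasurableSpace Ω] {P : Measure Ω}
    {f : ℕ → Ω → ℝ}
    (h0 : ∀ m ω, 0 ≤ f m ω) (hi : ∀ m, Integrable (f m) P)
    (h : Tendsto (fun m => ∫ ω, f m ω ∂P) atTop (𝓝 0)) {η : ℝ} (hη : 0 < η) :
    Tendsto (fun m => P.real {ω | η ≤ f m ω}) atTop (𝓝 0) := by
  refine squeeze_zero (g := fun m => η⁻¹ * ∫ ω, f m ω ∂P) (fun _ => measureReal_nonneg)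
    (fun m => ?_) (by simpa using h.const_mul η⁻¹)
  rw [le_inv_mul_iff₀ hη]
  exact mul_meas_ge_le_integral_of_nonneg (ae_of_all _ (h0 m)) (hi m) η

end DistributionFunction

/-! ### Quadratic forms of Gaussian vectors -/

section QuadraticForm

variable {q : Type*} [Fintype q] [DecidableEq q]

theorem finite_quadratic_roots {A : ℝ} (hA : A ≠ 0) (B C : ℝ) :
    {y : ℝ | A * y ^ 2 + B * y + C = 0}.Finite := by
  rcases Set.eq_empty_or_nonempty {y : ℝ | A * y ^ 2 + B * y + C = 0} with h | ⟨y₀, h₀⟩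
  · rw [h]; exact Set.finite_empty
  · refine (Set.toFinite {y₀, -B / A - y₀}).subset fun y hy => ?_
    have h : (y - y₀) * (A * (y + y₀) + B) = 0 := by
      have h1 := hy.out; have h2 := h₀.out; linear_combination h1 - h2
    rcases mul_eq_zero.mp h with h | h
    · exact Or.inl (sub_eq_zero.mp h)
    · refine Or.inr ?_
      rw [Set.mem_singleton_iff]
      field_simp
      linarith

/-- A quadratic form with a positive diagonal entry has no atoms under the standard Gaussian
measure: as a function of the corresponding coordinate it is a quadratic polynomial. -/
theorem pi_gaussianReal_quadForm_eq_zero (M : Matrix q q ℝ) {i : q} (hi : 0 < M i i) (x : ℝ) :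
    Measure.pi (fun _ : q => gaussianReal 0 1) {g | g ⬝ᵥ M *ᵥ g = x} = 0 := by
  have hmeas : MeasurableSet {g : q → ℝ | g ⬝ᵥ M *ᵥ g = x} :=
    measurableSet_eq_fun (by fun_prop) measurable_const
  have hind : Measurable (Set.indicator {g : q → ℝ | g ⬝ᵥ M *ᵥ g = x} (fun _ => (1 : ENNReal))) :=
    measurable_const.indicator hmeas
  rw [← lintegral_indicator_one hmeas]
  change ∫⁻ g, Set.indicator {g : q → ℝ | g ⬝ᵥ M *ᵥ g = x} (fun _ => (1 : ENNReal)) g ∂_ = 0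
  rw [lintegral_eq_lmarginal_univ (0 : q → ℝ),
    lmarginal_erase' _ hind (Finset.mem_univ i)]
  have hin : ∀ g : q → ℝ, ∫⁻ y, Set.indicator {g : q → ℝ | g ⬝ᵥ M *ᵥ g = x}
      (fun _ => (1 : ENNReal)) (Function.update g i y) ∂(gaussianReal 0 1) = 0 := by
    intro g
    set g₀ := Function.update g i 0 with hg₀
    have hup : ∀ y, Function.update g i y = g₀ + y • Pi.single i 1 := by
      intro y
      ext k
      by_cases hk : k = i
      · subst hk; simp [hg₀]
      · simp [hg₀, hk]
    have hq : ∀ y, Function.update g i y ⬝ᵥ M *ᵥ Function.update g i y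
        = M i i * y ^ 2 + (g₀ ⬝ᵥ M *ᵥ Pi.single i 1 + Pi.single i 1 ⬝ᵥ M *ᵥ g₀) * y
          + g₀ ⬝ᵥ M *ᵥ g₀ := by
      intro y
      have e : (Pi.single i 1 : q → ℝ) ⬝ᵥ M *ᵥ Pi.single i 1 = M i i := by simp
      rw [hup]
      simp only [Matrix.mulVec_add, Matrix.mulVec_smul, dotProduct_add, add_dotProduct,
        dotProduct_smul, smul_dotProduct, e, smul_eq_mul]
      ring
    have hset : {y | Function.update g i y ⬝ᵥ M *ᵥ Function.update g i y = x}.Finite := by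
      refine (finite_quadratic_roots hi.ne'
        (g₀ ⬝ᵥ M *ᵥ Pi.single i 1 + Pi.single i 1 ⬝ᵥ M *ᵥ g₀) (g₀ ⬝ᵥ M *ᵥ g₀ - x)).subset ?_
      intro y hy
      have := hy.out
      rw [hq] at this
      change _ = (0 : ℝ)
      linarith
    have := nullSingletonClass_gaussianReal (μ := 0) (v := 1) one_ne_zero
    have h0 := hset.measure_zero (gaussianReal 0 1)
    rw [← lintegral_indicator_one hset.measurableSet] at h0
    exact h0
  simp only [hin]
  rw [lmarginal]
  simp

/-- Quadratic forms of Gaussian vectors, possibly with singular covariance matrix, have no atoms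
unless they vanish on the support of the Gaussian measure. -/
theorem multivariateGaussian_quadForm_eq_zero {L B : Matrix q q ℝ} (hL : L.PosSemidef)
    (hB : B.PosSemidef) (h : L * B * L ≠ 0) (x : ℝ) :
    multivariateGaussian 0 L {g | g.ofLp ⬝ᵥ B *ᵥ g.ofLp = x} = 0 := by
  open scoped MatrixOrder in
  set S := CFC.sqrt L with hS
  have hSS : S * S = L := by
    open scoped MatrixOrder in
    exact CFC.sqrt_mul_sqrt_self L hL.nonneg
  have hSt : Sᴴ = S := by
    open scoped MatrixOrder in
    have : IsSelfAdjoint S := (CFC.sqrt_nonneg L).isSelfAdjoint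
    exact this
  have hM : (S * B * S).PosSemidef := by
    have := hB.mul_mul_conjTranspose_same S
    rwa [hSt] at this
  have hM0 : S * B * S ≠ 0 := by
    intro h0
    apply h
    calc L * B * L = S * (S * B * S) * S := by rw [← hSS]; simp only [Matrix.mul_assoc]
      _ = 0 := by rw [h0]; simp
  obtain ⟨i, hi⟩ : ∃ i, 0 < (S * B * S) i i := by
    by_contra hn
    push Not at hn
    apply hM0
    rw [← hM.trace_eq_zero_iff]
    exact Finset.sum_eq_zero fun i _ => le_antisymm (hn i) (hM.diag_nonneg)
  rw [multivariateGaussian, ← map_pi_eq_stdGaussian, Measure.map_map (by fun_prop) (by fun_prop),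
    Measure.map_apply (by fun_prop) (measurableSet_eq_fun (by fun_prop) measurable_const)]
  convert pi_gaussianReal_quadForm_eq_zero (S * B * S) hi x using 2
  ext g
  have hSt' : Sᵀ = S := by rwa [Matrix.conjTranspose_eq_transpose_of_trivial] at hSt
  have e : (S *ᵥ g) ⬝ᵥ B *ᵥ (S *ᵥ g) = g ⬝ᵥ (S * B * S) *ᵥ g := by
    rw [← dotProduct_transpose_mul_mul_mulVec, hSt']
  simp only [Set.mem_preimage, Set.mem_ofPred_eq, Function.comp_apply, zero_add,
    Matrix.ofLp_toEuclideanCLM, ← hS, e]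

end QuadraticForm

/-! ### Least squares in the multivariate analysis of covariance -/

section LeastSquares

variable {a c p : ℕ} (n : Fin a → ℕ) (z : Fin a → ℕ → Fin c → ℝ)

/-- The squared Euclidean norm of the row of `X` belonging to a subject. -/
noncomputable def rowSq (s : Subj n) : ℝ := ∑ r, designMatrix n z s r ^ 2

/-- The matrix `(X'X)⁻¹ X'` of the weights of the observations in the least squares estimator. -/
noncomputable def olsWeight : Matrix (Fin a ⊕ Fin c) (Subj n) ℝ :=
  ((designMatrix n z)ᵀ * designMatrix n z)⁻¹ * (designMatrix n z)ᵀ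

theorem rowSq_eq (s : Subj n) : rowSq n z s = 1 + ∑ w, z s.1 s.2 w ^ 2 := by
  simp [rowSq, designMatrix, ite_pow]

theorem one_le_rowSq (s : Subj n) : 1 ≤ rowSq n z s := by
  rw [rowSq_eq]
  have : 0 ≤ ∑ w, z s.1 s.2 w ^ 2 := Finset.sum_nonneg fun _ _ => sq_nonneg _
  linarith

theorem rowSq_nonneg (s : Subj n) : 0 ≤ rowSq n z s := zero_le_one.trans (one_le_rowSq n z s)

theorem sum_rowSq : ∑ s, rowSq n z s = ∑ r, ((designMatrix n z)ᵀ * designMatrix n z) r r := by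
  simp only [rowSq, Matrix.mul_apply, Matrix.transpose_apply]
  rw [Finset.sum_comm]
  exact Finset.sum_congr rfl fun _ _ => Finset.sum_congr rfl fun _ _ => sq _

theorem fullDesign_transpose_mul :
    (fullDesign n z p)ᵀ * fullDesign n z p
      = ((designMatrix n z)ᵀ * designMatrix n z) ⊗ₖ (1 : Matrix (Fin p) (Fin p) ℝ) := by
  rw [fullDesign, ← Matrix.kroneckerMap_transpose, ← Matrix.mul_kronecker_mul]
  simp

theorem fullDesign_inv_mul :
    ((fullDesign n z p)ᵀ * fullDesign n z p)⁻¹ * (fullDesign n z p)ᵀ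
      = olsWeight n z ⊗ₖ (1 : Matrix (Fin p) (Fin p) ℝ) := by
  rw [fullDesign_transpose_mul, Matrix.inv_kronecker, fullDesign, ← Matrix.kroneckerMap_transpose,
    ← Matrix.mul_kronecker_mul]
  simp [olsWeight]

theorem kronecker_one_mulVec {R S : Type*} [Fintype S] (M : Matrix R S ℝ) (Y : S × Fin p → ℝ)
    (r : R) (k : Fin p) :
    ((M ⊗ₖ (1 : Matrix (Fin p) (Fin p) ℝ)) *ᵥ Y) (r, k) = ∑ s, M r s * Y (s, k) := by
  simp [Matrix.mulVec, dotProduct, Fintype.sum_prod_type, Matrix.kroneckerMap_apply,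
    Matrix.one_apply]

theorem olsEstimator_apply (Y : Subj n × Fin p → ℝ) (r : Fin a ⊕ Fin c) (k : Fin p) :
    olsEstimator n z Y (r, k) = ∑ s, olsWeight n z r s * Y (s, k) := by
  rw [olsEstimator, fullDesign_inv_mul, kronecker_one_mulVec]

theorem residual_apply (Y : Subj n × Fin p → ℝ) (s : Subj n) (k : Fin p) :
    residual n z Y (s, k)
      = Y (s, k) - ∑ r, designMatrix n z s r * olsEstimator n z Y (r, k) := by
  rw [residual, Pi.sub_apply, fullDesign, kronecker_one_mulVec]

theorem leverage_eq (s : Subj n) :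
    leverage n z s = ∑ r, designMatrix n z s r * olsWeight n z r s := by
  rw [leverage, Matrix.mul_assoc]
  rfl

variable {n z}

theorem olsEstimator_add_mulVec (hdet : IsUnit ((designMatrix n z)ᵀ * designMatrix n z).det)
    (β : Param a c p) (e : Subj n × Fin p → ℝ) :
    olsEstimator n z (fullDesign n z p *ᵥ β + e) = β + olsEstimator n z e := by
  have h : olsWeight n z * designMatrix n z = 1 := by
    rw [olsWeight, Matrix.mul_assoc, Matrix.nonsing_inv_mul _ hdet]
  rw [olsEstimator, fullDesign_inv_mul, Matrix.mulVec_add, Matrix.mulVec_mulVec, fullDesign,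
    ← Matrix.mul_kronecker_mul, h, olsEstimator, fullDesign_inv_mul]
  simp

theorem residual_add_mulVec (hdet : IsUnit ((designMatrix n z)ᵀ * designMatrix n z).det)
    (β : Param a c p) (e : Subj n × Fin p → ℝ) :
    residual n z (fullDesign n z p *ᵥ β + e) = residual n z e := by
  rw [residual, olsEstimator_add_mulVec hdet, residual, Matrix.mulVec_add]
  abel

/-- Under the hypothesis `T μ = 0` the statistic depends only on the errors. -/
theorem mancats_add_mulVec (hdet : IsUnit ((designMatrix n z)ᵀ * designMatrix n z).det)
    {T : Matrix (Fin a × Fin p) (Fin a × Fin p) ℝ} {β : Param a c p}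
    (hβ : T *ᵥ meanPart β = 0) (e : Subj n × Fin p → ℝ) :
    mancats n z T (fullDesign n z p *ᵥ β + e) = mancats n z T e := by
  have hd : diagEstimator n z (fullDesign n z p *ᵥ β + e) = diagEstimator n z e := by
    unfold diagEstimator varEstimator
    rw [residual_add_mulVec hdet]
  have hm : meanPart (olsEstimator n z (fullDesign n z p *ᵥ β + e))
      = meanPart β + meanPart (olsEstimator n z e) := by
    rw [olsEstimator_add_mulVec hdet]; rfl
  unfold mancats
  rw [hd, hm]
  rw [dotProduct_transpose_mul_mul_mulVec, dotProduct_transpose_mul_mul_mulVec, Matrix.mulVec_add,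
    hβ, zero_add]

/-- The quadratic form `v' T' (T D T)⁺ T v` with `D` the diagonal matrix of `d`. -/
noncomputable def waldForm {q : Type*} [Fintype q] [DecidableEq q] (T : Matrix q q ℝ)
    (v d : q → ℝ) : ℝ :=
  v ⬝ᵥ ((Tᵀ * pinv (T * Matrix.diagonal d * T) * T) *ᵥ v)

theorem waldForm_smul {q : Type*} [Fintype q] [DecidableEq q] (T : Matrix q q ℝ)
    (v d : q → ℝ) {N : ℝ} (hN : 0 < N) : waldForm T (√N • v) (N • d) = waldForm T v d := by
  have h : T * Matrix.diagonal (N • d) * T = N • (T * Matrix.diagonal d * T) := by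
    rw [Matrix.diagonal_smul]; simp
  rw [waldForm, h, pinv_smul _ hN.ne', waldForm]
  simp only [Matrix.mul_smul, Matrix.smul_mul, Matrix.smul_mulVec, Matrix.mulVec_smul,
    dotProduct_smul, smul_dotProduct, smul_eq_mul]
  have : √N * √N = N := Real.mul_self_sqrt hN.le
  field_simp
  rw [sq, this]

/-- The statistic is invariant under rescaling by the total sample size. -/
theorem mancats_eq_waldForm (T : Matrix (Fin a × Fin p) (Fin a × Fin p) ℝ)
    (Y : Subj n × Fin p → ℝ) {N : ℝ} (hN : 0 < N) :
    mancats n z T Y = waldForm T (√N • meanPart (olsEstimator n z Y))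
      (N • fun q => (n q.1 : ℝ)⁻¹ * varEstimator n z Y q.1 q.2) := by
  rw [waldForm_smul _ _ _ hN]
  rfl

/-- The scaled covariance matrix of the estimated means, through the least squares weights. -/
theorem scaledMeanCov_apply (hN : (totalSize n : ℝ) ≠ 0)
    (hdet : IsUnit ((designMatrix n z)ᵀ * designMatrix n z).det)
    (Sig : Fin a → Matrix (Fin p) (Fin p) ℝ) (i i' : Fin a) (k l : Fin p) :
    scaledMeanCov n z Sig (i, k) (i', l) = totalSize n *
      ∑ s, olsWeight n z (Sum.inl i) s * olsWeight n z (Sum.inl i') s * Sig s.1 k l := by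
  set N : ℝ := (totalSize n : ℝ)
  set F := fullDesign n z p with hF
  have hF' : F = fullDesign n z p := rfl
  have hFdet : IsUnit (Fᵀ * F).det := by
    rw [hF', fullDesign_transpose_mul, Matrix.det_kronecker]
    simpa using hdet.pow _
  have hinv : (N⁻¹ • (Fᵀ * F))⁻¹ = N • (Fᵀ * F)⁻¹ := by
    have := Matrix.inv_smul' (A := Fᵀ * F) (Units.mk0 N⁻¹ (inv_ne_zero hN)) hFdet
    simpa [Units.smul_def] using this
  have hFs : (Fᵀ * F)ᵀ = Fᵀ * F := by simp [Matrix.transpose_mul]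
  have hinvs : ((Fᵀ * F)⁻¹)ᵀ = (Fᵀ * F)⁻¹ := by rw [Matrix.transpose_nonsing_inv, hFs]
  have hmat : (N⁻¹ • (Fᵀ * F))⁻¹ * (N⁻¹ • (Fᵀ * errorCov n Sig * F)) * (N⁻¹ • (Fᵀ * F))⁻¹
      = N • ((olsWeight n z ⊗ₖ (1 : Matrix (Fin p) (Fin p) ℝ)) * errorCov n Sig *
        (olsWeight n z ⊗ₖ (1 : Matrix (Fin p) (Fin p) ℝ))ᵀ) := by
    rw [hinv, ← fullDesign_inv_mul, Matrix.transpose_mul, hinvs]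
    simp only [Matrix.mul_smul, Matrix.smul_mul, smul_smul, Matrix.transpose_transpose,
      Matrix.mul_assoc, ← hF]
    congr 1
    field_simp
  rw [scaledMeanCov, Matrix.submatrix_apply, hmat, Matrix.smul_apply, smul_eq_mul]
  congr 1
  simp only [Matrix.mul_apply, Matrix.transpose_apply, Matrix.kroneckerMap_apply, errorCov,
    Matrix.of_apply, Fintype.sum_prod_type, Matrix.one_apply]
  simp [mul_ite]
  refine Finset.sum_congr rfl fun s _ => ?_
  ring

end LeastSquares

/-! ### Asymptotics of the design -/

section Design

variable {a c : ℕ}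

/-- Quantitative regularity of one design: `h` bounds the largest squared row norm relative to the
total sample size, `K` bounds the remaining quantities. Regularity of a sequence of designs is
regularity with a fixed `K` and some `h → 0`. -/
structure RegularDesign (n : Fin a → ℕ) (z : Fin a → ℕ → Fin c → ℝ) (K h : ℝ) : Prop where
  total_pos : 0 < (totalSize n : ℝ)
  det_isUnit : IsUnit ((designMatrix n z)ᵀ * designMatrix n z).det
  K_pos : 0 < K
  h_pos : 0 < h
  rowSq_le : ∀ s, rowSq n z s ≤ h * totalSize n
  olsWeight_sq_le : ∀ r s, olsWeight n z r s ^ 2 ≤ K * rowSq n z s / (totalSize n : ℝ) ^ 2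
  sum_rowSq_le : ∑ s, rowSq n z s ≤ K * totalSize n
  size_pos : ∀ i, 0 < (n i : ℝ)
  total_le : ∀ i, (totalSize n : ℝ) ≤ K * n i

/-- If the averages of a nonnegative sequence converge, its maxima are negligible relative to the
number of terms. -/
theorem eventually_forall_lt_le_mul {u : ℕ → ℝ} (hu : ∀ j, 0 ≤ u j) {b : ℝ}
    (h : Tendsto (fun N : ℕ => (N : ℝ)⁻¹ * ∑ j ∈ Finset.range N, u j) atTop (𝓝 b))
    {η : ℝ} (hη : 0 < η) : ∀ᶠ N : ℕ in atTop, ∀ j < N, u j ≤ η * N := by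
  set v : ℕ → ℝ := fun N => (N : ℝ)⁻¹ * ∑ j ∈ Finset.range N, u j with hv
  have hS : ∀ N : ℕ, ∑ j ∈ Finset.range N, u j = N * v N := by
    intro N
    rcases Nat.eq_zero_or_pos N with rfl | hN
    · simp
    · have : (N : ℝ) ≠ 0 := by positivity
      simp [hv, this]
  have hlim : Tendsto (fun j : ℕ => (v (j + 1) - v j) + v j * (1 / ((j : ℝ) + 1))) atTop
      (𝓝 0) := by
    have h1 := ((tendsto_add_atTop_iff_nat 1).mpr h).sub h
    have h2 := h.mul (tendsto_one_div_add_atTop_nhds_zero_nat (𝕜 := ℝ))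
    simpa using h1.add h2
  obtain ⟨J, hJ⟩ := eventually_atTop.mp (hlim.eventually_lt_const hη)
  have hlarge : ∀ j ≥ J, u j ≤ η * (j + 1) := by
    intro j hj
    have h1 : u j = (j + 1) * v (j + 1) - j * v j := by
      have e1 := hS (j + 1)
      rw [Finset.sum_range_succ, hS j] at e1
      push_cast at e1
      linarith
    have hj0 : (0 : ℝ) < j + 1 := by positivity
    have h2 : u j = (v (j + 1) - v j + v j * (1 / ((j : ℝ) + 1))) * (j + 1) := by
      rw [h1]; field_simp; ring
    rw [h2]
    exact mul_le_mul_of_nonneg_right (hJ j hj).le hj0.le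
  have hev : ∀ᶠ N : ℕ in atTop, ∑ j ∈ Finset.range J, u j ≤ η * N :=
    (tendsto_natCast_atTop_atTop.const_mul_atTop hη).eventually_ge_atTop _
  filter_upwards [hev] with N hN j hj
  rcases lt_or_ge j J with h1 | h1
  · exact (Finset.single_le_sum (f := u) (fun i _ => hu i) (Finset.mem_range.mpr h1)).trans hN
  · refine (hlarge j h1).trans (mul_le_mul_of_nonneg_left ?_ hη.le)
    exact_mod_cast hj

/-- Under the assumptions on the covariates the designs are eventually regular. The inverse of the
normalized Gram matrix is bounded since its limit is nonsingular, and the rows are negligible since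
the second moments of the covariates converge. -/
theorem exists_regularDesign {n : ℕ → Fin a → ℕ} {z : Fin a → ℕ → Fin c → ℝ}
    (hN : Tendsto (fun m => totalSize (n m)) atTop atTop)
    {κ : Fin a → ℝ} (hκ : ∀ i, 0 < κ i)
    (hratio : ∀ i, Tendsto (fun m => (totalSize (n m) : ℝ) / (n m i : ℝ)) atTop (𝓝 (κ i)))
    {Ξ : Matrix (Fin a ⊕ Fin c) (Fin a ⊕ Fin c) ℝ}
    (hΞ : Tendsto (fun m => (totalSize (n m) : ℝ)⁻¹ •
      ((designMatrix (n m) z)ᵀ * designMatrix (n m) z)) atTop (𝓝 Ξ))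
    (hΞdet : IsUnit Ξ.det) {Ξgrp : Fin a → Matrix (Fin c) (Fin c) ℝ}
    (hz2 : ∀ i, Tendsto
      (fun N : ℕ => (N : ℝ)⁻¹ • ∑ j ∈ Finset.range N, Matrix.vecMulVec (z i j) (z i j))
      atTop (𝓝 (Ξgrp i))) :
    ∃ K : ℝ, ∃ h : ℕ → ℝ, Tendsto h atTop (𝓝 0) ∧
      ∀ᶠ m in atTop, RegularDesign (n m) z K (h m) := by
  have hNr : Tendsto (fun m => (totalSize (n m) : ℝ)) atTop atTop :=
    tendsto_natCast_atTop_atTop.comp hN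
  have hNpos : ∀ᶠ m in atTop, 0 < (totalSize (n m) : ℝ) := hNr.eventually_gt_atTop 0
  set G : ℕ → Matrix (Fin a ⊕ Fin c) (Fin a ⊕ Fin c) ℝ := fun m => ((totalSize (n m) : ℝ)⁻¹ •
      ((designMatrix (n m) z)ᵀ * designMatrix (n m) z))⁻¹ with hG
  have hGlim : Tendsto G atTop (𝓝 Ξ⁻¹) :=
    (continuousAt_matrix_inv _ (NormedRing.inverse_continuousAt hΞdet.unit)).tendsto.comp hΞ
  set K₁ : ℝ := ∑ r, ∑ r', Ξ⁻¹ r r' ^ 2 + 1 with hK₁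
  set K₂ : ℝ := |∑ r, Ξ r r| + 1 with hK₂
  set K₃ : ℝ := ∑ i, κ i + 1 with hK₃
  have hK₁0 : 0 < K₁ := by positivity
  have hK₂0 : 0 < K₂ := by positivity
  have hK₃0 : 0 < K₃ := by
    have : 0 ≤ ∑ i, κ i := Finset.sum_nonneg fun i _ => (hκ i).le
    positivity
  refine ⟨K₁ + K₂ + K₃, fun m => ⨆ s, rowSq (n m) z s / totalSize (n m), ?_, ?_⟩
  · -- the largest row
    have hrow : ∀ η > 0, ∀ᶠ m in atTop, ∀ s, rowSq (n m) z s ≤ η * totalSize (n m) := by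
      intro η hη
      have hz : ∀ i, ∀ᶠ m in atTop, ∀ j < n m i, ∑ w, z i j w ^ 2 ≤ η / 2 * n m i := by
        intro i
        have hni : Tendsto (fun m => n m i) atTop atTop := by
          rw [← tendsto_natCast_atTop_iff (R := ℝ)]
          refine tendsto_atTop_mono' _ ?_ (hNr.atTop_div_const (r := κ i + 1) (by linarith [hκ i]))
          filter_upwards [(hratio i).eventually_lt_const (lt_add_one (κ i)),
            (hratio i).eventually_const_lt (hκ i)] with m h1 h2
          have hn0 : (0 : ℝ) < n m i := by
            rcases (Nat.cast_nonneg (n m i) : (0 : ℝ) ≤ n m i).eq_or_lt with h | h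
            · rw [← h] at h2; simp at h2
            · exact h
          rw [div_lt_iff₀ hn0] at h1
          rw [div_le_iff₀ (by linarith [hκ i])]
          linarith
        refine hni.eventually (eventually_forall_lt_le_mul (b := ∑ w, Ξgrp i w w)
          (fun j => Finset.sum_nonneg fun w _ => sq_nonneg _) ?_ (half_pos hη))
        have : ∀ w, Tendsto (fun N : ℕ => ((N : ℝ)⁻¹ •
            ∑ j ∈ Finset.range N, Matrix.vecMulVec (z i j) (z i j)) w w) atTop
            (𝓝 (Ξgrp i w w)) := fun w =>
          ((continuous_apply_apply w w).tendsto (Ξgrp i)).comp (hz2 i)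
        refine (tendsto_finsetSum Finset.univ fun w _ => this w).congr fun N => ?_
        simp only [Matrix.smul_apply, Matrix.sum_apply, Matrix.vecMulVec_apply, smul_eq_mul]
        rw [← Finset.mul_sum, Finset.sum_comm]
        simp [sq]
      filter_upwards [eventually_all.mpr hz, hNr.eventually_ge_atTop (2 / η)] with m hm hm' s
      rw [rowSq_eq]
      have h1 := hm s.1 s.2 s.2.isLt
      have h2 : (n m s.1 : ℝ) ≤ totalSize (n m) := by
        exact_mod_cast Finset.single_le_sum (f := n m) (fun _ _ => Nat.zero_le _)
          (Finset.mem_univ s.1)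
      rw [div_le_iff₀ hη] at hm'
      nlinarith
    rw [Metric.tendsto_nhds]
    intro η hη
    filter_upwards [hrow (η / 2) (half_pos hη), hNpos] with m hm hm'
    have h0 : 0 ≤ ⨆ s, rowSq (n m) z s / totalSize (n m) :=
      Real.iSup_nonneg fun s => div_nonneg (rowSq_nonneg _ _ s) hm'.le
    rw [Real.dist_eq, sub_zero, abs_of_nonneg h0]
    refine lt_of_le_of_lt (Real.iSup_le (fun s => ?_) (half_pos hη).le) (half_lt_self hη)
    rw [div_le_iff₀ hm']
    exact hm s
  · have hGe : ∀ r, ∀ᶠ m in atTop, ∑ r', G m r r' ^ 2 ≤ K₁ := by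
      intro r
      have h1 : Tendsto (fun m => ∑ r', G m r r' ^ 2) atTop (𝓝 (∑ r', Ξ⁻¹ r r' ^ 2)) :=
        tendsto_finsetSum _ fun r' _ => by
          have h2 : Tendsto (fun m => G m r r') atTop (𝓝 (Ξ⁻¹ r r')) :=
            tendsto_pi_nhds.mp (tendsto_pi_nhds.mp hGlim r) r'
          exact h2.pow 2
      refine (h1.eventually_lt_const ?_).mono fun _ h => h.le
      have : ∑ r', Ξ⁻¹ r r' ^ 2 ≤ ∑ r, ∑ r', Ξ⁻¹ r r' ^ 2 :=
        Finset.single_le_sum (f := fun r => ∑ r', Ξ⁻¹ r r' ^ 2)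
          (fun _ _ => Finset.sum_nonneg fun _ _ => sq_nonneg _) (Finset.mem_univ r)
      linarith
    have htr : ∀ᶠ m in atTop, ∑ r, ((totalSize (n m) : ℝ)⁻¹ •
        ((designMatrix (n m) z)ᵀ * designMatrix (n m) z)) r r < K₂ := by
      have h1 : Tendsto (fun m => ∑ r, ((totalSize (n m) : ℝ)⁻¹ •
          ((designMatrix (n m) z)ᵀ * designMatrix (n m) z)) r r) atTop (𝓝 (∑ r, Ξ r r)) :=
        tendsto_finsetSum _ fun r _ => ((continuous_apply_apply r r).tendsto Ξ).comp hΞ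
      refine h1.eventually_lt_const ?_
      have := le_abs_self (∑ r, Ξ r r)
      linarith
    have hdet : ∀ᶠ m in atTop, ((totalSize (n m) : ℝ)⁻¹ •
        ((designMatrix (n m) z)ᵀ * designMatrix (n m) z)).det ≠ 0 :=
      ((Continuous.matrix_det continuous_id).tendsto Ξ |>.comp hΞ).eventually_ne hΞdet.ne_zero
    have hκe : ∀ᶠ m in atTop, ∀ i, (totalSize (n m) : ℝ) / n m i < K₃ ∧
        0 < (totalSize (n m) : ℝ) / n m i := eventually_all.mpr fun i => by
      refine ((hratio i).eventually_lt_const ?_).and ((hratio i).eventually_const_lt (hκ i))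
      have : κ i ≤ ∑ i, κ i := Finset.single_le_sum (fun i _ => (hκ i).le) (Finset.mem_univ i)
      linarith
    filter_upwards [hNpos, eventually_all.mpr hGe, htr, hdet, hκe] with m hm hm₁ hm₂ hm₃ hm₄
    have hsize : ∀ i, (0 : ℝ) < n m i := fun i => by
      rcases (Nat.cast_nonneg (n m i) : (0 : ℝ) ≤ n m i).eq_or_lt with h | h
      · have := (hm₄ i).2
        rw [← h] at this; simp at this
      · exact h
    have hdet' : IsUnit ((designMatrix (n m) z)ᵀ * designMatrix (n m) z).det := by
      rw [isUnit_iff_ne_zero]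
      intro h0
      apply hm₃
      rw [Matrix.det_smul, h0, mul_zero]
    have hbdd : BddAbove (Set.range fun s => rowSq (n m) z s / totalSize (n m)) :=
      (Set.finite_range _).bddAbove
    have hle : ∀ s, rowSq (n m) z s ≤
        (⨆ s, rowSq (n m) z s / totalSize (n m)) * totalSize (n m) := fun s => by
      rw [← div_le_iff₀ hm]
      exact le_ciSup hbdd s
    have hW : olsWeight (n m) z
        = (totalSize (n m) : ℝ)⁻¹ • (G m * (designMatrix (n m) z)ᵀ) := by
      have hinv : G m = (totalSize (n m) : ℝ) •
          ((designMatrix (n m) z)ᵀ * designMatrix (n m) z)⁻¹ := by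
        have := Matrix.inv_smul' (A := (designMatrix (n m) z)ᵀ * designMatrix (n m) z)
          (Units.mk0 (totalSize (n m) : ℝ)⁻¹ (inv_ne_zero hm.ne')) hdet'
        simpa [Units.smul_def] using this
      rw [hinv, olsWeight, Matrix.smul_mul, smul_smul, inv_mul_cancel₀ hm.ne', one_smul]
    refine ⟨hm, hdet', by positivity, ?_, hle, ?_, ?_, hsize, ?_⟩
    · obtain ⟨i, hi⟩ : ∃ i, 0 < n m i := by
        by_contra hn
        push Not at hn
        have : totalSize (n m) = 0 := Finset.sum_eq_zero fun i _ => Nat.le_zero.mp (hn i)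
        rw [this] at hm; simp at hm
      have h1 := (one_le_rowSq (n m) z ⟨i, ⟨0, hi⟩⟩).trans (hle _)
      by_contra hn
      nlinarith
    · intro r s
      have h1 : olsWeight (n m) z r s
          = (totalSize (n m) : ℝ)⁻¹ * ∑ r', G m r r' * designMatrix (n m) z s r' := by
        rw [hW]; rfl
      have h2 : (∑ r', G m r r' * designMatrix (n m) z s r') ^ 2
          ≤ (∑ r', G m r r' ^ 2) * rowSq (n m) z s := Finset.sum_mul_sq_le_sq_mul_sq _ _ _
      have h3 : (∑ r', G m r r' ^ 2) * rowSq (n m) z s ≤ (K₁ + K₂ + K₃) * rowSq (n m) z s :=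
        mul_le_mul_of_nonneg_right (by linarith [hm₁ r]) (rowSq_nonneg _ _ _)
      rw [h1, mul_pow, inv_pow, inv_mul_eq_div]
      exact div_le_div_of_nonneg_right (h2.trans h3) (by positivity)
    · have h1 : ∑ s, rowSq (n m) z s = totalSize (n m) * ∑ r, ((totalSize (n m) : ℝ)⁻¹ •
          ((designMatrix (n m) z)ᵀ * designMatrix (n m) z)) r r := by
        rw [sum_rowSq]
        simp only [Matrix.smul_apply, smul_eq_mul, ← Finset.mul_sum]
        field_simp
      rw [h1]
      nlinarith
    · intro i
      have := (hm₄ i).1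
      rw [div_lt_iff₀ (hsize i)] at this
      nlinarith [hsize i]

end Design

/-! ### Measurability of the statistics -/

section Measurability

variable {a c p : ℕ} {n : Fin a → ℕ} {z : Fin a → ℕ → Fin c → ℝ}

theorem measurable_residual (q : Subj n × Fin p) :
    Measurable fun Y : Subj n × Fin p → ℝ => residual n z Y q := by
  have : Continuous fun Y : Subj n × Fin p → ℝ => residual n z Y := by
    unfold residual olsEstimator; fun_prop
  exact ((continuous_apply q).comp this).measurable

theorem measurable_mancats (T : Matrix (Fin a × Fin p) (Fin a × Fin p) ℝ) :
    Measurable fun Y : Subj n × Fin p → ℝ => mancats n z T Y := by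
  have hm : ∀ q, Measurable fun Y : Subj n × Fin p → ℝ => meanPart (olsEstimator n z Y) q := by
    intro q
    have : Continuous fun Y : Subj n × Fin p → ℝ => meanPart (olsEstimator n z Y) := by
      unfold meanPart olsEstimator; fun_prop
    exact ((continuous_apply q).comp this).measurable
  have hv : ∀ i k, Measurable fun Y : Subj n × Fin p → ℝ => varEstimator n z Y i k := by
    intro i k
    exact (Finset.measurable_sum _ fun j _ => (measurable_residual _).pow_const 2).const_mul _
  have hD : ∀ q q', Measurable fun Y : Subj n × Fin p → ℝ => diagEstimator n z Y q q' := by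
    intro q q'
    by_cases h : q = q'
    · subst h
      simpa [diagEstimator] using (hv q.1 q.2).const_mul _
    · simp [diagEstimator, h]
  have hB : ∀ q q', Measurable fun Y : Subj n × Fin p → ℝ =>
      pinv (T * diagEstimator n z Y * T) q q' := by
    refine measurable_pinv_apply fun q q' => ?_
    simp only [Matrix.mul_apply]
    exact Finset.measurable_sum _ fun i _ =>
      (Finset.measurable_sum _ fun j _ => (hD _ _).const_mul _).mul_const _
  unfold mancats
  simp only [dotProduct, Matrix.mulVec, Matrix.mul_apply]
  exact Finset.measurable_sum _ fun i _ => (hm i).mul (Finset.measurable_sum _ fun j _ =>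
    (Finset.measurable_sum _ fun k _ => (Finset.measurable_sum _ fun l _ =>
      (hB _ _).const_mul _).mul_const _).mul (hm j))

end Measurability

/-! ### Moment bounds for error arrays -/

section ErrorArray

variable {Ω : Type*} [MeasurableSpace Ω] {P : Measure Ω}

/-- A finite family of independent centred random vectors with finite fourth moments. -/
structure IsErrorArray {ι : Type*} {p : ℕ} (P : Measure Ω) (e : ι → Ω → Fin p → ℝ) : Prop where
  measurable : ∀ s, Measurable (e s)
  indep : iIndepFun e P
  memLp : ∀ s k, MemLp (fun ω => e s ω k) 4 P
  mean : ∀ s k, ∫ ω, e s ω k ∂P = 0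

/-- The stacked vector of an array. -/
def stack {ι α : Type*} {p : ℕ} (e : ι → α → Fin p → ℝ) (ω : α) : ι × Fin p → ℝ :=
  fun q => e q.1 ω q.2

theorem IsErrorArray.measurable_apply {ι : Type*} {p : ℕ} {e : ι → Ω → Fin p → ℝ}
    (he : IsErrorArray P e) (s : ι) (k : Fin p) : Measurable fun ω => e s ω k :=
  (measurable_pi_apply k).comp (he.measurable s)

variable [IsProbabilityMeasure P]

theorem integral_sq_sum_mul_of_indep {ι : Type*} [Fintype ι] {X : ι → Ω → ℝ}
    (hX : ∀ s, MemLp (X s) 2 P) (h0 : ∀ s, ∫ ω, X s ω ∂P = 0) (hi : iIndepFun X P) (b : ι → ℝ) :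
    ∫ ω, (∑ s, b s * X s ω) ^ 2 ∂P = ∑ s, b s ^ 2 * ∫ ω, X s ω ^ 2 ∂P := by
  have hY : ∀ s, MemLp (fun ω => b s * X s ω) 2 P := fun s => (hX s).const_mul _
  have hI : ∀ s, Integrable (X s) P := fun s => (hX s).integrable (by norm_num)
  have hYi : iIndepFun (fun s ω => b s * X s ω) P :=
    hi.comp (fun s x => b s * x) fun s => measurable_const_mul _
  have hv := IndepFun.variance_sum (μ := P) (X := fun s ω => b s * X s ω) (s := Finset.univ)
    (fun s _ => hY s) (fun s _ t _ hst => hYi.indepFun hst)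
  have hm : ∫ ω, (∑ s, fun ω => b s * X s ω) ω ∂P = 0 := by
    simp only [Finset.sum_apply]
    rw [integral_finsetSum _ fun s _ => (hI s).const_mul _]
    simp [integral_const_mul, h0]
  rw [variance_of_integral_eq_zero (memLp_finsetSum' _ fun s _ => hY s).aemeasurable hm] at hv
  simp only [Finset.sum_apply] at hv
  rw [hv]
  refine Finset.sum_congr rfl fun s _ => ?_
  rw [variance_const_mul, variance_of_integral_eq_zero (hX s).aemeasurable (h0 s)]

theorem sq_mul_le_sum_pow_four {p : ℕ} (x : Fin p → ℝ) (k l : Fin p) :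
    (x k * x l) ^ 2 ≤ ∑ k, x k ^ 4 := by
  have h : ∀ k, x k ^ 4 ≤ ∑ k, x k ^ 4 := fun k =>
    Finset.single_le_sum (f := fun k => x k ^ 4) (fun _ _ => by positivity)
      (Finset.mem_univ k)
  nlinarith [h k, h l, sq_nonneg (x k ^ 2 - x l ^ 2)]

namespace IsErrorArray

variable {ι : Type*} {p : ℕ} {e : ι → Ω → Fin p → ℝ}

theorem integrable_sq (he : IsErrorArray P e) (s : ι) (k : Fin p) :
    Integrable (fun ω => e s ω k ^ 2) P :=
  integrable_pow_of_memLp_four (he.memLp s k) (by norm_num)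

theorem integrable_pow_four (he : IsErrorArray P e) (s : ι) (k : Fin p) :
    Integrable (fun ω => e s ω k ^ 4) P :=
  integrable_pow_of_memLp_four (he.memLp s k) le_rfl

theorem integrable_mul (he : IsErrorArray P e) (s : ι) (k l : Fin p) :
    Integrable (fun ω => e s ω k * e s ω l) P :=
  MemLp.integrable_mul (p := 2) (q := 2) ((he.memLp s k).mono_exponent (by norm_num))
    ((he.memLp s l).mono_exponent (by norm_num))

theorem memLp_two_mul (he : IsErrorArray P e) (s : ι) (k l : Fin p) :
    MemLp (fun ω => e s ω k * e s ω l) 2 P := by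
  have hm : Measurable fun ω => e s ω k * e s ω l :=
    (he.measurable_apply s k).mul (he.measurable_apply s l)
  refine (memLp_two_iff_integrable_sq hm.aestronglyMeasurable).mpr ?_
  refine Integrable.mono' (integrable_finsetSum Finset.univ fun k _ => he.integrable_pow_four s k)
    (hm.pow_const 2).aestronglyMeasurable (ae_of_all _ fun ω => ?_)
  rw [Real.norm_of_nonneg (sq_nonneg _)]
  exact sq_mul_le_sum_pow_four _ k l

theorem integral_sq_mul_sub_le (he : IsErrorArray P e) (s : ι) (k l : Fin p) :
    ∫ ω, (e s ω k * e s ω l - ∫ ω, e s ω k * e s ω l ∂P) ^ 2 ∂P ≤ ∑ k, ∫ ω, e s ω k ^ 4 ∂P := by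
  have h2 := he.memLp_two_mul s k l
  rw [← variance_eq_integral h2.aemeasurable]
  refine (variance_le_expectation_sq h2.1).trans ?_
  rw [← integral_finsetSum _ fun k _ => he.integrable_pow_four s k]
  exact integral_mono_of_nonneg (ae_of_all _ fun ω => sq_nonneg (e s ω k * e s ω l))
    (integrable_finsetSum _ fun k _ => he.integrable_pow_four s k)
    (ae_of_all _ fun ω => sq_mul_le_sum_pow_four _ k l)

theorem memLp_sum_mul_sub (he : IsErrorArray P e) [Fintype ι] (b : ι → ℝ) (k l : Fin p) :
    MemLp (fun ω => ∑ s, b s * (e s ω k * e s ω l - ∫ ω, e s ω k * e s ω l ∂P)) 2 P :=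
  memLp_finsetSum _ fun s _ => ((he.memLp_two_mul s k l).sub (memLp_const _)).const_mul _

/-- The second moment of a weighted sum of centred products of errors, with weights dominated by
those of `w`. -/
theorem integral_sq_sum_mul_sub_le [Fintype ι] (he : IsErrorArray P e) {b w : ι → ℝ}
    (hb : ∀ s, |b s| ≤ w s) (k l : Fin p) :
    ∫ ω, (∑ s, b s * (e s ω k * e s ω l - ∫ ω, e s ω k * e s ω l ∂P)) ^ 2 ∂P ≤
      ∑ s, w s ^ 2 * ∑ k, ∫ ω, e s ω k ^ 4 ∂P := by
  have hX : ∀ s, MemLp (fun ω => e s ω k * e s ω l - ∫ ω, e s ω k * e s ω l ∂P) 2 P := fun s =>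
    (he.memLp_two_mul s k l).sub (memLp_const _)
  rw [integral_sq_sum_mul_of_indep hX ?_ ?_ b]
  · refine Finset.sum_le_sum fun s _ => ?_
    refine mul_le_mul (sq_le_sq' ?_ ?_) (he.integral_sq_mul_sub_le s k l)
      (integral_nonneg fun _ => sq_nonneg _) (sq_nonneg _)
    · linarith [(abs_le.mp (hb s)).1]
    · exact (abs_le.mp (hb s)).2
  · intro s
    rw [integral_sub (he.integrable_mul s k l) (integrable_const _)]
    simp
  · exact he.indep.comp (fun s x => x k * x l - ∫ ω, e s ω k * e s ω l ∂P) fun s => by fun_prop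

end IsErrorArray

end ErrorArray

/-! ### Residuals and errors -/

section ResidualGap

variable {a c p : ℕ} {n : Fin a → ℕ} {z : Fin a → ℕ → Fin c → ℝ}

/-- The weighted average `N⁻¹ ∑_s |x_s|² ∑_{k,l} |u_{sk} u_{sl} - y_{sk} y_{sl}|` of the distance
between products of residuals and products of observations. -/
noncomputable def residualGap (n : Fin a → ℕ) (z : Fin a → ℕ → Fin c → ℝ)
    (Y : Subj n × Fin p → ℝ) : ℝ :=
  (totalSize n : ℝ)⁻¹ * ∑ s, rowSq n z s * ∑ k, ∑ l,
    |residual n z Y (s, k) * residual n z Y (s, l) - Y (s, k) * Y (s, l)|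

theorem residualGap_nonneg (Y : Subj n × Fin p → ℝ) : 0 ≤ residualGap n z Y :=
  mul_nonneg (by positivity) (Finset.sum_nonneg fun s _ => mul_nonneg (rowSq_nonneg n z s)
    (Finset.sum_nonneg fun _ _ => Finset.sum_nonneg fun _ _ => abs_nonneg _))

theorem abs_sub_mul_sub_sub_mul_le (x y d d' : ℝ) {θ : ℝ} (hθ : 0 < θ) :
    |(x - d) * (y - d') - x * y| ≤
      θ / 2 * (x ^ 2 + y ^ 2) + (θ⁻¹ + 1) / 2 * (d ^ 2 + d' ^ 2) := by
  have key : ∀ u v : ℝ, |u * v| ≤ θ / 2 * u ^ 2 + θ⁻¹ / 2 * v ^ 2 := by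
    intro u v
    have h := mul_nonneg (inv_nonneg.mpr hθ.le) (sq_nonneg (θ * |u| - |v|))
    have e : θ⁻¹ * (θ * |u| - |v|) ^ 2 = θ * u ^ 2 + θ⁻¹ * v ^ 2 - 2 * |u * v| := by
      rw [abs_mul, ← sq_abs u, ← sq_abs v]; field_simp; ring
    linarith
  have h1 := key x d'
  have h2 := key y d
  have h3 : |d * d'| ≤ (d ^ 2 + d' ^ 2) / 2 := by
    rw [abs_le]; constructor <;> nlinarith [sq_nonneg (d - d'), sq_nonneg (d + d')]
  have e : (x - d) * (y - d') - x * y = -(x * d') + -(y * d) + d * d' := by ring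
  rw [e]
  refine (abs_add_le _ _).trans ((add_le_add_left (abs_add_le _ _) _).trans ?_)
  rw [abs_neg, abs_neg]
  linarith

/-- A residual differs from its observation by `x_s` applied to the estimator, a quantity of squared
size at most `h * N * |β̂|²`. Young's inequality with parameter `√h` bounds the mixed terms. -/
theorem residualGap_le {K h : ℝ} (hreg : RegularDesign n z K h) (Y : Subj n × Fin p → ℝ) :
    residualGap n z Y ≤
      p * √h * ((totalSize n : ℝ)⁻¹ * ∑ s, rowSq n z s * ∑ k, Y (s, k) ^ 2) +
      p * (√h + h) * K * totalSize n * ∑ k, ∑ r, olsEstimator n z Y (r, k) ^ 2 := by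
  set N : ℝ := (totalSize n : ℝ) with hNdef
  have hN : 0 < N := hreg.total_pos
  have hh : 0 < √h := Real.sqrt_pos.mpr hreg.h_pos
  set d : Subj n → Fin p → ℝ := fun s k =>
    ∑ r, designMatrix n z s r * olsEstimator n z Y (r, k) with hd
  have hres : ∀ s k, residual n z Y (s, k) = Y (s, k) - d s k := fun s k => residual_apply n z Y s k
  have hdle : ∀ s k, d s k ^ 2 ≤ rowSq n z s * ∑ r, olsEstimator n z Y (r, k) ^ 2 := fun s k =>
    Finset.sum_mul_sq_le_sq_mul_sq _ _ _
  set S := ∑ k, ∑ r, olsEstimator n z Y (r, k) ^ 2 with hS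
  have hS0 : 0 ≤ S := Finset.sum_nonneg fun _ _ => Finset.sum_nonneg fun _ _ => sq_nonneg _
  have hrow : ∀ s, rowSq n z s * ∑ k, ∑ l,
      |residual n z Y (s, k) * residual n z Y (s, l) - Y (s, k) * Y (s, l)| ≤
      p * √h * (rowSq n z s * ∑ k, Y (s, k) ^ 2) +
        p * ((√h)⁻¹ + 1) * (h * N) * S * rowSq n z s := by
    intro s
    have h1 : ∑ k, ∑ l,
        |residual n z Y (s, k) * residual n z Y (s, l) - Y (s, k) * Y (s, l)| ≤
        ∑ k : Fin p, ∑ l : Fin p, (√h / 2 * (Y (s, k) ^ 2 + Y (s, l) ^ 2) +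
          ((√h)⁻¹ + 1) / 2 * (d s k ^ 2 + d s l ^ 2)) :=
      Finset.sum_le_sum fun k _ => Finset.sum_le_sum fun l _ => by
        rw [hres, hres]; exact abs_sub_mul_sub_sub_mul_le _ _ _ _ hh
    have h2 : ∑ k : Fin p, ∑ l : Fin p, (√h / 2 * (Y (s, k) ^ 2 + Y (s, l) ^ 2) +
          ((√h)⁻¹ + 1) / 2 * (d s k ^ 2 + d s l ^ 2))
        = p * √h * ∑ k, Y (s, k) ^ 2 + p * ((√h)⁻¹ + 1) * ∑ k, d s k ^ 2 := by
      simp only [Finset.sum_add_distrib, ← Finset.mul_sum, Finset.sum_const, Finset.card_univ,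
        Fintype.card_fin, nsmul_eq_mul]
      ring
    have h3 : ∑ k, d s k ^ 2 ≤ rowSq n z s * S := by
      rw [hS, Finset.mul_sum]
      exact Finset.sum_le_sum fun k _ => hdle s k
    have h4 : ∑ k, d s k ^ 2 ≤ h * N * S :=
      h3.trans (mul_le_mul_of_nonneg_right (hreg.rowSq_le s) hS0)
    have h5 : p * ((√h)⁻¹ + 1) * ∑ k, d s k ^ 2 ≤ p * ((√h)⁻¹ + 1) * (h * N * S) :=
      mul_le_mul_of_nonneg_left h4 (by positivity)
    calc _ ≤ rowSq n z s * (p * √h * ∑ k, Y (s, k) ^ 2 + p * ((√h)⁻¹ + 1) * (h * N * S)) :=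
          mul_le_mul_of_nonneg_left (by linarith) (rowSq_nonneg n z s)
      _ = _ := by ring
  have hsum := Finset.sum_le_sum fun s (_ : s ∈ Finset.univ) => hrow s
  rw [Finset.sum_add_distrib, ← Finset.mul_sum, ← Finset.mul_sum] at hsum
  have e2 : ((√h)⁻¹ + 1) * h = √h + h := by
    have hsq := Real.mul_self_sqrt hreg.h_pos.le
    have : (√h)⁻¹ * h = √h := by
      rw [inv_mul_eq_div, div_eq_iff hh.ne', hsq]
    linarith
  have h6 : p * ((√h)⁻¹ + 1) * (h * N) * S * ∑ s, rowSq n z s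
      ≤ p * (√h + h) * N * S * (K * N) := by
    calc _ = p * (((√h)⁻¹ + 1) * h) * N * S * ∑ s, rowSq n z s := by ring
      _ ≤ _ := by
        rw [e2]
        have := hreg.h_pos
        exact mul_le_mul_of_nonneg_left hreg.sum_rowSq_le (by positivity)
  rw [residualGap, inv_mul_le_iff₀ hN]
  refine hsum.trans ((add_le_add_right h6 _).trans_eq ?_)
  field_simp

variable {Ω : Type*} [MeasurableSpace Ω] {P : Measure Ω} {e : Subj n → Ω → Fin p → ℝ}

theorem IsErrorArray.memLp_olsEstimator (he : IsErrorArray P e) (r : Fin a ⊕ Fin c) (k : Fin p) :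
    MemLp (fun ω => olsEstimator n z (stack e ω) (r, k)) 4 P := by
  simp only [olsEstimator_apply]
  exact memLp_finsetSum _ fun s _ => (he.memLp s k).const_mul _

theorem IsErrorArray.memLp_residual (he : IsErrorArray P e) (s : Subj n) (k : Fin p) :
    MemLp (fun ω => residual n z (stack e ω) (s, k)) 4 P := by
  simp only [residual_apply]
  exact (he.memLp s k).sub (memLp_finsetSum _ fun r _ => (he.memLp_olsEstimator r k).const_mul _)

variable [IsProbabilityMeasure P]

theorem IsErrorArray.integrable_residualGap (he : IsErrorArray P e) :
    Integrable (fun ω => residualGap n z (stack e ω)) P := by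
  refine (integrable_finsetSum _ fun s _ => (integrable_finsetSum _ fun k _ =>
    integrable_finsetSum _ fun l _ => ?_).const_mul _).const_mul _
  refine Integrable.abs ((MemLp.integrable_mul (p := 2) (q := 2) ?_ ?_).sub
    (he.integrable_mul s k l))
  · exact (he.memLp_residual s k).mono_exponent (by norm_num)
  · exact (he.memLp_residual s l).mono_exponent (by norm_num)

/-- In mean, products of residuals differ little from products of errors. -/
theorem IsErrorArray.integral_residualGap_le (he : IsErrorArray P e) {K h : ℝ}
    (hreg : RegularDesign n z K h) :
    ∫ ω, residualGap n z (stack e ω) ∂P ≤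
      p * (√h + (√h + h) * K ^ 2 * (a + c)) *
        ((totalSize n : ℝ)⁻¹ * ∑ s, rowSq n z s * ∑ k, ∫ ω, e s ω k ^ 2 ∂P) := by
  set N : ℝ := (totalSize n : ℝ) with hNdef
  have hN : 0 < N := hreg.total_pos
  have hh0 := hreg.h_pos
  have hK0 := hreg.K_pos
  set M := ∑ s, rowSq n z s * ∑ k, ∫ ω, e s ω k ^ 2 ∂P with hM
  have iols : ∀ r k, Integrable (fun ω => olsEstimator n z (stack e ω) (r, k) ^ 2) P :=
    fun r k => integrable_pow_of_memLp_four (he.memLp_olsEstimator r k) (by norm_num)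
  have i1 : Integrable (fun ω => p * √h * (N⁻¹ * ∑ s, rowSq n z s *
      ∑ k, stack e ω (s, k) ^ 2)) P :=
    ((integrable_finsetSum _ fun s _ => (integrable_finsetSum _ fun k _ =>
      he.integrable_sq s k).const_mul _).const_mul _).const_mul _
  have i2 : Integrable (fun ω => p * (√h + h) * K * N *
      ∑ k, ∑ r, olsEstimator n z (stack e ω) (r, k) ^ 2) P :=
    (integrable_finsetSum _ fun k _ => integrable_finsetSum _ fun r _ => iols r k).const_mul _
  refine (integral_mono_of_nonneg (ae_of_all _ fun ω => residualGap_nonneg _) (i1.add i2)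
    (ae_of_all _ fun ω => residualGap_le hreg _)).trans ?_
  have e1 : ∫ ω, p * √h * (N⁻¹ * ∑ s, rowSq n z s * ∑ k, stack e ω (s, k) ^ 2) ∂P
      = p * √h * (N⁻¹ * M) := by
    simp only [stack]
    rw [integral_const_mul, integral_const_mul, integral_finsetSum _ fun s _ =>
      (integrable_finsetSum _ fun k _ => he.integrable_sq s k).const_mul _]
    congr 2
    refine Finset.sum_congr rfl fun s _ => ?_
    rw [integral_const_mul, integral_finsetSum _ fun k _ => he.integrable_sq s k]
  have e2 : ∫ ω, ∑ k, ∑ r, olsEstimator n z (stack e ω) (r, k) ^ 2 ∂P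
      ≤ (a + c) * (K / N ^ 2 * M) := by
    rw [integral_finsetSum _ fun k _ => integrable_finsetSum _ fun r _ => iols r k]
    have hk : ∀ k, ∫ ω, ∑ r, olsEstimator n z (stack e ω) (r, k) ^ 2 ∂P
        ≤ (a + c) * (K / N ^ 2 * ∑ s, rowSq n z s * ∫ ω, e s ω k ^ 2 ∂P) := by
      intro k
      rw [integral_finsetSum _ fun r _ => iols r k]
      have hr : ∀ r, ∫ ω, olsEstimator n z (stack e ω) (r, k) ^ 2 ∂P
          ≤ K / N ^ 2 * ∑ s, rowSq n z s * ∫ ω, e s ω k ^ 2 ∂P := by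
        intro r
        simp only [olsEstimator_apply]
        rw [integral_sq_sum_mul_of_indep (X := fun s ω => stack e ω (s, k))
          (fun s => (he.memLp s k).mono_exponent (by norm_num)) (fun s => he.mean s k)
          (he.indep.comp (fun s x => x k) fun s => measurable_pi_apply k), Finset.mul_sum]
        refine Finset.sum_le_sum fun s _ => ?_
        calc _ ≤ K * rowSq n z s / N ^ 2 * ∫ ω, e s ω k ^ 2 ∂P :=
              mul_le_mul_of_nonneg_right (hreg.olsWeight_sq_le r s)
                (integral_nonneg fun _ => sq_nonneg _)
          _ = _ := by ring
      refine (Finset.sum_le_sum fun r _ => hr r).trans_eq ?_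
      simp [Finset.sum_const]
    refine (Finset.sum_le_sum fun k _ => hk k).trans_eq ?_
    rw [← Finset.mul_sum, ← Finset.mul_sum, hM]
    simp only [Finset.mul_sum]
    rw [Finset.sum_comm]
  change ∫ ω, (p * √h * (N⁻¹ * ∑ s, rowSq n z s * ∑ k, stack e ω (s, k) ^ 2) +
    p * (√h + h) * K * N * ∑ k, ∑ r, olsEstimator n z (stack e ω) (r, k) ^ 2) ∂P ≤ _
  rw [integral_add i1 i2, e1, integral_const_mul]
  have h3 : p * (√h + h) * K * N * ∫ ω, ∑ k, ∑ r, olsEstimator n z (stack e ω) (r, k) ^ 2 ∂P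
      ≤ p * (√h + h) * K * N * ((a + c) * (K / N ^ 2 * M)) :=
    mul_le_mul_of_nonneg_left e2 (by positivity)
  refine (add_le_add_right h3 _).trans_eq ?_
  field_simp

end ResidualGap

/-! ### The limit law of the statistic for general error arrays -/

section LimitLaw

variable {a c p : ℕ} {Ω : Type*} [MeasurableSpace Ω] {P : Measure Ω}

theorem measureReal_exists_le_tendsto {q : Type*} [Fintype q] {f : ℕ → Ω → q → ℝ} {δ : q → ℝ}
    [IsFiniteMeasure P]
    (h : ∀ i, Tendsto (fun m => P.real {ω | δ i ≤ f m ω i}) atTop (𝓝 0)) :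
    Tendsto (fun m => P.real {ω | ∃ i, δ i ≤ f m ω i}) atTop (𝓝 0) := by
  refine squeeze_zero (g := fun m => ∑ i, P.real {ω | δ i ≤ f m ω i})
    (fun _ => measureReal_nonneg) (fun m => ?_)
    (by simpa using tendsto_finsetSum Finset.univ fun i _ => h i)
  have : {ω | ∃ i, δ i ≤ f m ω i} = ⋃ i, {ω | δ i ≤ f m ω i} := by ext; simp
  rw [this]
  exact measureReal_iUnion_fintype_le _

theorem tendstoInMeasure_pi_const {q : Type*} [Fintype q] [IsFiniteMeasure P] {f : ℕ → Ω → q → ℝ}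
    {d : q → ℝ}
    (h : ∀ i, ∀ η > 0, Tendsto (fun m => P.real {ω | η ≤ |f m ω i - d i|}) atTop (𝓝 0)) :
    TendstoInMeasure P f atTop fun _ => d := by
  rw [tendstoInMeasure_iff_measureReal_norm]
  intro η hη
  refine squeeze_zero (fun _ => measureReal_nonneg) (fun m => measureReal_mono ?_)
    (measureReal_exists_le_tendsto (f := fun m ω i => |f m ω i - d i|) (δ := fun _ => η)
      fun i => h i η hη)
  intro ω hω
  by_contra hn
  have hn' : ∀ i, ‖(f m ω - d) i‖ < η := fun i => not_le.mp fun hi => hn ⟨i, hi⟩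
  exact absurd hω.out (not_le.mpr ((pi_norm_lt_iff hη).mpr hn'))

/-- The average over one group, as a weighted sum over all subjects. -/
theorem sum_ite_mul_eq {n : Fin a → ℕ} (i : Fin a) (t : ℝ) (f : Subj n → ℝ) :
    ∑ s : Subj n, (if s.1 = i then t else 0) * f s = t * ∑ j, f ⟨i, j⟩ := by
  rw [Fintype.sum_sigma, Finset.sum_eq_single i]
  · simp [Finset.mul_sum]
  · intro i' _ hi'
    simp [hi']
  · simp

theorem RegularDesign.inv_size_le {n : Fin a → ℕ} {z : Fin a → ℕ → Fin c → ℝ} {K h : ℝ}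
    (hreg : RegularDesign n z K h) (i : Fin a) : (n i : ℝ)⁻¹ ≤ K * (totalSize n : ℝ)⁻¹ := by
  have h1 := hreg.size_pos i
  have h2 := hreg.total_pos
  have h3 := hreg.total_le i
  rw [← div_eq_mul_inv, le_div_iff₀ h2, inv_mul_le_iff₀ h1]
  linarith

/-- Group averages are dominated by the averages weighted by the squared row norms. -/
theorem RegularDesign.group_average_le {n : Fin a → ℕ} {z : Fin a → ℕ → Fin c → ℝ} {K h : ℝ}
    (hreg : RegularDesign n z K h) (i : Fin a) {f : Subj n → ℝ} (hf : ∀ s, 0 ≤ f s) :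
    (n i : ℝ)⁻¹ * ∑ j, f ⟨i, j⟩ ≤ K * ((totalSize n : ℝ)⁻¹ * ∑ s, rowSq n z s * f s) := by
  have h1 : ∑ j, f ⟨i, j⟩ ≤ ∑ s, rowSq n z s * f s := by
    calc ∑ j, f ⟨i, j⟩ ≤ ∑ s : Subj n, f s := by
          rw [Fintype.sum_sigma]
          exact Finset.single_le_sum (f := fun i => ∑ j, f ⟨i, j⟩)
            (fun _ _ => Finset.sum_nonneg fun _ _ => hf _) (Finset.mem_univ i)
      _ ≤ _ := Finset.sum_le_sum fun s _ => le_mul_of_one_le_left (hf s) (one_le_rowSq n z s)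
  have h0 : 0 ≤ ∑ j, f ⟨i, j⟩ := Finset.sum_nonneg fun _ _ => hf _
  have hK := hreg.K_pos
  calc _ ≤ K * (totalSize n : ℝ)⁻¹ * ∑ j, f ⟨i, j⟩ :=
        mul_le_mul_of_nonneg_right (hreg.inv_size_le i) h0
    _ ≤ K * (totalSize n : ℝ)⁻¹ * ∑ s, rowSq n z s * f s :=
        mul_le_mul_of_nonneg_left h1 (mul_nonneg hK.le (inv_nonneg.mpr hreg.total_pos.le))
    _ = _ := by ring

theorem RegularDesign.group_weight_le {n : Fin a → ℕ} {z : Fin a → ℕ → Fin c → ℝ} {K h : ℝ}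
    (hreg : RegularDesign n z K h) (i : Fin a) (s : Subj n) :
    |if s.1 = i then (n i : ℝ)⁻¹ else 0| ≤ K * (totalSize n : ℝ)⁻¹ * rowSq n z s := by
  have hK := hreg.K_pos
  have hN := hreg.total_pos
  have h1 := one_le_rowSq n z s
  split_ifs
  · rw [abs_of_nonneg (by positivity)]
    exact (hreg.inv_size_le i).trans (le_mul_of_one_le_right (by positivity) h1)
  · rw [abs_zero]
    have := rowSq_nonneg n z s
    positivity

/-- The estimated variances, on the scale of the total sample size. -/
noncomputable def scaledVar (n : Fin a → ℕ) (z : Fin a → ℕ → Fin c → ℝ)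
    (Y : Subj n × Fin p → ℝ) : Fin a × Fin p → ℝ :=
  (totalSize n : ℝ) • fun q => (n q.1 : ℝ)⁻¹ * varEstimator n z Y q.1 q.2

theorem measurable_scaledVar (n : Fin a → ℕ) (z : Fin a → ℕ → Fin c → ℝ) :
    Measurable fun Y : Subj n × Fin p → ℝ => scaledVar n z Y := by
  refine measurable_pi_lambda _ fun q => ?_
  exact (((Finset.measurable_sum _ fun j _ =>
    (measurable_residual _).pow_const 2).const_mul _).const_mul _).const_mul _

theorem measurable_stack {ι : Type*} {e : ι → Ω → Fin p → ℝ} (he : ∀ s, Measurable (e s)) :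
    Measurable (stack e) :=
  measurable_pi_lambda _ fun q => (measurable_pi_apply q.2).comp (he q.1)

/-- The assumptions on an array of errors under which the statistic has the limit law determined
by the covariance matrix `L` and the variances `σ2`: convergence of the covariances of the scaled
estimator of the means, a bound for the second moments and a Lyapunov condition for the fourth
moments, both weighted by the rows of the design, and convergence of the average variances in each
group. -/
structure ErrorLimit (P : Measure Ω) (n : ℕ → Fin a → ℕ) (z : Fin a → ℕ → Fin c → ℝ)
    (e : ∀ m, Subj (n m) → Ω → Fin p → ℝ) (L : Matrix (Fin a × Fin p) (Fin a × Fin p) ℝ)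
    (σ2 : Fin a × Fin p → ℝ) : Prop where
  array : ∀ m, IsErrorArray P (e m)
  cov : ∀ i i' k l, Tendsto (fun m => (totalSize (n m) : ℝ) *
    ∑ s, olsWeight (n m) z (Sum.inl i) s * olsWeight (n m) z (Sum.inl i') s *
      ∫ ω, e m s ω k * e m s ω l ∂P) atTop (𝓝 (L (i, k) (i', l)))
  bdd : ∃ B, ∀ᶠ m in atTop,
    (totalSize (n m) : ℝ)⁻¹ * ∑ s, rowSq (n m) z s * ∑ k, ∫ ω, e m s ω k ^ 2 ∂P ≤ B
  lyapunov : Tendsto (fun m => ∑ s, ((totalSize (n m) : ℝ)⁻¹ * rowSq (n m) z s) ^ 2 *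
    ∑ k, ∫ ω, e m s ω k ^ 4 ∂P) atTop (𝓝 0)
  var : ∀ i k, Tendsto (fun m => (n m i : ℝ)⁻¹ * ∑ j, ∫ ω, e m ⟨i, j⟩ ω k ^ 2 ∂P) atTop
    (𝓝 (σ2 (i, k)))

variable [IsProbabilityMeasure P] {n : ℕ → Fin a → ℕ} {z : Fin a → ℕ → Fin c → ℝ} {K : ℝ}
  {h : ℕ → ℝ} {e : ∀ m, Subj (n m) → Ω → Fin p → ℝ}
  {L : Matrix (Fin a × Fin p) (Fin a × Fin p) ℝ} {σ2 : Fin a × Fin p → ℝ}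

/-- On average, the products of residuals are asymptotically those of the errors. -/
theorem ErrorLimit.tendsto_integral_residualGap (he : ErrorLimit P n z e L σ2)
    (hh : Tendsto h atTop (𝓝 0)) (hreg : ∀ᶠ m in atTop, RegularDesign (n m) z K (h m)) :
    Tendsto (fun m => ∫ ω, residualGap (n m) z (stack (e m) ω) ∂P) atTop (𝓝 0) := by
  obtain ⟨B, hB⟩ := he.bdd
  have hlim : Tendsto (fun m => (p : ℝ) * (√(h m) + (√(h m) + h m) * K ^ 2 * (a + c)) * B) atTop
      (𝓝 0) := by
    have h1 : Tendsto (fun m => √(h m)) atTop (𝓝 0) := by simpa using hh.sqrt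
    simpa using ((h1.add (((h1.add hh).mul_const (K ^ 2)).mul_const ((a : ℝ) + c))).const_mul
      (p : ℝ)).mul_const B
  refine squeeze_zero' (Eventually.of_forall fun m => integral_nonneg fun ω =>
    residualGap_nonneg _) ?_ hlim
  filter_upwards [hB, hreg] with m hm hr
  refine ((he.array m).integral_residualGap_le hr).trans (mul_le_mul_of_nonneg_left hm ?_)
  have := hr.h_pos
  positivity

/-- The scaled estimator of the means is a weighted sum of the errors, and the Lyapunov condition
holds because the squared weights are bounded by the relative row norms. -/
theorem ErrorLimit.tendsto_ols (he : ErrorLimit P n z e L σ2) (hL : L.PosSemidef)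
    (hreg : ∀ᶠ m in atTop, RegularDesign (n m) z K (h m)) :
    TendstoInDistribution (fun m ω => WithLp.toLp 2 (√(totalSize (n m) : ℝ) •
      meanPart (olsEstimator (n m) z (stack (e m) ω)))) atTop id (fun _ => P)
      (multivariateGaussian 0 L) := by
  set Z : ∀ m, Subj (n m) → Ω → EuclideanSpace ℝ (Fin a × Fin p) := fun m s ω =>
    WithLp.toLp 2 fun q => √(totalSize (n m) : ℝ) * olsWeight (n m) z (Sum.inl q.1) s * e m s ω q.2
    with hZ
  have hsum : (fun m ω => WithLp.toLp 2 (√(totalSize (n m) : ℝ) •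
      meanPart (olsEstimator (n m) z (stack (e m) ω)))) = fun m ω => ∑ s, Z m s ω := by
    funext m ω
    ext q
    simp only [hZ, meanPart, Pi.smul_apply, olsEstimator_apply, stack, smul_eq_mul,
      WithLp.ofLp_sum, Finset.sum_apply, Finset.mul_sum, mul_assoc]
  have hgm : ∀ m (s : Subj (n m)), Measurable fun x : Fin p → ℝ =>
      (WithLp.toLp 2 fun q : Fin a × Fin p =>
      √(totalSize (n m) : ℝ) * olsWeight (n m) z (Sum.inl q.1) s * x q.2 :
        EuclideanSpace ℝ (Fin a × Fin p)) := fun m s => by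
    have : Continuous fun x : Fin p → ℝ => fun q : Fin a × Fin p =>
      √(totalSize (n m) : ℝ) * olsWeight (n m) z (Sum.inl q.1) s * x q.2 := by fun_prop
    exact (WithLp.measurable_toLp 2 _).comp this.measurable
  rw [hsum]
  refine tendstoInDistribution_sum_of_lyapunov ?_ ?_ ?_ ?_ hL ?_ ?_
  · exact fun m s => (hgm m s).comp ((he.array m).measurable s)
  · exact fun m => (he.array m).indep.comp _ fun s => hgm m s
  · exact fun m s q => ((he.array m).memLp s q.2).const_mul _
  · intro m s q
    simp [hZ, integral_const_mul, (he.array m).mean]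
  · rintro ⟨i, k⟩ ⟨i', l⟩
    refine (he.cov i i' k l).congr fun m => ?_
    rw [Finset.mul_sum]
    refine Finset.sum_congr rfl fun s _ => ?_
    have hs : √(totalSize (n m) : ℝ) * √(totalSize (n m) : ℝ) = totalSize (n m) :=
      Real.mul_self_sqrt (by positivity)
    rw [← integral_const_mul, ← integral_const_mul]
    refine integral_congr_ae (ae_of_all _ fun ω => ?_)
    simp only [hZ]
    linear_combination -(olsWeight (n m) z (Sum.inl i) s * olsWeight (n m) z (Sum.inl i') s *
      e m s ω k * e m s ω l) * hs
  · refine squeeze_zero' (Eventually.of_forall fun m => Finset.sum_nonneg fun s _ =>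
      Finset.sum_nonneg fun q _ => integral_nonneg fun ω => by positivity) ?_
      (by simpa using he.lyapunov.const_mul ((a : ℝ) * K ^ 2))
    filter_upwards [hreg] with m hr
    rw [Finset.mul_sum]
    refine Finset.sum_le_sum fun s _ => ?_
    have hN := hr.total_pos
    have hs : √(totalSize (n m) : ℝ) ^ 4 = (totalSize (n m) : ℝ) ^ 2 := by
      rw [show (4 : ℕ) = 2 * 2 by norm_num, pow_mul, Real.sq_sqrt hN.le]
    have hq : ∀ q : Fin a × Fin p, ∫ ω, Z m s ω q ^ 4 ∂P ≤
        K ^ 2 * ((totalSize (n m) : ℝ)⁻¹ * rowSq (n m) z s) ^ 2 * ∫ ω, e m s ω q.2 ^ 4 ∂P := by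
      intro q
      have e1 : ∀ ω, Z m s ω q ^ 4 = (totalSize (n m) : ℝ) ^ 2 *
          (olsWeight (n m) z (Sum.inl q.1) s ^ 2) ^ 2 * e m s ω q.2 ^ 4 := fun ω => by
        simp only [hZ, mul_pow, hs]; ring
      simp_rw [e1]
      rw [integral_const_mul]
      refine mul_le_mul_of_nonneg_right ?_ (integral_nonneg fun ω => by positivity)
      have h1 := pow_le_pow_left₀ (sq_nonneg _) (hr.olsWeight_sq_le (Sum.inl q.1) s) 2
      calc _ ≤ (totalSize (n m) : ℝ) ^ 2 *
            (K * rowSq (n m) z s / (totalSize (n m) : ℝ) ^ 2) ^ 2 :=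
            mul_le_mul_of_nonneg_left h1 (by positivity)
        _ = _ := by field_simp
    refine (Finset.sum_le_sum fun q _ => hq q).trans_eq ?_
    rw [Fintype.sum_prod_type]
    simp only [← Finset.mul_sum, Finset.sum_const, Finset.card_univ, Fintype.card_fin,
      nsmul_eq_mul]
    ring

/-- Consistency of the variance estimators, in mean. Residuals are replaced by errors at the cost of
`residualGap`, and the averages of squared errors have vanishing variance. -/
theorem ErrorLimit.tendsto_groupVariance (he : ErrorLimit P n z e L σ2)
    (hh : Tendsto h atTop (𝓝 0)) (hreg : ∀ᶠ m in atTop, RegularDesign (n m) z K (h m))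
    (i : Fin a) (k : Fin p) :
    Tendsto (fun m => ∫ ω, |(n m i : ℝ)⁻¹ *
      ∑ j, residual (n m) z (stack (e m) ω) (⟨i, j⟩, k) ^ 2 - σ2 (i, k)| ∂P) atTop (𝓝 0) := by
  set c₀ : ∀ m, Subj (n m) → ℝ := fun m s => ∫ ω, e m s ω k * e m s ω k ∂P with hc₀
  set b : ∀ m, Subj (n m) → ℝ := fun m s => if s.1 = i then (n m i : ℝ)⁻¹ else 0 with hb
  set X : ℕ → Ω → ℝ := fun m ω => ∑ s, b m s * (e m s ω k * e m s ω k - c₀ m s) with hX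
  have hX2 : ∀ m, MemLp (X m) 2 P := fun m => (he.array m).memLp_sum_mul_sub _ k k
  have hXlim : Tendsto (fun m => ∫ ω, |X m ω| ∂P) atTop (𝓝 0) := by
    have h1 : Tendsto (fun m => ∫ ω, X m ω ^ 2 ∂P) atTop (𝓝 0) := by
      refine squeeze_zero' (Eventually.of_forall fun m => integral_nonneg fun ω => sq_nonneg _) ?_
        (by simpa using he.lyapunov.const_mul (K ^ 2))
      filter_upwards [hreg] with m hr
      refine ((he.array m).integral_sq_sum_mul_sub_le (fun s => hr.group_weight_le i s)
        k k).trans_eq ?_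
      rw [Finset.mul_sum]
      exact Finset.sum_congr rfl fun s _ => by ring
    refine squeeze_zero (fun m => integral_nonneg fun ω => abs_nonneg _) (fun m => ?_)
      (by simpa using h1.sqrt)
    refine Real.le_sqrt_of_sq_le ?_
    simpa using sq_integral_le_integral_sq (hX2 m).abs
  have hglim := he.tendsto_integral_residualGap hh hreg
  have hvlim := ((he.var i k).sub_const (σ2 (i, k))).abs
  rw [sub_self, abs_zero] at hvlim
  refine squeeze_zero' (Eventually.of_forall fun m => integral_nonneg fun ω => abs_nonneg _) ?_
    (by simpa using ((hglim.const_mul K).add hXlim).add hvlim)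
  filter_upwards [hreg] with m hr
  have iX : Integrable (fun ω => |X m ω|) P := ((hX2 m).integrable (by norm_num)).abs
  have ig : Integrable (fun ω => K * residualGap (n m) z (stack (e m) ω)) P :=
    (he.array m).integrable_residualGap.const_mul K
  set v := (n m i : ℝ)⁻¹ * ∑ j, ∫ ω, e m ⟨i, j⟩ ω k ^ 2 ∂P with hv
  have hpt : ∀ ω, |(n m i : ℝ)⁻¹ * ∑ j, residual (n m) z (stack (e m) ω) (⟨i, j⟩, k) ^ 2
      - σ2 (i, k)| ≤ K * residualGap (n m) z (stack (e m) ω) + |X m ω| + |v - σ2 (i, k)| := by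
    intro ω
    set u := residual (n m) z (stack (e m) ω) with hu
    have e1 : X m ω = (n m i : ℝ)⁻¹ * ∑ j, e m ⟨i, j⟩ ω k ^ 2 - v := by
      rw [hX]
      simp only [hb]
      rw [sum_ite_mul_eq, hv, ← mul_sub, ← Finset.sum_sub_distrib]
      simp only [hc₀, sq]
    have e2 : (n m i : ℝ)⁻¹ * ∑ j, u (⟨i, j⟩, k) ^ 2 - σ2 (i, k)
        = (n m i : ℝ)⁻¹ * ∑ j, (u (⟨i, j⟩, k) ^ 2 - e m ⟨i, j⟩ ω k ^ 2) + X m ω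
          + (v - σ2 (i, k)) := by
      rw [e1, Finset.sum_sub_distrib]; ring
    have e3 : |(n m i : ℝ)⁻¹ * ∑ j, (u (⟨i, j⟩, k) ^ 2 - e m ⟨i, j⟩ ω k ^ 2)|
        ≤ K * residualGap (n m) z (stack (e m) ω) := by
      rw [abs_mul, abs_of_nonneg (by positivity : (0 : ℝ) ≤ (n m i : ℝ)⁻¹)]
      have h1 := hr.group_average_le i (f := fun s => ∑ k, ∑ l,
        |u (s, k) * u (s, l) - stack (e m) ω (s, k) * stack (e m) ω (s, l)|)
        (fun s => Finset.sum_nonneg fun _ _ => Finset.sum_nonneg fun _ _ => abs_nonneg _)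
      refine le_trans (mul_le_mul_of_nonneg_left ?_ (by positivity)) h1
      refine (Finset.abs_sum_le_sum_abs _ _).trans (Finset.sum_le_sum fun j _ => ?_)
      have h2 : |u (⟨i, j⟩, k) ^ 2 - e m ⟨i, j⟩ ω k ^ 2| =
          |u (⟨i, j⟩, k) * u (⟨i, j⟩, k) -
            stack (e m) ω (⟨i, j⟩, k) * stack (e m) ω (⟨i, j⟩, k)| := by
        simp only [sq, stack]
      rw [h2]
      refine le_trans ?_ (Finset.single_le_sum (f := fun k => ∑ l, |u (⟨i, j⟩, k) * u (⟨i, j⟩, l) -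
        stack (e m) ω (⟨i, j⟩, k) * stack (e m) ω (⟨i, j⟩, l)|)
        (fun _ _ => Finset.sum_nonneg fun _ _ => abs_nonneg _) (Finset.mem_univ k))
      exact Finset.single_le_sum (f := fun l => |u (⟨i, j⟩, k) * u (⟨i, j⟩, l) -
        stack (e m) ω (⟨i, j⟩, k) * stack (e m) ω (⟨i, j⟩, l)|)
        (fun _ _ => abs_nonneg _) (Finset.mem_univ k)
    rw [e2]
    exact (abs_add_le _ _).trans (add_le_add_left ((abs_add_le _ _).trans
      (add_le_add_left e3 _)) _)
  have i12 : Integrable (fun ω => K * residualGap (n m) z (stack (e m) ω) + |X m ω|) P := ig.add iX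
  refine (integral_mono_of_nonneg (ae_of_all _ fun ω => abs_nonneg _)
    (i12.add (integrable_const |v - σ2 (i, k)|)) (ae_of_all _ hpt)).trans_eq ?_
  change ∫ ω, (K * residualGap (n m) z (stack (e m) ω) + |X m ω| + |v - σ2 (i, k)|) ∂P = _
  rw [integral_add i12 (integrable_const _), integral_add ig iX, integral_const_mul,
    integral_const]
  simp

theorem tendsto_total_mul_inv_size {κ : ℝ} (hκ : 0 < κ) {i : Fin a}
    (hN : Tendsto (fun m => totalSize (n m)) atTop atTop)
    (hratio : Tendsto (fun m => (totalSize (n m) : ℝ) / (n m i : ℝ)) atTop (𝓝 κ)) (t : ℝ) :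
    Tendsto (fun m => (totalSize (n m) : ℝ) * ((n m i : ℝ) - t)⁻¹) atTop (𝓝 κ) := by
  have hNr : Tendsto (fun m => (totalSize (n m) : ℝ)) atTop atTop :=
    tendsto_natCast_atTop_atTop.comp hN
  have h1 := (hratio.inv₀ hκ.ne').sub (hNr.inv_tendsto_atTop.const_mul t)
  rw [mul_zero, sub_zero] at h1
  have h2 := h1.inv₀ (inv_ne_zero hκ.ne')
  rw [inv_inv] at h2
  refine h2.congr' ?_
  filter_upwards [hNr.eventually_gt_atTop 0] with m hm
  have : ((totalSize (n m) : ℝ) / (n m i : ℝ))⁻¹ - t * (totalSize (n m) : ℝ)⁻¹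
      = ((n m i : ℝ) - t) * (totalSize (n m) : ℝ)⁻¹ := by rw [inv_div]; ring
  simp only [Pi.inv_apply]
  rw [this, mul_inv, inv_inv, mul_comm]

/-- Consistency of the variance estimators on the scale of the total sample size; the correction for
the number of covariates is negligible. -/
theorem ErrorLimit.tendsto_scaledVar (he : ErrorLimit P n z e L σ2)
    (hh : Tendsto h atTop (𝓝 0)) (hreg : ∀ᶠ m in atTop, RegularDesign (n m) z K (h m))
    (hN : Tendsto (fun m => totalSize (n m)) atTop atTop)
    {κ : Fin a → ℝ} (hκ : ∀ i, 0 < κ i)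
    (hratio : ∀ i, Tendsto (fun m => (totalSize (n m) : ℝ) / (n m i : ℝ)) atTop (𝓝 (κ i)))
    (q : Fin a × Fin p) {η : ℝ} (hη : 0 < η) :
    Tendsto (fun m => P.real {ω | η ≤ |scaledVar (n m) z (stack (e m) ω) q - κ q.1 * σ2 q|}) atTop
      (𝓝 0) := by
  obtain ⟨i, k⟩ := q
  set t : ℕ → ℝ := fun m => (totalSize (n m) : ℝ) * ((n m i : ℝ) - (c + 1))⁻¹ with ht
  have htlim : Tendsto t atTop (𝓝 (κ i)) := tendsto_total_mul_inv_size (hκ i) hN (hratio i) _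
  set A : ℕ → Ω → ℝ := fun m ω => (n m i : ℝ)⁻¹ *
    ∑ j, residual (n m) z (stack (e m) ω) (⟨i, j⟩, k) ^ 2 with hA
  have hAlim := he.tendsto_groupVariance hh hreg i k
  have hsv : ∀ m ω, scaledVar (n m) z (stack (e m) ω) (i, k) = t m * A m ω := by
    intro m ω
    simp only [scaledVar, Pi.smul_apply, smul_eq_mul, varEstimator, ht, hA, sub_sub]
    ring
  have iA : ∀ m, Integrable (A m) P := fun m =>
    (integrable_finsetSum _ fun j _ => integrable_pow_of_memLp_four
      ((he.array m).memLp_residual _ _) (by norm_num)).const_mul _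
  refine tendsto_measureReal_ge_of_integral (fun m ω => abs_nonneg _) (fun m => ?_) ?_ hη
  · simp_rw [hsv]
    exact (((iA m).const_mul _).sub (integrable_const _)).abs
  · have hlim := (htlim.abs.mul hAlim).add
      (((htlim.sub_const (κ i)).abs).mul_const |σ2 (i, k)|)
    rw [mul_zero, sub_self, abs_zero, zero_mul, add_zero] at hlim
    refine squeeze_zero (fun m => integral_nonneg fun ω => abs_nonneg _) (fun m => ?_) hlim
    have i1 : Integrable (fun ω => |t m| * |A m ω - σ2 (i, k)|) P :=
      (((iA m).sub (integrable_const _)).abs).const_mul _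
    refine (integral_mono_of_nonneg (ae_of_all _ fun ω => abs_nonneg _)
      (i1.add (integrable_const (|t m - κ i| * |σ2 (i, k)|))) (ae_of_all _ fun ω => ?_)).trans_eq ?_
    · simp only [Pi.add_apply]
      rw [hsv, ← abs_mul, ← abs_mul]
      refine le_trans (le_of_eq ?_) (abs_add_le _ _)
      congr 1; ring
    · simp only [Pi.add_apply]
      rw [integral_add i1 (integrable_const _), integral_const_mul, integral_const]
      simp [hA]

/-- **Limit law of the statistic.** The scaled estimator of the means is asymptotically normal, the
scaled variance estimators are consistent, and the statistic is a function of both which is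
continuous where all variances are positive. -/
theorem ErrorLimit.tendsto_mancats (he : ErrorLimit P n z e L σ2) (hL : L.PosSemidef)
    (hσ : ∀ q, 0 < σ2 q)
    (hh : Tendsto h atTop (𝓝 0)) (hreg : ∀ᶠ m in atTop, RegularDesign (n m) z K (h m))
    (hN : Tendsto (fun m => totalSize (n m)) atTop atTop)
    {κ : Fin a → ℝ} (hκ : ∀ i, 0 < κ i)
    (hratio : ∀ i, Tendsto (fun m => (totalSize (n m) : ℝ) / (n m i : ℝ)) atTop (𝓝 (κ i)))
    {T : Matrix (Fin a × Fin p) (Fin a × Fin p) ℝ} (hT : Tᵀ = T) (hTT : T * T = T) :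
    TendstoInDistribution (fun m ω => mancats (n m) z T (stack (e m) ω)) atTop
      (fun g : EuclideanSpace ℝ (Fin a × Fin p) => waldForm T g.ofLp fun q => κ q.1 * σ2 q)
      (fun _ => P) (multivariateGaussian 0 L) := by
  set d₀ : Fin a × Fin p → ℝ := fun q => κ q.1 * σ2 q with hd₀
  have hd₀pos : ∀ q, 0 < d₀ q := fun q => mul_pos (hκ q.1) (hσ q)
  set V : ℕ → Ω → EuclideanSpace ℝ (Fin a × Fin p) := fun m ω =>
    WithLp.toLp 2 (√(totalSize (n m) : ℝ) •
      meanPart (olsEstimator (n m) z (stack (e m) ω))) with hV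
  set D : ℕ → Ω → Fin a × Fin p → ℝ := fun m ω => scaledVar (n m) z (stack (e m) ω) with hD
  have hVlim : TendstoInDistribution V atTop id (fun _ => P) (multivariateGaussian 0 L) :=
    he.tendsto_ols hL hreg
  have hDq := fun q (η : ℝ) (hη : 0 < η) =>
    he.tendsto_scaledVar hh hreg hN hκ hratio q hη
  have hDlim : TendstoInMeasure P D atTop fun _ => d₀ :=
    tendstoInMeasure_pi_const fun q η hη => hDq q η hη
  have hDmeas : ∀ m, Measurable (D m) := fun m =>
    (measurable_scaledVar (n m) z).comp (measurable_stack (he.array m).measurable)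
  -- truncating the variances from below makes the quadratic form continuous everywhere
  set cut : (Fin a × Fin p → ℝ) → Fin a × Fin p → ℝ := fun d q => max (d q) (d₀ q / 2) with hcut
  have hcutpos : ∀ d q, 0 < cut d q := fun d q =>
    lt_max_of_lt_right (half_pos (hd₀pos q))
  have hwald : ∀ v d, (∀ q, 0 < d q) → waldForm T v d
      = v ⬝ᵥ ((Tᵀ * ((diagCompletion T d)⁻¹ * T) * T) *ᵥ v) := fun v d hd => by
    rw [waldForm, pinv_mul_diagonal_mul hT hTT hd]
  set g : EuclideanSpace ℝ (Fin a × Fin p) × (Fin a × Fin p → ℝ) → ℝ := fun x =>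
    waldForm T x.1.ofLp (cut x.2) with hg
  have hgcont : Continuous g := by
    have hcutc : Continuous cut := by
      refine continuous_pi fun q => ?_
      exact (continuous_apply q).max continuous_const
    have hinv : Continuous fun d => (diagCompletion T (cut d))⁻¹ := by
      rw [continuous_iff_continuousAt]
      intro d
      exact ContinuousAt.comp (f := cut)
        (continuousAt_diagCompletion_inv hT hTT (hcutpos d)) hcutc.continuousAt
    have hinv2 : Continuous fun x : EuclideanSpace ℝ (Fin a × Fin p) × (Fin a × Fin p → ℝ) =>
      (diagCompletion T (cut x.2))⁻¹ := hinv.comp continuous_snd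
    have hofLp : Continuous fun x : EuclideanSpace ℝ (Fin a × Fin p) × (Fin a × Fin p → ℝ) =>
      x.1.ofLp := (PiLp.continuous_ofLp 2 _).comp continuous_fst
    have : g = fun x => x.1.ofLp ⬝ᵥ
        ((Tᵀ * ((diagCompletion T (cut x.2))⁻¹ * T) * T) *ᵥ x.1.ofLp) :=
      funext fun x => hwald _ _ (hcutpos _)
    rw [this]
    fun_prop
  have hcut₀ : cut d₀ = d₀ := funext fun q => max_eq_left (half_le_self (hd₀pos q).le)
  have hslutsky := hVlim.continuous_comp_prodMk_of_tendstoInMeasure_const hgcont hDlim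
    fun m => (hDmeas m).aemeasurable
  have hZ : (fun ω : EuclideanSpace ℝ (Fin a × Fin p) => g (id ω, d₀))
      = fun v => waldForm T v.ofLp d₀ := by
    funext v; simp only [hg, id, hcut₀]
  rw [hZ] at hslutsky
  have hmm : ∀ m, Measurable fun ω => mancats (n m) z T (stack (e m) ω) := fun m =>
    (measurable_mancats T).comp (measurable_stack (he.array m).measurable)
  refine tendstoInDistribution_of_tendstoInMeasure_sub _ _ hslutsky ?_
    fun m => (hmm m).aemeasurable
  rw [tendstoInMeasure_iff_measureReal_norm]
  intro η hη
  refine squeeze_zero' (Eventually.of_forall fun _ => measureReal_nonneg) ?_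
    (measureReal_exists_le_tendsto (f := fun m ω q => |D m ω q - d₀ q|) (δ := fun q => d₀ q / 2)
      fun q => hDq q _ (half_pos (hd₀pos q)))
  filter_upwards [hreg] with m hr
  refine measureReal_mono fun ω hω => ?_
  by_contra hn
  have hn' : ∀ q, |D m ω q - d₀ q| < d₀ q / 2 := fun q => not_le.mp fun hq => hn ⟨q, hq⟩
  have hcutD : cut (D m ω) = D m ω := funext fun q => max_eq_left (by
    have := (abs_lt.mp (hn' q)).1
    linarith)
  have heq : mancats (n m) z T (stack (e m) ω) = g (V m ω, D m ω) := by
    rw [mancats_eq_waldForm T _ hr.total_pos]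
    simp only [hg, hcutD]
    rfl
  have h0 := hω.out
  simp only [Pi.sub_apply, Pi.zero_apply, heq, sub_self, norm_zero] at h0
  exact absurd h0 (not_le.mpr hη)

/-- The limit law of the statistic has no atoms if it is not degenerate. -/
theorem waldForm_gaussian_eq_zero {T : Matrix (Fin a × Fin p) (Fin a × Fin p) ℝ} (hT : Tᵀ = T)
    (hTT : T * T = T) (hL : L.PosSemidef) (hTL : T * L * T ≠ 0) {d : Fin a × Fin p → ℝ}
    (hd : ∀ q, 0 < d q) (x : ℝ) :
    (multivariateGaussian 0 L).map (fun g => waldForm T g.ofLp d) {x} = 0 := by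
  have hM := posDef_diagCompletion hT hTT hd
  set M := diagCompletion T d with hMdef
  have hw : ∀ v, waldForm T v d = v ⬝ᵥ (T * M⁻¹ * T) *ᵥ v := fun v => by
    have : T * (M⁻¹ * T) * T = T * M⁻¹ * T := by simp only [Matrix.mul_assoc, hTT]
    rw [waldForm, pinv_mul_diagonal_mul hT hTT hd, hT, ← hMdef, this]
  have hmeas : Measurable fun g : EuclideanSpace ℝ (Fin a × Fin p) => waldForm T g.ofLp d := by
    simp_rw [hw]; fun_prop
  have hTc : Tᴴ = T := by rw [Matrix.conjTranspose_eq_transpose_of_trivial, hT]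
  have hB : (T * M⁻¹ * T).PosSemidef := by
    have := hM.inv.posSemidef.mul_mul_conjTranspose_same T
    rwa [hTc] at this
  rw [Measure.map_apply hmeas (measurableSet_singleton x)]
  have hne : L * (T * M⁻¹ * T) * L ≠ 0 := by
    intro h0
    have hLt : Lᵀ = L := by
      have := hL.isHermitian.eq
      rwa [Matrix.conjTranspose_eq_transpose_of_trivial] at this
    have hTL0 : T * L = 0 := by
      refine Matrix.ext_of_mulVec_single fun i => ?_
      set y : Fin a × Fin p → ℝ := Pi.single i 1
      by_contra hy
      have hy' : (T * L) *ᵥ y ≠ 0 := by simpa using hy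
      have hpos := hM.inv.dotProduct_mulVec_pos hy'
      have : star ((T * L) *ᵥ y) ⬝ᵥ M⁻¹ *ᵥ ((T * L) *ᵥ y)
          = y ⬝ᵥ (L * (T * M⁻¹ * T) * L) *ᵥ y := by
        have e1 : L * (T * M⁻¹ * T) * L = (T * L)ᵀ * M⁻¹ * (T * L) := by
          rw [Matrix.transpose_mul, hT, hLt]; simp only [Matrix.mul_assoc]
        rw [e1, dotProduct_transpose_mul_mul_mulVec, star_trivial]
      rw [this, h0] at hpos
      simp at hpos
    exact hTL (by rw [hTL0, Matrix.zero_mul])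
  have := multivariateGaussian_quadForm_eq_zero hL hB hne x
  simp_rw [hw]
  exact this

end LimitLaw

/-! ### The limiting covariance matrix and the errors of the model -/

section ModelErrors

variable {a c p : ℕ}

theorem posSemidef_of_tendsto {q : Type*} [Fintype q] {M : ℕ → Matrix q q ℝ} {L : Matrix q q ℝ}
    (hM : ∀ᶠ m in atTop, (M m).PosSemidef) (h : Tendsto M atTop (𝓝 L)) : L.PosSemidef := by
  refine .of_dotProduct_mulVec_nonneg ?_ fun x => ?_
  · have hc : Continuous fun A : Matrix q q ℝ => Aᴴ := by fun_prop
    refine tendsto_nhds_unique ((hc.tendsto L).comp h) (h.congr' ?_)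
    filter_upwards [hM] with m hm
    exact hm.isHermitian.eq.symm
  · have hc : Continuous fun A : Matrix q q ℝ => star x ⬝ᵥ A *ᵥ x := by fun_prop
    refine ge_of_tendsto ((hc.tendsto L).comp h) ?_
    filter_upwards [hM] with m hm
    exact hm.dotProduct_mulVec_nonneg x

theorem posSemidef_scaledMeanCov {n : Fin a → ℕ} {z : Fin a → ℕ → Fin c → ℝ} {K h : ℝ}
    (hreg : RegularDesign n z K h) {Sig : Fin a → Matrix (Fin p) (Fin p) ℝ}
    (hSig : ∀ i, (Sig i).PosSemidef) : (scaledMeanCov n z Sig).PosSemidef := by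
  set B : Subj n → Matrix (Fin a × Fin p) (Fin p) ℝ := fun s =>
    Matrix.of fun q k => if q.2 = k then olsWeight n z (Sum.inl q.1) s else 0 with hB
  have e : scaledMeanCov n z Sig = (totalSize n : ℝ) • ∑ s, B s * Sig s.1 * (B s)ᴴ := by
    ext ⟨i, k⟩ ⟨i', l⟩
    rw [scaledMeanCov_apply hreg.total_pos.ne' hreg.det_isUnit, Matrix.smul_apply,
      Matrix.sum_apply, smul_eq_mul]
    congr 1
    refine Finset.sum_congr rfl fun s _ => ?_
    simp [hB, Matrix.mul_apply]
    ring
  rw [e]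
  exact (Matrix.posSemidef_sum _ fun s _ => (hSig s.1).mul_mul_conjTranspose_same (B s)).smul
    hreg.total_pos.le

/-- The maximal row bounds the sum of the squared relative row norms. -/
theorem RegularDesign.sum_sq_le {n : Fin a → ℕ} {z : Fin a → ℕ → Fin c → ℝ} {K h : ℝ}
    (hreg : RegularDesign n z K h) :
    ∑ s, ((totalSize n : ℝ)⁻¹ * rowSq n z s) ^ 2 ≤ h * K := by
  have hN := hreg.total_pos
  have h0 := hreg.h_pos
  have h1 : ∀ s, ((totalSize n : ℝ)⁻¹ * rowSq n z s) ^ 2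
      ≤ h * ((totalSize n : ℝ)⁻¹ * rowSq n z s) := fun s => by
    rw [sq]
    refine mul_le_mul_of_nonneg_right ?_ (mul_nonneg (by positivity) (rowSq_nonneg n z s))
    rw [inv_mul_le_iff₀ hN, mul_comm]
    exact hreg.rowSq_le s
  refine (Finset.sum_le_sum fun s _ => h1 s).trans ?_
  rw [← Finset.mul_sum, ← Finset.mul_sum]
  refine mul_le_mul_of_nonneg_left ?_ h0.le
  rw [inv_mul_le_iff₀ hN, mul_comm]
  exact hreg.sum_rowSq_le

variable {Ω : Type*} [MeasurableSpace Ω] {P : Measure Ω}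

theorem injective_subj (n : Fin a → ℕ) :
    Function.Injective fun s : Subj n => ((s.1, (s.2 : ℕ)) : Fin a × ℕ) := by
  rintro ⟨i, j⟩ ⟨i', j'⟩ h
  obtain ⟨rfl, hj⟩ := Prod.mk.inj h
  exact congrArg (Sigma.mk i) (Fin.ext hj)

theorem isErrorArray_of_iIndepFun {ε : Fin a → ℕ → Ω → Fin p → ℝ}
    (hεmeas : ∀ i j, Measurable (ε i j)) (hεindep : iIndepFun (fun ij : Fin a × ℕ => ε ij.1 ij.2) P)
    (hεmean : ∀ i j k, ∫ ω, ε i j ω k ∂P = 0) (hεmem : ∀ i j k, MemLp (fun ω => ε i j ω k) 4 P)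
    (n : Fin a → ℕ) : IsErrorArray P fun s : Subj n => ε s.1 s.2 where
  measurable _ := hεmeas _ _
  indep := hεindep.precomp (injective_subj n)
  memLp _ k := hεmem _ _ k
  mean _ k := hεmean _ _ k

/-- Errors whose covariance matrices depend only on the group and whose fourth moments are bounded
satisfy the assumptions of the limit theorem. -/
theorem errorLimit_of_groupCov {n : ℕ → Fin a → ℕ} {z : Fin a → ℕ → Fin c → ℝ} {K : ℝ} {h : ℕ → ℝ}
    {e : ∀ m, Subj (n m) → Ω → Fin p → ℝ} (hh : Tendsto h atTop (𝓝 0))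
    (hreg : ∀ᶠ m in atTop, RegularDesign (n m) z K (h m)) (he : ∀ m, IsErrorArray P (e m))
    {Sig : Fin a → Matrix (Fin p) (Fin p) ℝ}
    (hcov : ∀ m s k l, ∫ ω, e m s ω k * e m s ω l ∂P = Sig s.1 k l) {C₁ : ℝ}
    (h4 : ∀ m s k, ∫ ω, e m s ω k ^ 4 ∂P ≤ C₁) {L : Matrix (Fin a × Fin p) (Fin a × Fin p) ℝ}
    (hL : Tendsto (fun m => scaledMeanCov (n m) z Sig) atTop (𝓝 L)) :
    ErrorLimit P n z e L fun q => Sig q.1 q.2 q.2 := by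
  have hvar : ∀ m s k, ∫ ω, e m s ω k ^ 2 ∂P = Sig s.1 k k := fun m s k => by
    rw [← hcov m s k k]; simp only [sq]
  refine ⟨he, fun i i' k l => ?_, ⟨K * ∑ i, ∑ k, |Sig i k k|, ?_⟩, ?_, fun i k => ?_⟩
  · have h1 : Tendsto (fun m => scaledMeanCov (n m) z Sig (i, k) (i', l)) atTop
        (𝓝 (L (i, k) (i', l))) := tendsto_pi_nhds.mp (tendsto_pi_nhds.mp hL (i, k)) (i', l)
    refine h1.congr' ?_
    filter_upwards [hreg] with m hr
    simp only [hcov]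
    exact scaledMeanCov_apply hr.total_pos.ne' hr.det_isUnit Sig i i' k l
  · filter_upwards [hreg] with m hr
    have hN := hr.total_pos
    rw [inv_mul_le_iff₀ hN]
    simp only [hvar]
    have h1 : ∀ s : Subj (n m), ∑ k, Sig s.1 k k ≤ ∑ i, ∑ k, |Sig i k k| := fun s =>
      (Finset.sum_le_sum fun k _ => le_abs_self (Sig s.1 k k)).trans
        (Finset.single_le_sum (f := fun i => ∑ k, |Sig i k k|)
          (fun _ _ => Finset.sum_nonneg fun _ _ => abs_nonneg _) (Finset.mem_univ s.1))
    have h0 : 0 ≤ ∑ i, ∑ k, |Sig i k k| :=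
      Finset.sum_nonneg fun _ _ => Finset.sum_nonneg fun _ _ => abs_nonneg _
    calc _ ≤ ∑ s, rowSq (n m) z s * ∑ i, ∑ k, |Sig i k k| :=
          Finset.sum_le_sum fun s _ => mul_le_mul_of_nonneg_left (h1 s) (rowSq_nonneg _ _ s)
      _ ≤ K * totalSize (n m) * ∑ i, ∑ k, |Sig i k k| := by
          rw [← Finset.sum_mul]
          exact mul_le_mul_of_nonneg_right hr.sum_rowSq_le h0
      _ = _ := by ring
  · refine squeeze_zero' (Eventually.of_forall fun m => Finset.sum_nonneg fun s _ =>
      mul_nonneg (sq_nonneg _) (Finset.sum_nonneg fun k _ => integral_nonneg fun ω => by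
        positivity)) ?_ (by simpa using (hh.mul_const K).mul_const (p * |C₁|))
    filter_upwards [hreg] with m hr
    calc _ ≤ ∑ s, ((totalSize (n m) : ℝ)⁻¹ * rowSq (n m) z s) ^ 2 * (p * |C₁|) := by
          refine Finset.sum_le_sum fun s _ => mul_le_mul_of_nonneg_left ?_ (sq_nonneg _)
          refine (Finset.sum_le_sum fun k _ => (h4 m s k).trans (le_abs_self C₁)).trans_eq ?_
          simp
      _ ≤ _ := by
          rw [← Finset.sum_mul]
          exact mul_le_mul_of_nonneg_right hr.sum_sq_le (by positivity)
  · refine tendsto_const_nhds.congr' ?_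
    filter_upwards [hreg] with m hr
    have := hr.size_pos i
    simp only [hvar, Finset.sum_const, Finset.card_univ, Fintype.card_fin, nsmul_eq_mul]
    field_simp

end ModelErrors

/-! ### The wild bootstrap given the data -/

section WildBootstrap

variable {a c p : ℕ}

theorem RegularDesign.abs_leverage_le {n : Fin a → ℕ} {z : Fin a → ℕ → Fin c → ℝ} {K h : ℝ}
    (hreg : RegularDesign n z K h) (s : Subj n) : |leverage n z s| ≤ h * √((a + c) * K) := by
  have hN := hreg.total_pos
  have hK := hreg.K_pos
  have h0 := hreg.h_pos
  have h1 : leverage n z s ^ 2 ≤ h ^ 2 * ((a + c) * K) := by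
    rw [leverage_eq]
    refine (Finset.sum_mul_sq_le_sq_mul_sq _ _ _).trans ?_
    have h2 : ∑ r, olsWeight n z r s ^ 2 ≤ (a + c) * (K * rowSq n z s / (totalSize n : ℝ) ^ 2) := by
      refine (Finset.sum_le_sum fun r _ => hreg.olsWeight_sq_le r s).trans_eq ?_
      simp
    have hr0 := rowSq_nonneg n z s
    have hr : rowSq n z s / totalSize n ≤ h := by
      rw [div_le_iff₀ hN]; exact hreg.rowSq_le s
    calc _ ≤ rowSq n z s * ((a + c) * (K * rowSq n z s / (totalSize n : ℝ) ^ 2)) :=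
          mul_le_mul_of_nonneg_left h2 hr0
      _ = (rowSq n z s / totalSize n) ^ 2 * ((a + c) * K) := by field_simp
      _ ≤ _ := by gcongr
  have h3 := Real.abs_le_sqrt h1
  rwa [Real.sqrt_mul (sq_nonneg _), Real.sqrt_sq h0.le] at h3

/-- The factor by which the bootstrap inflates products of residuals, equal to `(1 - p_{ij,ij})⁻¹`
if the leverage `p_{ij,ij}` is less than `1`. -/
noncomputable def wildScale (n : Fin a → ℕ) (z : Fin a → ℕ → Fin c → ℝ) (s : Subj n) : ℝ :=
  (√(1 - leverage n z s))⁻¹ ^ 2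

theorem wildScale_nonneg (n : Fin a → ℕ) (z : Fin a → ℕ → Fin c → ℝ) (s : Subj n) :
    0 ≤ wildScale n z s := sq_nonneg _

theorem abs_wildScale_sub_one_le {n : Fin a → ℕ} {z : Fin a → ℕ → Fin c → ℝ} {s : Subj n}
    (hs : |leverage n z s| ≤ 1 / 2) : |wildScale n z s - 1| ≤ 2 * |leverage n z s| := by
  have h1 := (abs_le.mp hs).2
  have h2 : (0 : ℝ) < 1 - leverage n z s := by linarith
  have e : wildScale n z s - 1 = (1 - leverage n z s)⁻¹ * leverage n z s := by
    rw [wildScale, inv_pow, Real.sq_sqrt h2.le]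
    field_simp
    ring
  rw [e, abs_mul, abs_of_pos (inv_pos.mpr h2)]
  refine mul_le_mul_of_nonneg_right ?_ (abs_nonneg _)
  rw [inv_le_comm₀ h2 (by norm_num)]
  linarith

/-- The weights of products of errors in the second-moment quantities that determine the limit
law: covariances of the estimated means, group averages, and averages weighted by the rows of the
design. -/
noncomputable def momentWeight (n : Fin a → ℕ) (z : Fin a → ℕ → Fin c → ℝ) :
    (Fin a × Fin a) ⊕ Fin a ⊕ Unit → Subj n → ℝ
  | .inl (i, i'), s =>
    (totalSize n : ℝ) * (olsWeight n z (Sum.inl i) s * olsWeight n z (Sum.inl i') s)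
  | .inr (.inl i), s => if s.1 = i then (n i : ℝ)⁻¹ else 0
  | .inr (.inr _), s => (totalSize n : ℝ)⁻¹ * rowSq n z s

theorem RegularDesign.abs_momentWeight_le {n : Fin a → ℕ} {z : Fin a → ℕ → Fin c → ℝ} {K h : ℝ}
    (hreg : RegularDesign n z K h) (t : (Fin a × Fin a) ⊕ Fin a ⊕ Unit) (s : Subj n) :
    |momentWeight n z t s| ≤ (K + 1) * ((totalSize n : ℝ)⁻¹ * rowSq n z s) := by
  have hN := hreg.total_pos
  have hK := hreg.K_pos
  have hr := rowSq_nonneg n z s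
  have hK1 : K * ((totalSize n : ℝ)⁻¹ * rowSq n z s)
      ≤ (K + 1) * ((totalSize n : ℝ)⁻¹ * rowSq n z s) := by gcongr; linarith
  rcases t with ⟨i, i'⟩ | i | u
  · refine le_trans ?_ hK1
    simp only [momentWeight]
    rw [abs_mul, abs_of_pos hN]
    have h1 := hreg.olsWeight_sq_le (Sum.inl i) s
    have h2 := hreg.olsWeight_sq_le (Sum.inl i') s
    have h3 : |olsWeight n z (Sum.inl i) s * olsWeight n z (Sum.inl i') s|
        ≤ K * rowSq n z s / (totalSize n : ℝ) ^ 2 := by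
      rw [abs_le]
      constructor <;> nlinarith [sq_nonneg (olsWeight n z (Sum.inl i) s
        - olsWeight n z (Sum.inl i') s), sq_nonneg (olsWeight n z (Sum.inl i) s
        + olsWeight n z (Sum.inl i') s)]
    calc _ ≤ totalSize n * (K * rowSq n z s / (totalSize n : ℝ) ^ 2) :=
          mul_le_mul_of_nonneg_left h3 hN.le
      _ = _ := by field_simp
  · refine le_trans (hreg.group_weight_le i s) (le_trans (le_of_eq ?_) hK1)
    ring
  · simp only [momentWeight]
    rw [abs_of_nonneg (by positivity)]
    exact le_mul_of_one_le_left (by positivity) (by linarith)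

/-- The weighted average `N⁻¹ ∑_s |x_s|² ∑_{k,l} |u_{sk} u_{sl} / (1 - p_{ss}) - y_{sk} y_{sl}|` of
the distance between the second moments of the bootstrap errors and the products of the
observations. -/
noncomputable def bootGap (n : Fin a → ℕ) (z : Fin a → ℕ → Fin c → ℝ)
    (y : Subj n × Fin p → ℝ) : ℝ :=
  (totalSize n : ℝ)⁻¹ * ∑ s, rowSq n z s * ∑ k, ∑ l,
    |residual n z y (s, k) * residual n z y (s, l) * wildScale n z s - y (s, k) * y (s, l)|

/-- The weighted sum of the centred products of observations. -/
noncomputable def centredSum (n : Fin a → ℕ) (z : Fin a → ℕ → Fin c → ℝ)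
    (C : Subj n → Fin p → Fin p → ℝ) (t : (Fin a × Fin a) ⊕ Fin a ⊕ Unit) (k l : Fin p)
    (y : Subj n × Fin p → ℝ) : ℝ :=
  ∑ s, momentWeight n z t s * (y (s, k) * y (s, l) - C s k l)

/-- The total discrepancy between the moments of the bootstrap errors for the data `y` and those of
the true errors, whose second moments are `C`. The wild bootstrap works for those data for which it
is small. -/
noncomputable def wildGap (n : Fin a → ℕ) (z : Fin a → ℕ → Fin c → ℝ)
    (C : Subj n → Fin p → Fin p → ℝ) (y : Subj n × Fin p → ℝ) : ℝ :=
  bootGap n z y + ∑ s, ((totalSize n : ℝ)⁻¹ * rowSq n z s) ^ 2 * ∑ k, y (s, k) ^ 4 +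
    ∑ t, ∑ k, ∑ l, centredSum n z C t k l y ^ 2

section Bounds

variable {n : Fin a → ℕ} {z : Fin a → ℕ → Fin c → ℝ} {C : Subj n → Fin p → Fin p → ℝ}
  {y : Subj n × Fin p → ℝ}

theorem bootGap_nonneg (y : Subj n × Fin p → ℝ) : 0 ≤ bootGap n z y :=
  mul_nonneg (by positivity) (Finset.sum_nonneg fun s _ => mul_nonneg (rowSq_nonneg n z s)
    (Finset.sum_nonneg fun _ _ => Finset.sum_nonneg fun _ _ => abs_nonneg _))

theorem lyapunovSum_nonneg (y : Subj n × Fin p → ℝ) :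
    0 ≤ ∑ s, ((totalSize n : ℝ)⁻¹ * rowSq n z s) ^ 2 * ∑ k, y (s, k) ^ 4 :=
  Finset.sum_nonneg fun s _ => mul_nonneg (sq_nonneg _) (Finset.sum_nonneg fun k _ => by positivity)

theorem sum_centredSum_sq_nonneg (y : Subj n × Fin p → ℝ) :
    0 ≤ ∑ t, ∑ k, ∑ l, centredSum n z C t k l y ^ 2 :=
  Finset.sum_nonneg fun _ _ => Finset.sum_nonneg fun _ _ => Finset.sum_nonneg fun _ _ => sq_nonneg _

theorem bootGap_le_wildGap : bootGap n z y ≤ wildGap n z C y := by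
  have := lyapunovSum_nonneg (z := z) y
  have := sum_centredSum_sq_nonneg (z := z) (C := C) y
  unfold wildGap; linarith

theorem lyapunovSum_le_wildGap :
    ∑ s, ((totalSize n : ℝ)⁻¹ * rowSq n z s) ^ 2 * ∑ k, y (s, k) ^ 4 ≤ wildGap n z C y := by
  have := bootGap_nonneg (z := z) y
  have := sum_centredSum_sq_nonneg (z := z) (C := C) y
  unfold wildGap; linarith

theorem wildGap_nonneg : 0 ≤ wildGap n z C y := (bootGap_nonneg y).trans bootGap_le_wildGap

theorem abs_centredSum_le (t : (Fin a × Fin a) ⊕ Fin a ⊕ Unit) (k l : Fin p) :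
    |centredSum n z C t k l y| ≤ √(wildGap n z C y) := by
  refine Real.abs_le_sqrt ?_
  have h1 : centredSum n z C t k l y ^ 2 ≤ ∑ t, ∑ k, ∑ l, centredSum n z C t k l y ^ 2 := by
    refine le_trans ?_ (Finset.single_le_sum (f := fun t => ∑ k, ∑ l, centredSum n z C t k l y ^ 2)
      (fun _ _ => Finset.sum_nonneg fun _ _ => Finset.sum_nonneg fun _ _ => sq_nonneg _)
      (Finset.mem_univ t))
    refine le_trans ?_ (Finset.single_le_sum (f := fun k => ∑ l, centredSum n z C t k l y ^ 2)
      (fun _ _ => Finset.sum_nonneg fun _ _ => sq_nonneg _) (Finset.mem_univ k))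
    exact Finset.single_le_sum (f := fun l => centredSum n z C t k l y ^ 2)
      (fun _ _ => sq_nonneg _) (Finset.mem_univ l)
  have := bootGap_nonneg (z := z) y
  have := lyapunovSum_nonneg (z := z) y
  unfold wildGap; linarith

/-- The weighted sums of the second moments of the bootstrap errors differ from those of the true
errors by at most a multiple of the discrepancy. -/
theorem abs_sum_momentWeight_sub_le {K h : ℝ} (hreg : RegularDesign n z K h)
    (t : (Fin a × Fin a) ⊕ Fin a ⊕ Unit) (k l : Fin p) :
    |∑ s, momentWeight n z t s *
        (residual n z y (s, k) * residual n z y (s, l) * wildScale n z s) -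
      ∑ s, momentWeight n z t s * C s k l| ≤
      (K + 1) * wildGap n z C y + √(wildGap n z C y) := by
  have hK := hreg.K_pos
  set v : Subj n → Fin p → Fin p → ℝ := fun s k l =>
    residual n z y (s, k) * residual n z y (s, l) * wildScale n z s with hv
  have e : ∑ s, momentWeight n z t s * v s k l - ∑ s, momentWeight n z t s * C s k l
      = ∑ s, momentWeight n z t s * (v s k l - y (s, k) * y (s, l)) + centredSum n z C t k l y := by
    rw [centredSum, ← Finset.sum_add_distrib, ← Finset.sum_sub_distrib]
    exact Finset.sum_congr rfl fun s _ => by ring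
  rw [e]
  refine (abs_add_le _ _).trans (add_le_add ?_ (abs_centredSum_le t k l))
  refine le_trans ?_ (mul_le_mul_of_nonneg_left (bootGap_le_wildGap (C := C)) (by positivity))
  rw [bootGap, Finset.mul_sum, Finset.mul_sum]
  refine (Finset.abs_sum_le_sum_abs _ _).trans (Finset.sum_le_sum fun s _ => ?_)
  rw [abs_mul]
  have h1 : |v s k l - y (s, k) * y (s, l)| ≤ ∑ k, ∑ l, |v s k l - y (s, k) * y (s, l)| := by
    refine le_trans ?_ (Finset.single_le_sum (f := fun k => ∑ l, |v s k l - y (s, k) * y (s, l)|)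
      (fun _ _ => Finset.sum_nonneg fun _ _ => abs_nonneg _) (Finset.mem_univ k))
    exact Finset.single_le_sum (f := fun l => |v s k l - y (s, k) * y (s, l)|)
      (fun _ _ => abs_nonneg _) (Finset.mem_univ l)
  refine (mul_le_mul (hreg.abs_momentWeight_le t s) h1 (abs_nonneg _) (mul_nonneg (by positivity)
    (mul_nonneg (by positivity) (rowSq_nonneg n z s)))).trans_eq ?_
  ring

/-- The Lyapunov sum of the bootstrap errors, up to the fourth moment of the multipliers. -/
theorem sum_sq_mul_residual_pow_le {K h : ℝ} (hreg : RegularDesign n z K h) :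
    ∑ s, ((totalSize n : ℝ)⁻¹ * rowSq n z s) ^ 2 *
        ∑ k, (residual n z y (s, k) ^ 2 * wildScale n z s) ^ 2 ≤
      2 * (wildGap n z C y ^ 2 + wildGap n z C y) := by
  have hN := hreg.total_pos
  set d : Subj n → Fin p → ℝ := fun s k =>
    |residual n z y (s, k) * residual n z y (s, k) * wildScale n z s - y (s, k) * y (s, k)| with hd
  have hd0 : ∀ s k, 0 ≤ d s k := fun s k => abs_nonneg _
  have hD : ∀ s, ∑ k, d s k ≤ ∑ k, ∑ l,
      |residual n z y (s, k) * residual n z y (s, l) * wildScale n z s - y (s, k) * y (s, l)| :=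
    fun s => Finset.sum_le_sum fun k _ => Finset.single_le_sum (f := fun l =>
      |residual n z y (s, k) * residual n z y (s, l) * wildScale n z s - y (s, k) * y (s, l)|)
      (fun _ _ => abs_nonneg _) (Finset.mem_univ k)
  have h1 : ∀ s k, (residual n z y (s, k) ^ 2 * wildScale n z s) ^ 2
      ≤ 2 * d s k ^ 2 + 2 * y (s, k) ^ 4 := fun s k => by
    rw [hd]
    simp only [sq_abs]
    nlinarith [sq_nonneg (residual n z y (s, k) ^ 2 * wildScale n z s - 2 * y (s, k) ^ 2)]
  have h2 : ∑ s, ((totalSize n : ℝ)⁻¹ * rowSq n z s) ^ 2 * ∑ k, d s k ^ 2 ≤ bootGap n z y ^ 2 := by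
    have hx : ∀ s, 0 ≤ (totalSize n : ℝ)⁻¹ * (rowSq n z s * ∑ k, d s k) := fun s =>
      mul_nonneg (by positivity) (mul_nonneg (rowSq_nonneg n z s)
        (Finset.sum_nonneg fun k _ => hd0 s k))
    calc _ ≤ ∑ s, ((totalSize n : ℝ)⁻¹ * (rowSq n z s * ∑ k, d s k)) ^ 2 := by
          refine Finset.sum_le_sum fun s _ => ?_
          rw [← mul_assoc, mul_pow _ (∑ k, d s k)]
          exact mul_le_mul_of_nonneg_left
            (Finset.sum_sq_le_sq_sum_of_nonneg fun k _ => hd0 s k) (sq_nonneg _)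
      _ ≤ (∑ s, (totalSize n : ℝ)⁻¹ * (rowSq n z s * ∑ k, d s k)) ^ 2 :=
          Finset.sum_sq_le_sq_sum_of_nonneg fun s _ => hx s
      _ ≤ _ := by
          refine pow_le_pow_left₀ (Finset.sum_nonneg fun s _ => hx s) ?_ 2
          rw [← Finset.mul_sum, bootGap]
          exact mul_le_mul_of_nonneg_left (Finset.sum_le_sum fun s _ =>
            mul_le_mul_of_nonneg_left (hD s) (rowSq_nonneg n z s)) (by positivity)
  have h3 : bootGap n z y ^ 2 ≤ wildGap n z C y ^ 2 :=
    pow_le_pow_left₀ (bootGap_nonneg y) bootGap_le_wildGap 2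
  have h4 := lyapunovSum_le_wildGap (z := z) (C := C) (y := y)
  calc _ ≤ ∑ s, ((totalSize n : ℝ)⁻¹ * rowSq n z s) ^ 2 *
        ∑ k, (2 * d s k ^ 2 + 2 * y (s, k) ^ 4) :=
        Finset.sum_le_sum fun s _ => mul_le_mul_of_nonneg_left
          (Finset.sum_le_sum fun k _ => h1 s k) (sq_nonneg _)
    _ = 2 * (∑ s, ((totalSize n : ℝ)⁻¹ * rowSq n z s) ^ 2 * ∑ k, d s k ^ 2) +
        2 * ∑ s, ((totalSize n : ℝ)⁻¹ * rowSq n z s) ^ 2 * ∑ k, y (s, k) ^ 4 := by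
        rw [Finset.mul_sum, Finset.mul_sum, ← Finset.sum_add_distrib]
        refine Finset.sum_congr rfl fun s _ => ?_
        rw [Finset.sum_add_distrib, ← Finset.mul_sum, ← Finset.mul_sum]
        ring
    _ ≤ _ := by linarith

/-- If all leverages are small, inflating the residuals has a small effect. -/
theorem bootGap_le {η : ℝ} (hη : η ≤ 1 / 2) (hlev : ∀ s, |leverage n z s| ≤ η)
    (y : Subj n × Fin p → ℝ) :
    bootGap n z y ≤ 2 * residualGap n z y +
      2 * η * p * ((totalSize n : ℝ)⁻¹ * ∑ s, rowSq n z s * ∑ k, y (s, k) ^ 2) := by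
  have h1 : ∀ s k l,
      |residual n z y (s, k) * residual n z y (s, l) * wildScale n z s - y (s, k) * y (s, l)| ≤
      2 * |residual n z y (s, k) * residual n z y (s, l) - y (s, k) * y (s, l)| +
        η * (y (s, k) ^ 2 + y (s, l) ^ 2) := by
    intro s k l
    have hg := abs_wildScale_sub_one_le ((hlev s).trans hη)
    have hg2 : wildScale n z s ≤ 2 := by
      have := (abs_le.mp hg).2
      linarith [(hlev s).trans hη]
    have e : residual n z y (s, k) * residual n z y (s, l) * wildScale n z s - y (s, k) * y (s, l)
        = wildScale n z s * (residual n z y (s, k) * residual n z y (s, l) - y (s, k) * y (s, l))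
          + (wildScale n z s - 1) * (y (s, k) * y (s, l)) := by ring
    rw [e]
    refine (abs_add_le _ _).trans (add_le_add ?_ ?_)
    · rw [abs_mul, abs_of_nonneg (wildScale_nonneg n z s)]
      exact mul_le_mul_of_nonneg_right hg2 (abs_nonneg _)
    · rw [abs_mul]
      have h2 : |y (s, k) * y (s, l)| ≤ (y (s, k) ^ 2 + y (s, l) ^ 2) / 2 := by
        rw [abs_le]
        constructor <;> nlinarith [sq_nonneg (y (s, k) - y (s, l)), sq_nonneg (y (s, k) + y (s, l))]
      have h3 : |wildScale n z s - 1| ≤ 2 * η := hg.trans (by linarith [hlev s])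
      refine (mul_le_mul h3 h2 (abs_nonneg _) ((abs_nonneg _).trans h3)).trans_eq ?_
      ring
  have h2 : ∀ s, ∑ k, ∑ l,
      |residual n z y (s, k) * residual n z y (s, l) * wildScale n z s - y (s, k) * y (s, l)| ≤
      2 * ∑ k, ∑ l, |residual n z y (s, k) * residual n z y (s, l) - y (s, k) * y (s, l)| +
        2 * η * p * ∑ k, y (s, k) ^ 2 := by
    intro s
    refine (Finset.sum_le_sum fun k _ => Finset.sum_le_sum fun l _ => h1 s k l).trans_eq ?_
    simp only [Finset.sum_add_distrib, ← Finset.mul_sum, Finset.sum_const, Finset.card_univ,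
      Fintype.card_fin, nsmul_eq_mul]
    ring
  rw [bootGap, residualGap]
  calc _ ≤ (totalSize n : ℝ)⁻¹ * ∑ s, rowSq n z s *
        (2 * ∑ k, ∑ l, |residual n z y (s, k) * residual n z y (s, l) - y (s, k) * y (s, l)| +
        2 * η * p * ∑ k, y (s, k) ^ 2) :=
        mul_le_mul_of_nonneg_left (Finset.sum_le_sum fun s _ =>
          mul_le_mul_of_nonneg_left (h2 s) (rowSq_nonneg n z s)) (by positivity)
    _ = _ := by
        have : ∀ s, rowSq n z s *
          (2 * ∑ k, ∑ l, |residual n z y (s, k) * residual n z y (s, l) - y (s, k) * y (s, l)| +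
            2 * η * p * ∑ k, y (s, k) ^ 2) = 2 * (rowSq n z s *
          ∑ k, ∑ l, |residual n z y (s, k) * residual n z y (s, l) - y (s, k) * y (s, l)|) +
          2 * η * p * (rowSq n z s * ∑ k, y (s, k) ^ 2) := fun s => by ring
        simp only [this, Finset.sum_add_distrib, ← Finset.mul_sum]
        ring

end Bounds

end WildBootstrap

section WildLimit

variable {a c p : ℕ} {Ω : Type*}

/-- The bootstrap errors for the data `y`, as an array of random vectors. -/
noncomputable def wildArray (n : Fin a → ℕ) (z : Fin a → ℕ → Fin c → ℝ) (y : Subj n × Fin p → ℝ)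
    (τ : Fin a → ℕ → Ω → ℝ) (s : Subj n) (ω : Ω) (k : Fin p) : ℝ :=
  wildObs n z y (weightVec n τ ω) (s, k)

theorem wildArray_apply {n : Fin a → ℕ} {z : Fin a → ℕ → Fin c → ℝ} {τ : Fin a → ℕ → Ω → ℝ}
    (y : Subj n × Fin p → ℝ) (s : Subj n) (ω : Ω) (k : Fin p) :
    wildArray n z y τ s ω k
      = residual n z y (s, k) * (√(1 - leverage n z s))⁻¹ * τ s.1 s.2 ω := by
  simp only [wildArray, wildObs, weightVec]
  ring

variable [MeasurableSpace Ω] {P : Measure Ω}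

/-- Independent standardized multipliers with common fourth moment `M`. -/
structure IsMultiplierArray (P : Measure Ω) (τ : Fin a → ℕ → Ω → ℝ) (M : ℝ) : Prop where
  measurable : ∀ i j, Measurable (τ i j)
  indep : iIndepFun (fun ij : Fin a × ℕ => τ ij.1 ij.2) P
  memLp : ∀ i j, MemLp (τ i j) 4 P
  mean : ∀ i j, ∫ ω, τ i j ω ∂P = 0
  integral_sq : ∀ i j, ∫ ω, τ i j ω ^ 2 ∂P = 1
  integral_pow_four : ∀ i j, ∫ ω, τ i j ω ^ 4 ∂P = M

section Moments

variable {n : Fin a → ℕ} {z : Fin a → ℕ → Fin c → ℝ} {τ : Fin a → ℕ → Ω → ℝ} {M : ℝ}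

theorem IsMultiplierArray.isErrorArray_wildArray [IsProbabilityMeasure P]
    (hτ : IsMultiplierArray P τ M) (y : Subj n × Fin p → ℝ) :
    IsErrorArray P (wildArray n z y τ) := by
  have hg : ∀ s : Subj n, Measurable fun (t : ℝ) (k : Fin p) =>
      residual n z y (s, k) * (√(1 - leverage n z s))⁻¹ * t := fun s =>
    measurable_pi_lambda _ fun k => measurable_const_mul _
  have e : wildArray n z y τ = fun s => (fun (t : ℝ) (k : Fin p) =>
      residual n z y (s, k) * (√(1 - leverage n z s))⁻¹ * t) ∘ τ s.1 s.2 := by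
    funext s ω k
    exact wildArray_apply y s ω k
  refine ⟨fun s => ?_, ?_, fun s k => ?_, fun s k => ?_⟩
  · rw [e]; exact (hg s).comp (hτ.measurable _ _)
  · rw [e]; exact (hτ.indep.precomp (injective_subj n)).comp _ hg
  · simp only [wildArray_apply]; exact (hτ.memLp _ _).const_mul _
  · simp only [wildArray_apply]; rw [integral_const_mul, hτ.mean, mul_zero]

theorem IsMultiplierArray.integral_wildArray_mul (hτ : IsMultiplierArray P τ M)
    (y : Subj n × Fin p → ℝ) (s : Subj n) (k l : Fin p) :
    ∫ ω, wildArray n z y τ s ω k * wildArray n z y τ s ω l ∂P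
      = residual n z y (s, k) * residual n z y (s, l) * wildScale n z s := by
  have e : ∀ ω, wildArray n z y τ s ω k * wildArray n z y τ s ω l =
      residual n z y (s, k) * residual n z y (s, l) * wildScale n z s * τ s.1 s.2 ω ^ 2 :=
    fun ω => by rw [wildArray_apply, wildArray_apply, wildScale]; ring
  simp_rw [e]
  rw [integral_const_mul, hτ.integral_sq, mul_one]

theorem IsMultiplierArray.integral_wildArray_sq (hτ : IsMultiplierArray P τ M)
    (y : Subj n × Fin p → ℝ) (s : Subj n) (k : Fin p) :
    ∫ ω, wildArray n z y τ s ω k ^ 2 ∂P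
      = residual n z y (s, k) * residual n z y (s, k) * wildScale n z s := by
  rw [← hτ.integral_wildArray_mul]
  simp only [sq]

theorem IsMultiplierArray.integral_wildArray_pow_four (hτ : IsMultiplierArray P τ M)
    (y : Subj n × Fin p → ℝ) (s : Subj n) (k : Fin p) :
    ∫ ω, wildArray n z y τ s ω k ^ 4 ∂P
      = (residual n z y (s, k) ^ 2 * wildScale n z s) ^ 2 * M := by
  have e : ∀ ω, wildArray n z y τ s ω k ^ 4 =
      (residual n z y (s, k) ^ 2 * wildScale n z s) ^ 2 * τ s.1 s.2 ω ^ 4 :=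
    fun ω => by rw [wildArray_apply, wildScale]; ring
  simp_rw [e]
  rw [integral_const_mul, hτ.integral_pow_four]

end Moments

variable {n : ℕ → Fin a → ℕ} {z : Fin a → ℕ → Fin c → ℝ} {K : ℝ}
  {h : ℕ → ℝ} {e : ∀ m, Subj (n m) → Ω → Fin p → ℝ}
  {L : Matrix (Fin a × Fin p) (Fin a × Fin p) ℝ} {σ2 : Fin a × Fin p → ℝ}
  {τ : Fin a → ℕ → Ω → ℝ} {M : ℝ}

/-- Along data sets whose discrepancy vanishes, the bootstrap errors satisfy the assumptions of the
limit theorem, with the same limits as the true errors. -/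
theorem ErrorLimit.wildArray [IsProbabilityMeasure P] (he : ErrorLimit P n z e L σ2)
    (hreg : ∀ᶠ m in atTop, RegularDesign (n m) z K (h m)) (hτ : IsMultiplierArray P τ M)
    {φ : ℕ → ℕ} (hφ : Tendsto φ atTop atTop) {y : ∀ j, Subj (n (φ j)) × Fin p → ℝ}
    (hgap : Tendsto (fun j => wildGap (n (φ j)) z
      (fun s k l => ∫ ω, e (φ j) s ω k * e (φ j) s ω l ∂P) (y j)) atTop (𝓝 0)) :
    ErrorLimit P (fun j => n (φ j)) z (fun j => wildArray (n (φ j)) z (y j) τ) L σ2 := by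
  set C : ∀ m, Subj (n m) → Fin p → Fin p → ℝ := fun m s k l =>
    ∫ ω, e m s ω k * e m s ω l ∂P with hC
  set v : ∀ j, Subj (n (φ j)) → Fin p → Fin p → ℝ := fun j s k l =>
    residual (n (φ j)) z (y j) (s, k) * residual (n (φ j)) z (y j) (s, l) *
      wildScale (n (φ j)) z s with hv
  have hreg' := hφ.eventually hreg
  have hdiff : ∀ t k l, Tendsto (fun j => ∑ s, momentWeight (n (φ j)) z t s * v j s k l -
      ∑ s, momentWeight (n (φ j)) z t s * C (φ j) s k l) atTop (𝓝 0) := by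
    intro t k l
    refine (tendsto_zero_iff_abs_tendsto_zero _).mpr (squeeze_zero'
      (Eventually.of_forall fun j => abs_nonneg _) ?_
      (by simpa using (hgap.const_mul (K + 1)).add hgap.sqrt))
    filter_upwards [hreg'] with j hr
    exact abs_sum_momentWeight_sub_le hr t k l
  have hlim : ∀ t k l {x : ℝ},
      Tendsto (fun m => ∑ s, momentWeight (n m) z t s * C m s k l) atTop (𝓝 x) →
      Tendsto (fun j => ∑ s, momentWeight (n (φ j)) z t s * v j s k l) atTop (𝓝 x) := by
    intro t k l x hx
    simpa using (hdiff t k l).add (hx.comp hφ)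
  refine ⟨fun j => hτ.isErrorArray_wildArray (y j), fun i i' k l => ?_, ?_, ?_, fun i k => ?_⟩
  · have := hlim (.inl (i, i')) k l (x := L (i, k) (i', l)) ((he.cov i i' k l).congr fun m => by
      rw [Finset.mul_sum]
      exact Finset.sum_congr rfl fun s _ => by simp only [momentWeight, hC]; ring)
    refine this.congr fun j => ?_
    rw [Finset.mul_sum]
    refine Finset.sum_congr rfl fun s _ => ?_
    rw [hτ.integral_wildArray_mul]
    simp only [momentWeight, hv]; ring
  · obtain ⟨B, hB⟩ := he.bdd
    have hk : ∀ᶠ j in atTop, ∀ k, ∑ s, momentWeight (n (φ j)) z (.inr (.inr ())) s * v j s k k -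
        ∑ s, momentWeight (n (φ j)) z (.inr (.inr ())) s * C (φ j) s k k < 1 :=
      eventually_all.mpr fun k => (hdiff _ k k).eventually_lt_const one_pos
    refine ⟨B + p, ?_⟩
    filter_upwards [hk, hφ.eventually hB] with j hj hBj
    have e1 : ∀ f : Subj (n (φ j)) → Fin p → ℝ, (totalSize (n (φ j)) : ℝ)⁻¹ *
        ∑ s, rowSq (n (φ j)) z s * ∑ k, f s k =
        ∑ k, ∑ s, momentWeight (n (φ j)) z (.inr (.inr ())) s * f s k := by
      intro f
      rw [Finset.sum_comm, Finset.mul_sum]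
      refine Finset.sum_congr rfl fun s _ => ?_
      rw [← Finset.mul_sum]
      simp only [momentWeight]; ring
    rw [e1] at hBj ⊢
    have e2 : ∀ s k, ∫ ω, e (φ j) s ω k ^ 2 ∂P = C (φ j) s k k := fun s k => by
      simp only [hC, sq]
    simp only [e2] at hBj
    simp only [hτ.integral_wildArray_sq]
    calc _ ≤ ∑ k, (∑ s, momentWeight (n (φ j)) z (.inr (.inr ())) s * C (φ j) s k k + 1) :=
          Finset.sum_le_sum fun k _ => by linarith [hj k]
      _ ≤ _ := by
          rw [Finset.sum_add_distrib]
          simpa using hBj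
  · have hl : Tendsto (fun j => 2 * (wildGap (n (φ j)) z (C (φ j)) (y j) ^ 2 +
        wildGap (n (φ j)) z (C (φ j)) (y j)) * |M|) atTop (𝓝 0) := by
      simpa using (((hgap.pow 2).add hgap).const_mul 2).mul_const |M|
    refine squeeze_zero' (Eventually.of_forall fun j => Finset.sum_nonneg fun s _ =>
      mul_nonneg (sq_nonneg _) (Finset.sum_nonneg fun k _ => integral_nonneg fun ω => by
        positivity)) ?_ hl
    filter_upwards [hreg'] with j hr
    simp only [hτ.integral_wildArray_pow_four, ← Finset.sum_mul, ← mul_assoc]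
    have h0 : 0 ≤ ∑ s, ((totalSize (n (φ j)) : ℝ)⁻¹ * rowSq (n (φ j)) z s) ^ 2 *
        ∑ k, (residual (n (φ j)) z (y j) (s, k) ^ 2 * wildScale (n (φ j)) z s) ^ 2 :=
      Finset.sum_nonneg fun s _ => mul_nonneg (sq_nonneg _)
        (Finset.sum_nonneg fun k _ => sq_nonneg _)
    exact (mul_le_mul_of_nonneg_left (le_abs_self M) h0).trans
      (mul_le_mul_of_nonneg_right (sum_sq_mul_residual_pow_le hr) (abs_nonneg M))
  · have := hlim (.inr (.inl i)) k k (x := σ2 (i, k)) ((he.var i k).congr fun m => by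
      simp only [momentWeight]
      rw [sum_ite_mul_eq]
      simp only [hC, sq])
    refine this.congr fun j => ?_
    simp only [momentWeight]
    rw [sum_ite_mul_eq]
    simp only [hτ.integral_wildArray_sq, hv]

/-- The expected discrepancy between the moments of the bootstrap errors and those of the true
errors vanishes. -/
theorem ErrorLimit.tendsto_integral_wildGap [IsProbabilityMeasure P]
    (he : ErrorLimit P n z e L σ2) (hh : Tendsto h atTop (𝓝 0))
    (hreg : ∀ᶠ m in atTop, RegularDesign (n m) z K (h m)) :
    (∀ m, Integrable (fun ω => wildGap (n m) z (fun s k l => ∫ ω, e m s ω k * e m s ω l ∂P)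
      (stack (e m) ω)) P) ∧
    Tendsto (fun m => ∫ ω, wildGap (n m) z (fun s k l => ∫ ω, e m s ω k * e m s ω l ∂P)
      (stack (e m) ω) ∂P) atTop (𝓝 0) := by
  set C : ∀ m, Subj (n m) → Fin p → Fin p → ℝ := fun m s k l =>
    ∫ ω, e m s ω k * e m s ω l ∂P with hC
  have iboot : ∀ m, Integrable (fun ω => bootGap (n m) z (stack (e m) ω)) P := fun m => by
    refine (integrable_finsetSum _ fun s _ => (integrable_finsetSum _ fun k _ =>
      integrable_finsetSum _ fun l _ => ?_).const_mul _).const_mul _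
    refine Integrable.abs (((MemLp.integrable_mul (p := 2) (q := 2) ?_ ?_).mul_const _).sub
      ((he.array m).integrable_mul s k l))
    · exact ((he.array m).memLp_residual s k).mono_exponent (by norm_num)
    · exact ((he.array m).memLp_residual s l).mono_exponent (by norm_num)
  have ilyap : ∀ m, Integrable (fun ω => ∑ s, ((totalSize (n m) : ℝ)⁻¹ * rowSq (n m) z s) ^ 2 *
      ∑ k, stack (e m) ω (s, k) ^ 4) P := fun m =>
    integrable_finsetSum _ fun s _ => (integrable_finsetSum _ fun k _ =>
      (he.array m).integrable_pow_four s k).const_mul _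
  have icent : ∀ m t k l, Integrable (fun ω => centredSum (n m) z (C m) t k l
      (stack (e m) ω) ^ 2) P := fun m t k l =>
    ((he.array m).memLp_sum_mul_sub (momentWeight (n m) z t) k l).integrable_sq
  have icent' : ∀ m, Integrable (fun ω => ∑ t, ∑ k, ∑ l, centredSum (n m) z (C m) t k l
      (stack (e m) ω) ^ 2) P := fun m =>
    integrable_finsetSum _ fun t _ => integrable_finsetSum _ fun k _ =>
      integrable_finsetSum _ fun l _ => icent m t k l
  refine ⟨fun m => ((iboot m).add (ilyap m)).add (icent' m), ?_⟩
  have hboot : Tendsto (fun m => ∫ ω, bootGap (n m) z (stack (e m) ω) ∂P) atTop (𝓝 0) := by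
    obtain ⟨B, hB⟩ := he.bdd
    set η : ℕ → ℝ := fun m => h m * √((a + c) * K) with hη
    have hηlim : Tendsto η atTop (𝓝 0) := by simpa using hh.mul_const (√((a + c) * K))
    have hlim : Tendsto (fun m => 2 * ∫ ω, residualGap (n m) z (stack (e m) ω) ∂P +
        2 * η m * p * B) atTop (𝓝 0) := by
      simpa using ((he.tendsto_integral_residualGap hh hreg).const_mul 2).add
        (((hηlim.const_mul 2).mul_const (p : ℝ)).mul_const B)
    refine squeeze_zero' (Eventually.of_forall fun m => integral_nonneg fun ω => bootGap_nonneg _)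
      ?_ hlim
    filter_upwards [hreg, hB, hηlim.eventually_lt_const (u := 1 / 2) (by norm_num)]
      with m hr hBm hηm
    have hη0 : 0 ≤ η m := mul_nonneg hr.h_pos.le (Real.sqrt_nonneg _)
    have i1 : Integrable (fun ω => 2 * residualGap (n m) z (stack (e m) ω)) P :=
      (he.array m).integrable_residualGap.const_mul 2
    have i3 : ∀ s : Subj (n m), Integrable (fun ω => rowSq (n m) z s *
        ∑ k, stack (e m) ω (s, k) ^ 2) P := fun s =>
      (integrable_finsetSum _ fun k _ => (he.array m).integrable_sq s k).const_mul _
    have i2 : Integrable (fun ω => 2 * η m * p * ((totalSize (n m) : ℝ)⁻¹ *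
        ∑ s, rowSq (n m) z s * ∑ k, stack (e m) ω (s, k) ^ 2)) P :=
      ((integrable_finsetSum _ fun s _ => i3 s).const_mul _).const_mul _
    refine (integral_mono (iboot m) (i1.add i2) fun ω =>
      bootGap_le hηm.le (fun s => hr.abs_leverage_le s) _).trans ?_
    simp only [Pi.add_apply]
    rw [integral_add i1 i2, integral_const_mul, integral_const_mul, integral_const_mul,
      integral_finsetSum _ fun s _ => i3 s]
    refine add_le_add_right (mul_le_mul_of_nonneg_left (le_trans (le_of_eq ?_) hBm)
      (by positivity)) _
    congr 1
    refine Finset.sum_congr rfl fun s _ => ?_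
    rw [integral_const_mul, integral_finsetSum]
    · rfl
    · exact fun k _ => (he.array m).integrable_sq s k
  have hcent : ∀ t k l, Tendsto (fun m => ∫ ω, centredSum (n m) z (C m) t k l
      (stack (e m) ω) ^ 2 ∂P) atTop (𝓝 0) := by
    intro t k l
    refine squeeze_zero' (Eventually.of_forall fun m => integral_nonneg fun ω => sq_nonneg _) ?_
      (by simpa using he.lyapunov.const_mul ((K + 1) ^ 2))
    filter_upwards [hreg] with m hr
    refine ((he.array m).integral_sq_sum_mul_sub_le (hr.abs_momentWeight_le t) k l).trans_eq ?_
    rw [Finset.mul_sum]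
    exact Finset.sum_congr rfl fun s _ => by ring
  have htot := (hboot.add he.lyapunov).add (tendsto_finsetSum Finset.univ fun t _ =>
    tendsto_finsetSum Finset.univ fun k _ => tendsto_finsetSum Finset.univ fun l _ => hcent t k l)
  simp only [Finset.sum_const_zero, add_zero] at htot
  refine htot.congr fun m => ?_
  have e1 : ∫ ω, ∑ s, ((totalSize (n m) : ℝ)⁻¹ * rowSq (n m) z s) ^ 2 *
      ∑ k, stack (e m) ω (s, k) ^ 4 ∂P = ∑ s, ((totalSize (n m) : ℝ)⁻¹ * rowSq (n m) z s) ^ 2 *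
      ∑ k, ∫ ω, e m s ω k ^ 4 ∂P := by
    simp only [stack]
    rw [integral_finsetSum _ fun s _ => (integrable_finsetSum _ fun k _ =>
      (he.array m).integrable_pow_four s k).const_mul _]
    refine Finset.sum_congr rfl fun s _ => ?_
    rw [integral_const_mul, integral_finsetSum _ fun k _ =>
      (he.array m).integrable_pow_four s k]
  have e2 : ∫ ω, ∑ t, ∑ k, ∑ l, centredSum (n m) z (C m) t k l (stack (e m) ω) ^ 2 ∂P
      = ∑ t, ∑ k, ∑ l, ∫ ω, centredSum (n m) z (C m) t k l (stack (e m) ω) ^ 2 ∂P := by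
    rw [integral_finsetSum _ fun t _ => integrable_finsetSum _ fun k _ =>
      integrable_finsetSum _ fun l _ => icent m t k l]
    refine Finset.sum_congr rfl fun t _ => ?_
    rw [integral_finsetSum _ fun k _ => integrable_finsetSum _ fun l _ => icent m t k l]
    refine Finset.sum_congr rfl fun k _ => ?_
    rw [integral_finsetSum _ fun l _ => icent m t k l]
  unfold wildGap
  rw [← e1, ← e2, ← integral_add (iboot m) (ilyap m)]
  exact (integral_add ((iboot m).add (ilyap m)) (icent' m)).symm

end WildLimit

/-! ### Consistency of the conditional law of the wild bootstrap -/

section WildConsistency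

variable {a c p : ℕ} {Ω : Type*} [MeasurableSpace Ω] {P : Measure Ω} [IsProbabilityMeasure P]
  {n : ℕ → Fin a → ℕ} {z : Fin a → ℕ → Fin c → ℝ} {K : ℝ}
  {h : ℕ → ℝ} {e : ∀ m, Subj (n m) → Ω → Fin p → ℝ}
  {L : Matrix (Fin a × Fin p) (Fin a × Fin p) ℝ} {σ2 : Fin a × Fin p → ℝ}
  {τ : Fin a → ℕ → Ω → ℝ} {M : ℝ} {κ : Fin a → ℝ}
  {T : Matrix (Fin a × Fin p) (Fin a × Fin p) ℝ}

/-- The limit law of the statistic: the law of a quadratic form in a centred Gaussian vector with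
covariance matrix `L`. -/
noncomputable def limitLaw (T L : Matrix (Fin a × Fin p) (Fin a × Fin p) ℝ)
    (d : Fin a × Fin p → ℝ) : Measure ℝ :=
  (multivariateGaussian 0 L).map fun g => waldForm T g.ofLp d

/-- The statistic of the true errors has the limit law, uniformly in the argument of the
distribution function. -/
theorem ErrorLimit.eventually_abs_law_sub_le (he : ErrorLimit P n z e L σ2) (hL : L.PosSemidef)
    (hσ : ∀ q, 0 < σ2 q) (hh : Tendsto h atTop (𝓝 0))
    (hreg : ∀ᶠ m in atTop, RegularDesign (n m) z K (h m))
    (hN : Tendsto (fun m => totalSize (n m)) atTop atTop) (hκ : ∀ i, 0 < κ i)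
    (hratio : ∀ i, Tendsto (fun m => (totalSize (n m) : ℝ) / (n m i : ℝ)) atTop (𝓝 (κ i)))
    (hT : Tᵀ = T) (hTT : T * T = T) (hTL : T * L * T ≠ 0) {η : ℝ} (hη : 0 < η) :
    ∀ᶠ m in atTop, ∀ x, |(P.map fun ω => mancats (n m) z T (stack (e m) ω)).real (Set.Iic x) -
      (limitLaw T L fun q => κ q.1 * σ2 q).real (Set.Iic x)| ≤ η := by
  have hlim := he.tendsto_mancats hL hσ hh hreg hN hκ hratio hT hTT
  have hatom : ∀ x, limitLaw T L (fun q => κ q.1 * σ2 q) {x} = 0 :=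
    waldForm_gaussian_eq_zero hT hTT hL hTL fun q => mul_pos (hκ q.1) (hσ q)
  have hprob : IsProbabilityMeasure (limitLaw T L fun q => κ q.1 * σ2 q) :=
    Measure.isProbabilityMeasure_map hlim.aemeasurable_limit
  have hprob' : ∀ m, IsProbabilityMeasure (P.map fun ω => mancats (n m) z T (stack (e m) ω)) :=
    fun m => Measure.isProbabilityMeasure_map (hlim.forall_aemeasurable m)
  exact eventually_forall_abs_measureReal_Iic_sub_le hatom
    (fun x => TendstoInDistribution.tendsto_measureReal_le hlim hatom x) hη

/-- If the discrepancy between the moments is small, the conditional law of the bootstrap statistic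
is close to the limit law. Otherwise there would be data sets with vanishing discrepancy along which
the bootstrap fails, in contradiction to the limit theorem for the bootstrap errors. -/
theorem ErrorLimit.exists_wildGap_lt (he : ErrorLimit P n z e L σ2) (hL : L.PosSemidef)
    (hσ : ∀ q, 0 < σ2 q) (hh : Tendsto h atTop (𝓝 0))
    (hreg : ∀ᶠ m in atTop, RegularDesign (n m) z K (h m))
    (hN : Tendsto (fun m => totalSize (n m)) atTop atTop) (hκ : ∀ i, 0 < κ i)
    (hratio : ∀ i, Tendsto (fun m => (totalSize (n m) : ℝ) / (n m i : ℝ)) atTop (𝓝 (κ i)))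
    (hT : Tᵀ = T) (hTT : T * T = T) (hTL : T * L * T ≠ 0) (hτ : IsMultiplierArray P τ M)
    {η : ℝ} (hη : 0 < η) :
    ∃ δ > 0, ∀ᶠ m in atTop, ∀ y : Subj (n m) × Fin p → ℝ,
      wildGap (n m) z (fun s k l => ∫ ω, e m s ω k * e m s ω l ∂P) y < δ →
      ∀ x, |(P.map fun ω => wildMancats (n m) z T y (weightVec (n m) τ ω)).real (Set.Iic x) -
        (limitLaw T L fun q => κ q.1 * σ2 q).real (Set.Iic x)| ≤ η := by
  by_contra hcon
  push Not at hcon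
  have hj : ∀ j : ℕ, ∃ m ≥ j, ∃ y : Subj (n m) × Fin p → ℝ,
      wildGap (n m) z (fun s k l => ∫ ω, e m s ω k * e m s ω l ∂P) y < 1 / ((j : ℝ) + 1) ∧
      ∃ x, η < |(P.map fun ω => wildMancats (n m) z T y (weightVec (n m) τ ω)).real (Set.Iic x) -
        (limitLaw T L fun q => κ q.1 * σ2 q).real (Set.Iic x)| := fun j =>
    frequently_atTop.mp (hcon (1 / ((j : ℝ) + 1)) (by positivity)) j
  choose φ hφj y hy x hx using hj
  have hφ : Tendsto φ atTop atTop := tendsto_atTop_mono hφj tendsto_id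
  have hgap : Tendsto (fun j => wildGap (n (φ j)) z
      (fun s k l => ∫ ω, e (φ j) s ω k * e (φ j) s ω l ∂P) (y j)) atTop (𝓝 0) :=
    squeeze_zero (fun j => wildGap_nonneg) (fun j => (hy j).le)
      tendsto_one_div_add_atTop_nhds_zero_nat
  have hev := (he.wildArray hreg hτ hφ hgap).eventually_abs_law_sub_le hL hσ (hh.comp hφ)
    (hφ.eventually hreg) (hN.comp hφ) hκ (fun i => (hratio i).comp hφ) hT hTT hTL hη
  obtain ⟨j, hj⟩ := hev.exists
  exact absurd (hj (x j)) (not_le.mpr (hx j))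

/-- For the data of the model, the law of the bootstrap statistic converges to the limit law,
uniformly in probability. -/
theorem ErrorLimit.tendsto_measureReal_wildLaw (he : ErrorLimit P n z e L σ2) (hL : L.PosSemidef)
    (hσ : ∀ q, 0 < σ2 q) (hh : Tendsto h atTop (𝓝 0))
    (hreg : ∀ᶠ m in atTop, RegularDesign (n m) z K (h m))
    (hN : Tendsto (fun m => totalSize (n m)) atTop atTop) (hκ : ∀ i, 0 < κ i)
    (hratio : ∀ i, Tendsto (fun m => (totalSize (n m) : ℝ) / (n m i : ℝ)) atTop (𝓝 (κ i)))
    (hT : Tᵀ = T) (hTT : T * T = T) (hTL : T * L * T ≠ 0) (hτ : IsMultiplierArray P τ M)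
    {η : ℝ} (hη : 0 < η) :
    Tendsto (fun m => P.real {ω | ∃ x, η < |(P.map fun ω' =>
        wildMancats (n m) z T (stack (e m) ω) (weightVec (n m) τ ω')).real (Set.Iic x) -
        (limitLaw T L fun q => κ q.1 * σ2 q).real (Set.Iic x)|}) atTop (𝓝 0) := by
  obtain ⟨δ, hδ, hev⟩ := he.exists_wildGap_lt hL hσ hh hreg hN hκ hratio hT hTT hTL hτ hη
  obtain ⟨hi, hlim⟩ := he.tendsto_integral_wildGap hh hreg
  refine squeeze_zero' (Eventually.of_forall fun m => measureReal_nonneg) ?_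
    (tendsto_measureReal_ge_of_integral (fun m ω => wildGap_nonneg) hi hlim hδ)
  filter_upwards [hev] with m hm
  refine measureReal_mono fun ω hω => ?_
  obtain ⟨x, hx⟩ := hω
  by_contra hn
  exact absurd (hm _ (not_le.mp hn) x) (not_le.mpr hx)

end WildConsistency

section ConditionalLaw

variable {a c p : ℕ} {Ω : Type*} [MeasurableSpace Ω] {P : Measure Ω}

theorem dataVec_eq {α : Type*} (n : Fin a → ℕ) (z : Fin a → ℕ → Fin c → ℝ)
    (ε : Fin a → ℕ → α → Fin p → ℝ) (β : Param a c p) (ω : α) :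
    dataVec n z ε β ω = fullDesign n z p *ᵥ β + stack (fun s : Subj n => ε s.1 s.2) ω := rfl

/-- The wild bootstrap does not depend on the parameter. -/
theorem wildMancats_dataVec {α : Type*} {n : Fin a → ℕ} {z : Fin a → ℕ → Fin c → ℝ}
    (hdet : IsUnit ((designMatrix n z)ᵀ * designMatrix n z).det)
    (T : Matrix (Fin a × Fin p) (Fin a × Fin p) ℝ) (ε : Fin a → ℕ → α → Fin p → ℝ)
    (β : Param a c p) (ω : α) (t : Subj n → ℝ) :
    wildMancats n z T (dataVec n z ε β ω) t
      = wildMancats n z T (stack (fun s : Subj n => ε s.1 s.2) ω) t := by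
  unfold wildMancats wildObs
  rw [dataVec_eq, residual_add_mulVec hdet]

theorem measurable_wildMancats (n : Fin a → ℕ) (z : Fin a → ℕ → Fin c → ℝ)
    (T : Matrix (Fin a × Fin p) (Fin a × Fin p) ℝ) :
    Measurable fun x : (Subj n × Fin p → ℝ) × (Subj n → ℝ) => wildMancats n z T x.1 x.2 := by
  refine (measurable_mancats T).comp (measurable_pi_lambda _ fun q => ?_)
  exact ((measurable_residual q).comp measurable_fst).mul
    (((measurable_pi_apply q.1).comp measurable_snd).div_const _)

theorem measurable_dataVec (n : Fin a → ℕ) (z : Fin a → ℕ → Fin c → ℝ)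
    {ε : Fin a → ℕ → Ω → Fin p → ℝ} (hε : ∀ i j, Measurable (ε i j)) (β : Param a c p) :
    Measurable (dataVec n z ε β) :=
  measurable_pi_lambda _ fun q => ((measurable_pi_apply q.2).comp (hε q.1.1 q.1.2)).const_add _

/-- The conditional law of the bootstrap statistic is its law for fixed data. -/
theorem wildCondLaw_ae_eq [IsProbabilityMeasure P] (n : Fin a → ℕ) (z : Fin a → ℕ → Fin c → ℝ)
    {ε : Fin a → ℕ → Ω → Fin p → ℝ} (hε : ∀ i j, Measurable (ε i j))
    {τ : Fin a → ℕ → Ω → ℝ} (hτ : ∀ i j, Measurable (τ i j))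
    (hτε : IndepFun (fun ω (ij : Fin a × ℕ) => ε ij.1 ij.2 ω)
      (fun ω (ij : Fin a × ℕ) => τ ij.1 ij.2 ω) P)
    (T : Matrix (Fin a × Fin p) (Fin a × Fin p) ℝ) (β : Param a c p) :
    ∀ᵐ ω ∂P, wildCondLaw n z P ε τ T β (dataVec n z ε β ω) =
      P.map fun ω' => wildMancats n z T (dataVec n z ε β ω) (weightVec n τ ω') := by
  have hY := measurable_dataVec n z hε β
  have hW : Measurable (weightVec n τ) := measurable_pi_lambda _ fun s => hτ s.1 s.2
  have hind : IndepFun (dataVec n z ε β) (weightVec n τ) P := by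
    have h1 : Measurable fun (f : Fin a × ℕ → Fin p → ℝ) (q : Subj n × Fin p) =>
        (fullDesign n z p *ᵥ β) q + f (q.1.1, q.1.2) q.2 := by
      refine measurable_pi_lambda _ fun q => ?_
      have : Measurable fun f : Fin a × ℕ → Fin p → ℝ => f (q.1.1, q.1.2) q.2 := by fun_prop
      exact this.const_add _
    have h2 : Measurable fun (f : Fin a × ℕ → ℝ) (s : Subj n) => f (s.1, s.2) :=
      measurable_pi_lambda _ fun s => measurable_pi_apply _
    exact hτε.comp h1 h2
  exact ae_of_ae_map hY.aemeasurable
    (condDistrib_comp_prodMk_of_indepFun hY hW hind (measurable_wildMancats n z T))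

end ConditionalLaw

end Mancova

theorem theorem3 {a c p r : ℕ}
    {Ω : Type*} [MeasurableSpace Ω] (P : Measure Ω) [IsProbabilityMeasure P]
    -- sample sizes `n m i` along a sequence of samples with total size tending to infinity
    (n : ℕ → Fin a → ℕ) (hN : Tendsto (fun m => totalSize (n m)) atTop atTop)
    -- fixed covariates, errors, multipliers
    (z : Fin a → ℕ → Fin c → ℝ)
    (ε : Fin a → ℕ → Ω → Fin p → ℝ) (hεmeas : ∀ i j, Measurable (ε i j))
    (τ : Fin a → ℕ → Ω → ℝ) (hτmeas : ∀ i j, Measurable (τ i j))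
    -- errors: independent, centred, group-wise covariance, bounded fourth moments
    (Sig : Fin a → Matrix (Fin p) (Fin p) ℝ) (C₁ : ℝ)
    (hεindep : iIndepFun (fun ij : Fin a × ℕ => ε ij.1 ij.2) P)
    (hεmean : ∀ i j k, ∫ ω, ε i j ω k ∂P = 0)
    (hεcov : ∀ i j k l, cov[fun ω => ε i j ω k, fun ω => ε i j ω l; P] = Sig i k l)
    (hεmem : ∀ i j k, MemLp (fun ω => ε i j ω k) 4 P)
    (hε4 : ∀ i j k, ∫ ω, ε i j ω k ^ 4 ∂P ≤ C₁)
    -- possibly singular covariance matrices with positive diagonal entries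
    (hSig : ∀ i, (Sig i).PosSemidef) (hSigdiag : ∀ i k, 0 < Sig i k k)
    -- proportions of the group sizes
    (κ : Fin a → ℝ) (hκ : ∀ i, 0 < κ i)
    (hratio : ∀ i, Tendsto (fun m => (totalSize (n m) : ℝ) / (n m i : ℝ)) atTop (𝓝 (κ i)))
    -- no collinearity, also in the limit
    (hcol : ∀ᶠ m in atTop, LinearIndependent ℝ (designMatrix (n m) z).col)
    (Ξ : Matrix (Fin a ⊕ Fin c) (Fin a ⊕ Fin c) ℝ)
    (hΞ : Tendsto (fun m => (totalSize (n m) : ℝ)⁻¹ •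
      ((designMatrix (n m) z)ᵀ * designMatrix (n m) z)) atTop (𝓝 Ξ))
    (hΞdet : IsUnit Ξ.det)
    -- convergence of the empirical first and second moments of the covariates
    (zbar : Fin a → Fin c → ℝ)
    (hz1 : ∀ i w, Tendsto (fun N : ℕ => (N : ℝ)⁻¹ * ∑ j ∈ Finset.range N, z i j w)
      atTop (𝓝 (zbar i w)))
    (Ξgrp : Fin a → Matrix (Fin c) (Fin c) ℝ)
    (hz2 : ∀ i, Tendsto
      (fun N : ℕ => (N : ℝ)⁻¹ • ∑ j ∈ Finset.range N, Matrix.vecMulVec (z i j) (z i j))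
      atTop (𝓝 (Ξgrp i)))
    -- multipliers: i.i.d., mean 0, variance 1, finite fourth moment, independent of the errors
    (hτindep : iIndepFun (fun ij : Fin a × ℕ => τ ij.1 ij.2) P)
    (hτid : ∀ i j i' j', IdentDistrib (τ i j) (τ i' j') P P)
    (hτmean : ∀ i j, ∫ ω, τ i j ω ∂P = 0) (hτvar : ∀ i j, Var[τ i j; P] = 1)
    (hτ4 : ∀ i j, MemLp (τ i j) 4 P)
    (hτε : IndepFun (fun ω (ij : Fin a × ℕ) => ε ij.1 ij.2 ω)
      (fun ω (ij : Fin a × ℕ) => τ ij.1 ij.2 ω) P)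
    -- hypothesis matrix in projector form
    (H : Matrix (Fin r) (Fin a × Fin p) ℝ)
    (T : Matrix (Fin a × Fin p) (Fin a × Fin p) ℝ) (hT : T = hypProjector H)
    -- the limiting covariance matrix of the scaled tested contrasts is not zero
    (Λ₁₁ : Matrix (Fin a × Fin p) (Fin a × Fin p) ℝ)
    (hΛ : Tendsto (fun m => scaledMeanCov (n m) z Sig) atTop (𝓝 Λ₁₁))
    (hnondeg : T * Λ₁₁ * T ≠ 0) :
    (∀ β β₀ : Param a c p, T *ᵥ meanPart β₀ = 0 →
      TendstoInMeasure P
        (fun m ω => ⨆ x : ℝ,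
          |(wildCondLaw (n m) z P ε τ T β (dataVec (n m) z ε β ω)).real (Set.Iic x) -
            P.real {ω' | mancats (n m) z T (dataVec (n m) z ε β₀ ω') ≤ x}|)
        atTop (fun _ => 0)) ∧
    (∀ β : Param a c p, T *ᵥ meanPart β = 0 → ∀ α : ℝ, 0 < α → α < 1 →
      Tendsto
        (fun m => P.real {ω |
          quantile (wildCondLaw (n m) z P ε τ T β (dataVec (n m) z ε β ω)) (1 - α) <
            mancats (n m) z T (dataVec (n m) z ε β ω)})
        atTop (𝓝 α)) := by
  -- the design is eventually regular, and the errors satisfy the limit theorem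
  obtain ⟨K, h, hh, hreg⟩ := exists_regularDesign hN hκ hratio hΞ hΞdet hz2
  have hTt : Tᵀ = T := by rw [hT, transpose_hypProjector]
  have hTT : T * T = T := by rw [hT, hypProjector_mul_self]
  have harr : ∀ m, IsErrorArray P fun s : Subj (n m) => ε s.1 s.2 := fun m =>
    isErrorArray_of_iIndepFun hεmeas hεindep hεmean hεmem (n m)
  have hprod : ∀ i j k l, ∫ ω, ε i j ω k * ε i j ω l ∂P = Sig i k l := by
    intro i j k l
    have h2 : ∀ k, MemLp (fun ω => ε i j ω k) 2 P := fun k =>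
      (hεmem i j k).mono_exponent (by norm_num)
    have := hεcov i j k l
    rw [covariance_eq_sub (h2 k) (h2 l), hεmean, zero_mul, sub_zero] at this
    exact this
  have he : ErrorLimit P n z (fun m (s : Subj (n m)) => ε s.1 s.2) Λ₁₁
      fun q => Sig q.1 q.2 q.2 :=
    errorLimit_of_groupCov hh hreg harr (fun m s => hprod s.1 s.2) (fun m s => hε4 s.1 s.2) hΛ
  have hL : Λ₁₁.PosSemidef :=
    posSemidef_of_tendsto (hreg.mono fun m hr => posSemidef_scaledMeanCov hr hSig) hΛ
  have hσ : ∀ q : Fin a × Fin p, 0 < Sig q.1 q.2 q.2 := fun q => hSigdiag q.1 q.2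
  have hτ : ∃ M, IsMultiplierArray P τ M := by
    by_cases ha : Nonempty (Fin a)
    · obtain ⟨i₀⟩ := ha
      refine ⟨∫ ω, τ i₀ 0 ω ^ 4 ∂P, hτmeas, hτindep, hτ4, hτmean, fun i j => ?_, fun i j => ?_⟩
      · rw [← variance_of_integral_eq_zero (hτmeas i j).aemeasurable (hτmean i j), hτvar]
      · exact ((hτid i j i₀ 0).comp (measurable_id.pow_const 4)).integral_eq
    · exact ⟨0, hτmeas, hτindep, hτ4, hτmean, fun i => (ha ⟨i⟩).elim, fun i => (ha ⟨i⟩).elim⟩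
  obtain ⟨M, hτ⟩ := hτ
  set ν : Measure ℝ := limitLaw T Λ₁₁ fun q => κ q.1 * Sig q.1 q.2 q.2 with hν
  have hprob : IsProbabilityMeasure ν := Measure.isProbabilityMeasure_map
    (he.tendsto_mancats hL hσ hh hreg hN hκ hratio hTt hTT).aemeasurable_limit
  have hatom : ∀ x, ν {x} = 0 :=
    waldForm_gaussian_eq_zero hTt hTT hL hnondeg fun q => mul_pos (hκ q.1) (hσ q)
  -- the law of the statistic under the hypothesis
  have hlaw : ∀ β : Param a c p, T *ᵥ meanPart β = 0 → ∀ δ > 0, ∀ᶠ m in atTop, ∀ x,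
      |P.real {ω | mancats (n m) z T (dataVec (n m) z ε β ω) ≤ x} - ν.real (Set.Iic x)| ≤ δ := by
    intro β hβ δ hδ
    filter_upwards [he.eventually_abs_law_sub_le hL hσ hh hreg hN hκ hratio hTt hTT hnondeg hδ,
      hreg] with m hm hr x
    have hx := hm x
    have hmeas : Measurable fun ω =>
        mancats (n m) z T (stack (fun s : Subj (n m) => ε s.1 s.2) ω) :=
      (measurable_mancats T).comp (measurable_stack (harr m).measurable)
    rw [map_measureReal_apply hmeas measurableSet_Iic] at hx
    simp only [dataVec_eq, mancats_add_mulVec hr.det_isUnit hβ]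
    exact hx
  -- the conditional law of the bootstrap statistic
  have hcond : ∀ (β : Param a c p), ∀ δ > 0, Tendsto (fun m => P.real {ω | ∃ x, δ <
      |(wildCondLaw (n m) z P ε τ T β (dataVec (n m) z ε β ω)).real (Set.Iic x) -
        ν.real (Set.Iic x)|}) atTop (𝓝 0) := by
    intro β δ hδ
    refine (he.tendsto_measureReal_wildLaw hL hσ hh hreg hN hκ hratio hTt hTT hnondeg hτ
      hδ).congr' ?_
    filter_upwards [hreg] with m hr
    refine measureReal_congr ?_
    filter_upwards [wildCondLaw_ae_eq (n m) z hεmeas hτmeas hτε T β] with ω hω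
    simp only [wildMancats_dataVec hr.det_isUnit] at hω
    change (∃ x, _) = (∃ x, _)
    rw [hω]
  constructor
  · intro β β₀ hβ₀
    rw [tendstoInMeasure_iff_measureReal_norm]
    intro η hη
    refine squeeze_zero' (Eventually.of_forall fun _ => measureReal_nonneg) ?_
      (hcond β (η / 3) (by positivity))
    filter_upwards [hlaw β₀ hβ₀ (η / 3) (by positivity)] with m hm
    refine measureReal_mono fun ω hω => ?_
    by_contra hn
    have hle : ∀ x, |(wildCondLaw (n m) z P ε τ T β (dataVec (n m) z ε β ω)).real (Set.Iic x) -
        P.real {ω' | mancats (n m) z T (dataVec (n m) z ε β₀ ω') ≤ x}| ≤ 2 * η / 3 := fun x => by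
      have h1 := not_lt.mp fun hx => hn ⟨x, hx⟩
      have h2 := hm x
      rw [abs_sub_comm] at h2
      refine (abs_sub_le _ (ν.real (Set.Iic x)) _).trans ?_
      linarith
    have h0 := hω.out
    rw [sub_zero, Real.norm_of_nonneg (Real.iSup_nonneg fun x => abs_nonneg _)] at h0
    linarith [ciSup_le hle]
  · intro β hβ α h0 h1
    have : ∀ m ω, IsProbabilityMeasure
        (wildCondLaw (n m) z P ε τ T β (dataVec (n m) z ε β ω)) := fun m ω => by
      unfold wildCondLaw; infer_instance
    refine tendsto_measureReal_quantile_lt (ν := ν)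
      (fun m => (measurable_mancats T).comp (measurable_dataVec (n m) z hεmeas β)) hatom
      (fun x => ?_) (hcond β) h0 h1
    rw [Metric.tendsto_nhds]
    intro δ hδ
    filter_upwards [hlaw β hβ (δ / 2) (by positivity)] with m hm
    rw [Real.dist_eq]
    exact (hm x).trans_lt (half_lt_self hδ)
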